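/- Setting. Let $I=(a,b)\subset\mathbb R$ be an open interval ($-\infty\le a<b\le\infty$), $J=[-\tfrac12,\tfrac12]$, $t_0\in I$ and $\Omega=(t_0,T)\subset I$ with $t_0<T\le b$. A dynamic function on an open interval $I'$ assigns to each $t\in I'$ a function $g(t)(\cdot):J\to\mathbb R$; its value at $t$ is ordinary if this function is constant, and the ordinary part $\hat g$ is the ordinary function so defined at such $t$. One-sided limits in $t$ are meant uniformly in $s\in J$, with real constants as limits. $g$ is regulated if it is bounded, each $g(t)(\cdot)$ is a regulated function on $J$, and $g$ has one-sided limits at all points and at both ends of $I'$. It is in $s\mathbb G(I')$ if moreover each $g(t)(\cdot)$ is absolutely continuous with $g(t)(-\tfrac12)=g(t-)$ and $g(t)(\tfrac12)=g(t+)$. It is in $s\mathbb{BV}^{\rm loc}(I')$ if each $g(t)(\cdot)$ is absolutely continuous with these endpoint values and, on every compact subinterval of $I'$, $\hat g$ has bounded variation and the variations over $J$ of the non-ordinary values $g(t)(\cdot)$ have a finite sum. Test functions on $I'$ are the regulated dynamic functions with compact support in $I'$, and distributions are continuous linear functionals on them. A locally summable function $h$ acts by $(h,\varphi)=\int h\hat\varphi\,dt$;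 the delta-function with shape $\alpha$, $\int_J\alpha=1$, acts by $(\delta_\tau^\alpha,\varphi)=\int_J\alpha(s)\varphi(\tau)(s)\,ds$; products are defined by $(gv,\varphi)=(v,g\varphi)$; and for $g\in s\mathbb{BV}^{\rm loc}(I')$ the derivative is $(\dot g,\varphi)=\int\hat\varphi\,dg_c+\sum_{\tau}\int_J\varphi(\tau)(s)\,\partial_s g(\tau)(s)\,ds$, where $g_c$ is the continuous part of $\hat g$ and the sum is over the points of discontinuity $\tau$ of $g$. Vector-valued objects are treated componentwise, and $\langle\cdot,\cdot\rangle$ is the componentwise product. System. Let $N\subset\mathbb R^n$ be open. Consider $$\dot x=f(t,x)+g(t,x)v,\qquad v=w+\sum_{k=1}^\infty\langle c_k,\delta_{\tau_k}^{\alpha_k}\rangle, \qquad (*)$$ where $f:I\times N\to\mathbb R^n$ satisfies the Carathéodory conditions, is Lipschitz in $x$ with a constant independent of $t$, and is continuous in $t\in\Omega$; $g(\cdot,x)\in s\mathbb G(I)$ entrywise for each $x\in N$, and $g$ is Lipschitz in $x$ with a constant independent of $t\in I$ and $s\in J$; $w:I\to\mathbb R^n$ is continuous; the $\tau_k\in I$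 are distinct; $c_k\in\mathbb R^n$; the shapes $\alpha_k:J\to\mathbb R^n$ are continuous with all components of integral $1$; and $v$ is a distribution on $I$ that has a primitive in $s\mathbb{BV}^{\rm loc}(I)$. A solution on an open interval $I'\subset I$ is an $x\in s\mathbb{BV}^{\rm loc}(I')$ with values $x(t)(s)\in N$ that satisfies $(*)$ in the sense of distributions on $I'$. It is non-continuable if it does not extend to a solution on a larger open interval in $I$. Suppose that for all $(t_1,x_1)\in I\times N$ there is a non-continuable solution, on an interval containing $t_1$, with $x(t_1-)=x_1$. Let $\eta_1,\dots,\eta_m:\mathbb R^n\to\mathbb R$ be continuously differentiable, with gradients $\dot\eta_i$, let $M=\{x\in\mathbb R^n:\eta_i(x)\le 0,\ 1\le i\le m\}$, suppose $M\subset N$, and put $L_x=\{i:\eta_i(x)=0\}$. Corollary. Suppose that for every $x\in\partial M$ the vectors $\dot\eta_i(x)$, $i\in L_x$, are linearly independent, and that for all $x\in\partial M$ and $i\in L_x$ $$\bigl(\dot\eta_i(x),\,f(t,x)+\hat g(t,x)w(t)\bigr)\le 0$$ for all $t\in\Omega$ at which $\hat g(\cdot,x)$ is defined, and $$\bigl(\dot\eta_i(x),\,g(\tau_k,x)(s)\langle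 c_k,\alpha_k(s)\rangle\bigr)\le 0$$ for all $s\in J$ and all $k\in\mathbb N$. Then $M$ has the property of viability for $(*)$ on $\Omega$: every solution of $(*)$ on an open interval containing $t_0$ with $x(t_0-)\in M$ satisfies $x(t)(s)\in M$ for all $s\in J$ and all $t\in\Omega\cup\{t_0\}$ at which it is defined, and every such solution that is non-continuable is defined on the whole of $\Omega$. -/

import Mathlib

open Set Filter Topology MeasureTheory

namespace DynamicODE

noncomputable section

/-! ## Dynamic functions -/

/-- The open interval `(a, b)` of the real line; the endpoints may be infinite. -/
def openInterval (a b : EReal) : Set ℝ := {t | a < (t : EReal) ∧ (t : EReal) < b}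

/-- The parameter interval `J = [-1/2, 1/2]`. -/
def J : Set ℝ := Icc (-1 / 2) (1 / 2)

/-- A dynamic function `g` assigns to every time `t` a function `g t : J → ℝ` (its dynamic value).
Times outside the interval under consideration and parameters outside `J` are never used. -/
abbrev DynFun := ℝ → ℝ → ℝ

/-- The dynamic value at `t` is an ordinary value, i.e. constant on `J`. -/
def IsOrdinaryAt (g : DynFun) (t : ℝ) : Prop := ∀ s ∈ J, ∀ s' ∈ J, g t s = g t s'

/-- The ordinary part. It is meaningful at the times where `g` has an ordinary value; for regulated
dynamic functions these are all times outside a countable set. -/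
def ordPart (g : DynFun) (t : ℝ) : ℝ := g t 0

/-- `g` tends to the constant `c` along `l`, uniformly in the parameter `s ∈ J`. -/
def HasDynLimit (g : DynFun) (l : Filter ℝ) (c : ℝ) : Prop :=
  TendstoUniformlyOn g (fun _ => c) l J

/-- Regulated functions on the closed interval `J`. -/
structure IsRegulatedOnJ (β : ℝ → ℝ) : Prop where
  bounded : ∃ C : ℝ, ∀ s ∈ J, |β s| ≤ C
  left_lim : ∀ s ∈ J, s ≠ -1 / 2 → ∃ c : ℝ, Tendsto β (𝓝[<] s) (𝓝 c)
  right_lim : ∀ s ∈ J, s ≠ 1 / 2 → ∃ c : ℝ, Tendsto β (𝓝[>] s) (𝓝 c)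

/-- Regulated dynamic functions on `(a, b)`: bounded, with regulated dynamic values, and with
one-sided limits at all points of the interval and at both of its (possibly infinite) ends. -/
structure IsRegulated (a b : EReal) (g : DynFun) : Prop where
  bounded : ∃ C : ℝ, ∀ t ∈ openInterval a b, ∀ s ∈ J, |g t s| ≤ C
  value_regulated : ∀ t ∈ openInterval a b, IsRegulatedOnJ (g t)
  left_lim : ∀ t ∈ openInterval a b, ∃ c : ℝ, HasDynLimit g (𝓝[<] t) c
  right_lim : ∀ t ∈ openInterval a b, ∃ c : ℝ, HasDynLimit g (𝓝[>] t) c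
  lim_left_end : ∃ c : ℝ, HasDynLimit g (comap (fun t : ℝ => (t : EReal)) (𝓝[>] a)) c
  lim_right_end : ∃ c : ℝ, HasDynLimit g (comap (fun t : ℝ => (t : EReal)) (𝓝[<] b)) c

/-- Every dynamic value on `(a, b)` is an absolutely continuous path on `J` which runs from the
left limit to the right limit: `g(t)(-1/2) = g(t-)` and `g(t)(1/2) = g(t+)`. -/
structure JoinsLimits (a b : EReal) (g : DynFun) : Prop where
  value_ac : ∀ t ∈ openInterval a b, AbsolutelyContinuousOnInterval (g t) (-1 / 2) (1 / 2)
  left_lim : ∀ t ∈ openInterval a b, HasDynLimit g (𝓝[<] t) (g t (-1 / 2))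
  right_lim : ∀ t ∈ openInterval a b, HasDynLimit g (𝓝[>] t) (g t (1 / 2))

/-- The class `s𝔾(a, b)`. -/
structure IsSG (a b : EReal) (g : DynFun) : Prop where
  regulated : IsRegulated a b g
  joins : JoinsLimits a b g

/-- The class `s𝔹𝕍ˡᵒᶜ(a, b)` of dynamic functions of locally bounded variation: on compact
subintervals the ordinary part has bounded variation and the variations of the dynamic values that
are not ordinary have a finite sum. -/
structure IsSBVLoc (a b : EReal) (g : DynFun) : Prop where
  joins : JoinsLimits a b g
  ord_bv : LocallyBoundedVariationOn (ordPart g) {t | t ∈ openInterval a b ∧ IsOrdinaryAt g t}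
  sum_var : ∀ c ∈ openInterval a b, ∀ d ∈ openInterval a b,
    ∑' t : {t : ℝ // t ∈ Icc c d ∧ ¬ IsOrdinaryAt g t}, eVariationOn (g t) J < ⊤

/-! ## Distributions with dynamic test functions -/

/-- A dynamic test function on `(a, b)`: a regulated dynamic function that vanishes outside a compact
subinterval `[lo, hi]` of `(a, b)`. -/
structure TestFun (a b : EReal) where
  toFun : DynFun
  lo : ℝ
  hi : ℝ
  lo_mem : lo ∈ openInterval a b
  hi_mem : hi ∈ openInterval a b
  regulated : IsRegulated a b toFun
  eq_zero : ∀ t, t ∉ Icc lo hi → ∀ s ∈ J, toFun t s = 0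

/-- The regular distribution given by the ordinary function `h` on `(a, b)`. -/
def regularPairing (a b : EReal) (h : ℝ → ℝ) (ψ : DynFun) : ℝ :=
  ∫ t in openInterval a b, h t * ordPart ψ t

/-- The delta-function at `τ` with shape `α`. -/
def deltaPairing (τ : ℝ) (α : ℝ → ℝ) (ψ : DynFun) : ℝ :=
  ∫ s in (-1 / 2 : ℝ)..(1 / 2), α s * ψ τ s

/-- The jump `g(τ+) - g(τ-)` of a dynamic function that joins its limits. -/
def jump (g : DynFun) (τ : ℝ) : ℝ := g τ (1 / 2) - g τ (-1 / 2)

/-- The continuous part on `[c, d]` (extended by constants outside `[c, d]`) of a dynamic function of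
locally bounded variation: the left limit `g(r-)` minus the sum of the jumps in `[c, r)`. It is
normalized to have the value `g(c-)` at `c`. -/
def continuousPart (g : DynFun) (c d : ℝ) (t : ℝ) : ℝ :=
  g (max c (min t d)) (-1 / 2) -
    ∑' τ : {τ : ℝ // c ≤ τ ∧ τ < max c (min t d) ∧ ¬ IsOrdinaryAt g τ}, jump g τ

open Classical in
/-- The Stieltjes integral `∫ φ dh` against a function `h` of bounded variation on `ℝ`. -/
def stieltjesIntegral (φ h : ℝ → ℝ) : ℝ :=
  if hh : BoundedVariationOn h univ then ∫ᵛ t, φ t ∂•hh.vectorMeasure else 0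

/-- The value `(ġ, φ)` of the distributional derivative of `g ∈ s𝔹𝕍ˡᵒᶜ(a, b)` at the test function
`φ`. The points of discontinuity of `g` are the points at which its value is not ordinary. -/
def derivPairing {a b : EReal} (g : DynFun) (φ : TestFun a b) : ℝ :=
  stieltjesIntegral (ordPart φ.toFun) (continuousPart g φ.lo φ.hi) +
    ∑' τ : {τ : ℝ // τ ∈ openInterval a b ∧ ¬ IsOrdinaryAt g τ},
      ∫ s in (-1 / 2 : ℝ)..(1 / 2), φ.toFun τ s * deriv (g τ) s

/-! ## Systems with distributions -/

/-- The data of the system `ẋ = f(t, x) + g(t, x) v`, `v = w + ∑ₖ ⟨cₖ, δ_{τₖ}^{αₖ}⟩` on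
`(left, right) × N`. Here `g t x s` is the dynamic value of `g` at `(t, x)`. -/
structure ImpulsiveSystem (n : ℕ) where
  left : EReal
  right : EReal
  N : Set (Fin n → ℝ)
  f : ℝ → (Fin n → ℝ) → (Fin n → ℝ)
  g : ℝ → (Fin n → ℝ) → ℝ → Matrix (Fin n) (Fin n) ℝ
  w : ℝ → Fin n → ℝ
  c : ℕ → Fin n → ℝ
  τ : ℕ → ℝ
  α : ℕ → ℝ → Fin n → ℝ

namespace ImpulsiveSystem

variable {n : ℕ}

/-- The time interval `I` of the system. -/
def I (S : ImpulsiveSystem n) : Set ℝ := openInterval S.left S.right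

/-- The `j`-th component of the distribution `v`. -/
def vPairing (S : ImpulsiveSystem n) (j : Fin n) (ψ : DynFun) : ℝ :=
  regularPairing S.left S.right (fun t => S.w t j) ψ +
    ∑' k : ℕ, S.c k j * deltaPairing (S.τ k) (fun s => S.α k s j) ψ

/-- The assumptions on the right-hand side; `Ω` is the interval on which viability is studied. -/
structure StandingAssumptions (S : ImpulsiveSystem n) (Ω : Set ℝ) : Prop where
  isOpen_N : IsOpen S.N
  /-- Carathéodory conditions (continuity in `x` is part of the Lipschitz condition). -/
  f_meas : ∀ x ∈ S.N, AEStronglyMeasurable (fun t => S.f t x) (volume.restrict S.I)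
  f_bound : ∀ K : Set (ℝ × (Fin n → ℝ)), IsCompact K → K ⊆ S.I ×ˢ S.N →
    ∃ r : ℝ → ℝ, IntegrableOn r S.I ∧ ∀ p ∈ K, ‖S.f p.1 p.2‖ ≤ r p.1
  f_lip : ∃ K : NNReal, ∀ t ∈ S.I, LipschitzOnWith K (S.f t) S.N
  f_cont : ∀ x ∈ S.N, ContinuousOn (fun t => S.f t x) Ω
  g_sG : ∀ x ∈ S.N, ∀ i j, IsSG S.left S.right (fun t s => S.g t x s i j)
  g_lip : ∃ K : NNReal, ∀ t ∈ S.I, ∀ s ∈ J, ∀ i j, LipschitzOnWith K (fun x => S.g t x s i j) S.N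
  w_cont : ContinuousOn S.w S.I
  τ_mem : ∀ k, S.τ k ∈ S.I
  τ_inj : Function.Injective S.τ
  α_cont : ∀ k, ContinuousOn (S.α k) J
  α_integral : ∀ k i, ∫ s in (-1 / 2 : ℝ)..(1 / 2), S.α k s i = 1
  /-- The series that defines `v` converges weakly, and `v` has a primitive of locally bounded
  variation. -/
  series_conv : ∀ (φ : TestFun S.left S.right) (i : Fin n),
    Summable fun k : ℕ => S.c k i * deltaPairing (S.τ k) (fun s => S.α k s i) φ.toFun
  primitive : ∃ u : ℝ → ℝ → (Fin n → ℝ), ∀ i,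
    IsSBVLoc S.left S.right (fun t s => u t s i) ∧
    ∀ φ : TestFun S.left S.right, derivPairing (fun t s => u t s i) φ = S.vPairing i φ.toFun

/-- `x` is a solution of the system on the open interval `(a, b) ⊆ I`: it is of locally bounded
variation, has values in `N`, and satisfies the equation as an equality of distributions on `(a, b)`;
the product of `g(·, x)` and `v` is tested as `(g v, φ) = (v, g φ)`. -/
structure IsSolution (S : ImpulsiveSystem n) (a b : EReal) (x : ℝ → ℝ → (Fin n → ℝ)) : Prop where
  le_left : S.left ≤ a
  lt : a < b
  le_right : b ≤ S.right
  sbv : ∀ i, IsSBVLoc a b (fun t s => x t s i)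
  mem : ∀ t ∈ openInterval a b, ∀ s ∈ J, x t s ∈ S.N
  eq : ∀ (φ : TestFun a b) (i : Fin n),
    derivPairing (fun t s => x t s i) φ =
      regularPairing a b (fun t => S.f t (x t 0) i) φ.toFun +
        ∑ j, S.vPairing j (fun t s => S.g t (x t s) s i j * φ.toFun t s)

/-- `x` is a solution on `(a, b) ∋ t₀` with the initial value `x(t₀-) = x₀`. -/
structure IsSolutionFrom (S : ImpulsiveSystem n) (a b : EReal) (x : ℝ → ℝ → (Fin n → ℝ))
    (t₀ : ℝ) (x₀ : Fin n → ℝ) : Prop where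
  isSolution : S.IsSolution a b x
  time_mem : t₀ ∈ openInterval a b
  init : ∀ i, HasDynLimit (fun t s => x t s i) (𝓝[<] t₀) (x₀ i)

/-- `x` is a solution on `(a, b)` that has no extension to a solution on a larger open interval. -/
def IsNoncontinuable (S : ImpulsiveSystem n) (a b : EReal) (x : ℝ → ℝ → (Fin n → ℝ)) : Prop :=
  S.IsSolution a b x ∧
    ∀ (a' b' : EReal) (y : ℝ → ℝ → (Fin n → ℝ)), S.IsSolution a' b' y → a' ≤ a → b ≤ b' →
      (∀ t ∈ openInterval a b, ∀ s ∈ J, y t s = x t s) → a' = a ∧ b' = b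

/-- The initial value problem has a non-continuable solution for all initial data in `I × N`. -/
def HasNoncontinuableSolutions (S : ImpulsiveSystem n) : Prop :=
  ∀ t₁ ∈ S.I, ∀ x₁ ∈ S.N, ∃ (a b : EReal) (x : ℝ → ℝ → (Fin n → ℝ)),
    S.IsSolutionFrom a b x t₁ x₁ ∧ S.IsNoncontinuable a b x

/-- `M` has the property of viability on `Ω = (t₀, T)`: every solution with `x(t₀-) ∈ M` satisfies
`x(t)(s) ∈ M` for all `s ∈ J` and all `t ∈ Ω ∪ {t₀}` at which it is defined, and every non-continuable
one is defined on the whole of `Ω`. -/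
def HasViability (S : ImpulsiveSystem n) (t₀ : ℝ) (T : EReal) (M : Set (Fin n → ℝ)) : Prop :=
  ∀ (a b : EReal) (x : ℝ → ℝ → (Fin n → ℝ)) (x₀ : Fin n → ℝ),
    S.IsSolutionFrom a b x t₀ x₀ → x₀ ∈ M →
      (∀ t : ℝ, t = t₀ ∨ t ∈ openInterval t₀ T → t ∈ openInterval a b → ∀ s ∈ J, x t s ∈ M) ∧
      (S.IsNoncontinuable a b x → openInterval t₀ T ⊆ openInterval a b)

end ImpulsiveSystem

/-- The set `{x : η₁(x) ≤ 0, …, ηₘ(x) ≤ 0}`. -/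
def constraintSet {n m : ℕ} (η : Fin m → (Fin n → ℝ) → ℝ) : Set (Fin n → ℝ) :=
  {x | ∀ i, η i x ≤ 0}

end

end DynamicODE

namespace DynamicODE

noncomputable section

/-! ## Functions of bounded variation and Stieltjes integrals -/

/-! The distributional equation is equivalent to an integral equation for the increments of `x`
between two points `(t, s)` of the lexicographically ordered set of times and parameters: the
increment is the integral of the drift `f + g w` over the elapsed time plus, for each impulse, the
integral of `g ⟨c, α⟩` over the part of `J` passed in between (`flow`). Ordinary indicators of `[c,
d]` and step functions of `s` at a single time are enough test functions to derive it
(`IsSolution.isPathSolution`); conversely it gives back bounded variation and the equation for all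
test functions (`IsPathSolution.isSolution`). The sums converge because a primitive of `v` has
values whose variations are summable on compact intervals, and these variations dominate the masses
of the impulses (`summable_mass`). Everything is measured by the clock `θ`, the elapsed time plus
the mass of the impulses passed.

For viability, let `D` be the distance of `x(t)(s)` to `M`, suppose `D > 0`, and let `y ∈ M` be a
nearest point. Let `v` be the increment, over a short step, of the system frozen at `y`. The two
inequalities integrate to `η_i'(y) v ≤ 0` for the active `i`. Linear independence of the active
gradients yields a direction `e` with `η_i'(y) e = -1`; a correction of `v` by a small multiple of
`‖v‖ e` leads into `M`, so `y + v` has distance `o(‖v‖)` from `M` (`eventually_infDist_le`). Since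
the system is Lipschitz, `x` moves like `y + v` up to `D + 2LD Δθ`. Hence the new distance is at
most `D (1 + (2L + 1) Δθ)`. A continuous induction in the lexicographic order, with `1 + z ≤ exp z`,
shows that `D exp(-(2L + 1) θ)` never exceeds any `A > 0`, so `D = 0` (`mul_exp_le_of_step`,
`mem_constraintSet`).

For the continuation, suppose a non-continuable solution ends at `β < T`. The same Gronwall scheme
applied to `1 + ‖x - y‖` bounds the solution before `β`, so it has a limit `ξ` there
(`exists_limit`). As `M` is closed and contained in `N`, `ξ` is an admissible initial value. The
solution that starts from it at `β` can be glued on (`glue`), which contradicts non-continuability.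
-/

theorem eVariationOn_le_of_dist_le {h m : ℝ → ℝ} {s : Set ℝ}
    (hm : ∀ t ∈ s, ∀ t' ∈ s, t ≤ t' → |h t' - h t| ≤ m t' - m t) :
    eVariationOn h s ≤ eVariationOn m s := by
  refine iSup_mono fun p => Finset.sum_le_sum fun i _ => ?_
  rw [edist_dist, edist_dist, Real.dist_eq, Real.dist_eq]
  exact ENNReal.ofReal_le_ofReal ((hm _ (p.2.2.2 i) _ (p.2.2.2 (i + 1))
    (p.2.2.1 (Nat.le_succ i))).trans (le_abs_self _))

theorem boundedVariationOn_of_dist_le {h m : ℝ → ℝ} {s : Set ℝ} {C : ℝ}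
    (hm : ∀ t ∈ s, ∀ t' ∈ s, t ≤ t' → |h t' - h t| ≤ m t' - m t)
    (hC : ∀ t ∈ s, |m t| ≤ C) : BoundedVariationOn h s := by
  have mono : MonotoneOn m s := fun t ht t' ht' htt' => by
    have := (abs_nonneg _).trans (hm t ht t' ht' htt')
    linarith
  exact ((eVariationOn_le_of_dist_le hm).trans_lt (mono.boundedVariationOn hC).lt_top).ne

instance isFiniteMeasure_variation_signedMeasure (μ : SignedMeasure ℝ) :
    IsFiniteMeasure μ.variation := by
  rw [← SignedMeasure.totalVariation_eq_variation]
  unfold SignedMeasure.totalVariation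
  infer_instance

/-- The Stieltjes measure of `[c, d]` is `h(d+) - h(c-)`, and continuity removes the one-sided
limits. With `c = d` it shows that the continuous part does not charge points. -/
theorem stieltjesIntegral_indicator_Icc {h : ℝ → ℝ} (hc : Continuous h)
    (hb : BoundedVariationOn h univ) {c d : ℝ} (hcd : c ≤ d) (r : ℝ) :
    stieltjesIntegral ((Icc c d).indicator fun _ => r) h = r * (h d - h c) := by
  have hfin : IsFiniteMeasure (VectorMeasure.restrict hb.vectorMeasure (Icc c d)).variation :=
    isFiniteMeasure_variation_signedMeasure _
  rw [stieltjesIntegral, dif_pos hb, VectorMeasure.integral_indicator measurableSet_Icc,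
    VectorMeasure.integral_const]
  rw [VectorMeasure.restrict_apply _ measurableSet_Icc MeasurableSet.univ, univ_inter,
    hb.vectorMeasure_Icc hcd, hc.continuousWithinAt.rightLim_eq, hc.continuousWithinAt.leftLim_eq]
  simp

/-- The signed measure is the difference of the finite measures with densities `max F 0` and `max
(-F) 0`. A bounded `φ` is integrable against both, so the integral splits. -/
theorem integral_withDensityᵥ_eq {F φ : ℝ → ℝ} {C : ℝ} (hF : Integrable F)
    (hφ : AEStronglyMeasurable φ) (hC : ∀ t, ‖φ t‖ ≤ C) :
    ∫ᵛ t, φ t ∂•((volume : Measure ℝ).withDensityᵥ F) = ∫ t, φ t * F t := by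
  have key : ∀ G : ℝ → ℝ, Integrable G → ∃ hfin : IsFiniteMeasure
      ((volume : Measure ℝ).withDensity fun x => ENNReal.ofReal (G x)),
      (((volume : Measure ℝ).withDensity fun x => ENNReal.ofReal (G x)).toSignedMeasure.Integrable φ)
      ∧ ∫ᵛ t, φ t ∂•((volume : Measure ℝ).withDensity fun x =>
          ENNReal.ofReal (G x)).toSignedMeasure = ∫ t, max (G t) 0 * φ t := by
    intro G hG
    have hfin : IsFiniteMeasure ((volume : Measure ℝ).withDensity fun x => ENNReal.ofReal (G x)) :=
      isFiniteMeasure_withDensity_ofReal hG.2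
    refine ⟨hfin, ?_, ?_⟩
    · rw [VectorMeasure.Integrable, Measure.variation_toSignedMeasure]
      exact Integrable.of_bound (hφ.mono_ac (withDensity_absolutelyContinuous _ _)) C
        (Eventually.of_forall hC)
    -- Multiplication is commutative, so the pairing equals its flip, to which
    -- `VectorMeasure.integral_toSignedMeasure` applies.
    · have hflip : (ContinuousLinearMap.lsmul ℝ ℝ : ℝ →L[ℝ] ℝ →L[ℝ] ℝ) =
          (ContinuousLinearMap.lsmul ℝ ℝ : ℝ →L[ℝ] ℝ →L[ℝ] ℝ).flip := by
        ext; simp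
      rw [hflip, VectorMeasure.integral_toSignedMeasure,
        integral_withDensity_eq_integral_toReal_smul₀ hG.aemeasurable.ennreal_ofReal
          (Eventually.of_forall fun _ => ENNReal.ofReal_lt_top)]
      refine integral_congr_ae (Eventually.of_forall fun t => ?_)
      simp [ENNReal.toReal_ofReal']
  obtain ⟨f1, i1, e1⟩ := key F hF
  obtain ⟨f2, i2, e2⟩ := key (fun t => -F t) hF.neg
  have hd : (volume : Measure ℝ).withDensityᵥ F =
      ((volume : Measure ℝ).withDensity fun x => ENNReal.ofReal (F x)).toSignedMeasure -
      ((volume : Measure ℝ).withDensity fun x => ENNReal.ofReal (-F x)).toSignedMeasure :=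
    withDensityᵥ_eq_withDensity_pos_part_sub_withDensity_neg_part hF
  rw [hd, VectorMeasure.integral_sub_vectorMeasure i1 i2, e1, e2, ← integral_sub]
  · refine integral_congr_ae (Eventually.of_forall fun t => ?_)
    have := max_zero_sub_max_neg_zero_eq_self (F t)
    simp only
    rw [← sub_mul, this, mul_comm]
  · exact hF.pos_part.mul_bdd hφ (Eventually.of_forall hC)
  · exact hF.neg.pos_part.mul_bdd hφ (Eventually.of_forall hC)

/-- The clamping of `t` to `[lo, hi]` makes `h` a primitive on the whole line of `F` cut off outside
`(lo, hi]`. Hence its Stieltjes measure and the measure with that density agree on closed intervals,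
a π-system that generates the Borel sets. -/
theorem stieltjesIntegral_eq_integral {h F φ : ℝ → ℝ} {lo hi C : ℝ} (hlohi : lo ≤ hi)
    (hF : IntervalIntegrable F volume lo hi)
    (hh : ∀ t, h t = h lo + ∫ r in lo..max lo (min t hi), F r)
    (hφ : AEStronglyMeasurable φ) (hC : ∀ t, ‖φ t‖ ≤ C) :
    stieltjesIntegral φ h = ∫ t in lo..hi, F t * φ t := by
  set G := (Ioc lo hi).indicator F with hG
  have hFi : IntegrableOn F (Ioc lo hi) := (intervalIntegrable_iff_integrableOn_Ioc_of_le hlohi).1 hF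
  have hGi : Integrable G := (integrable_indicator_iff measurableSet_Ioc).2 hFi
  have hGdiff : ∀ c d, c ≤ d → h d - h c = ∫ r in c..d, G r := by
    have base : ∀ t, h t = h lo + ∫ r in lo..t, G r := by
      intro t
      rw [hh t]
      congr 1
      rcases le_total t lo with ht | ht
      · have : max lo (min t hi) = lo := max_eq_left ((min_le_left _ _).trans ht)
        rw [this, intervalIntegral.integral_same, intervalIntegral.integral_of_ge ht,
          hG, setIntegral_indicator measurableSet_Ioc, Ioc_inter_Ioc]
        simp [ht]
      · have hmm : max lo (min t hi) = min t hi := max_eq_right (le_min ht hlohi)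
        rw [hmm, intervalIntegral.integral_of_le (le_min ht hlohi),
          intervalIntegral.integral_of_le ht, hG, setIntegral_indicator measurableSet_Ioc,
          Ioc_inter_Ioc]
        simp
    intro c d _
    rw [base d, base c, add_sub_add_left_eq_sub,
      intervalIntegral.integral_interval_sub_left hGi.intervalIntegrable hGi.intervalIntegrable]
  have hcont : Continuous h := by
    have : h = fun t => h 0 + ∫ r in (0:ℝ)..t, G r := by
      funext t
      rcases le_total 0 t with ht | ht
      · rw [← hGdiff 0 t ht]; ring
      · rw [intervalIntegral.integral_symm, ← hGdiff t 0 ht]; ring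
    rw [this]
    exact continuous_const.add (intervalIntegral.continuous_primitive
      (fun _ _ => hGi.intervalIntegrable) 0)
  have hbv : BoundedVariationOn h univ := by
    refine boundedVariationOn_of_dist_le (m := fun t => ∫ r in lo..t, |G r|)
      (C := ∫ r, |G r|) (fun t _ t' _ htt' => ?_) fun t _ => ?_
    · rw [hGdiff t t' htt', intervalIntegral.integral_interval_sub_left
        hGi.abs.intervalIntegrable hGi.abs.intervalIntegrable]
      exact intervalIntegral.abs_integral_le_integral_abs htt'
    · have h1 := intervalIntegral.norm_integral_le_integral_norm_uIoc (f := fun r => |G r|)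
        (a := lo) (b := t) (μ := volume)
      rw [Real.norm_eq_abs] at h1
      refine h1.trans ?_
      simp only [Real.norm_eq_abs, abs_abs]
      exact setIntegral_le_integral hGi.abs (Eventually.of_forall fun _ => abs_nonneg _)
  have hmeas : hbv.vectorMeasure = (volume : Measure ℝ).withDensityᵥ G := by
    have hIoc : ∀ c d, c ≤ d → hbv.vectorMeasure (Icc c d) =
        ((volume : Measure ℝ).withDensityᵥ G) (Icc c d) := by
      intro c d hcd
      rw [hbv.vectorMeasure_Icc hcd, hcont.continuousWithinAt.rightLim_eq,
        hcont.continuousWithinAt.leftLim_eq, withDensityᵥ_apply hGi measurableSet_Icc,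
        hGdiff c d hcd, intervalIntegral.integral_of_le hcd, integral_Icc_eq_integral_Ioc]
    refine VectorMeasure.ext_of_generateFrom {S : Set ℝ | ∃ l u, l ≤ u ∧ Icc l u = S} ?_ ?_ ?_ ?_
    · rintro _ ⟨l, u, hlu, rfl⟩
      exact hIoc l u hlu
    · rw [← borel_eq_generateFrom_Icc ℝ]
      exact BorelSpace.measurable_eq
    · exact isPiSystem_Icc (id : ℝ → ℝ) (id : ℝ → ℝ)
    -- For signed measures the extension from a π-system also needs equality on the whole line,
    -- obtained here as a limit over `[-n, n]`.
    · have hU : (univ : Set ℝ) = ⋃ n : ℕ, Icc (-(n : ℝ)) n := by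
        symm
        refine eq_univ_of_forall fun x => ?_
        obtain ⟨n, hn⟩ := exists_nat_ge |x|
        exact mem_iUnion.2 ⟨n, abs_le.1 hn⟩
      have hmono : Monotone fun n : ℕ => Icc (-(n : ℝ)) n := fun i j hij =>
        Icc_subset_Icc (neg_le_neg (Nat.cast_le.2 hij)) (Nat.cast_le.2 hij)
      have t1 := VectorMeasure.tendsto_vectorMeasure_iUnion_atTop_nat (v := hbv.vectorMeasure)
        hmono fun i => measurableSet_Icc
      have t2 := VectorMeasure.tendsto_vectorMeasure_iUnion_atTop_nat
        (v := (volume : Measure ℝ).withDensityᵥ G) hmono fun i => measurableSet_Icc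
      rw [← hU] at t1 t2
      refine tendsto_nhds_unique t1 (t2.congr fun n => (hIoc _ _ ?_).symm)
      have : (0:ℝ) ≤ n := Nat.cast_nonneg n
      linarith
  rw [stieltjesIntegral, dif_pos hbv, hmeas, integral_withDensityᵥ_eq hGi hφ hC,
    intervalIntegral.integral_of_le hlohi, ← integral_indicator measurableSet_Ioc]
  refine integral_congr_ae (Eventually.of_forall fun t => ?_)
  by_cases ht : t ∈ Ioc lo hi <;> simp [hG, ht, mul_comm]

/-! ## Intervals -/

theorem isOpen_openInterval (a b : EReal) : IsOpen (openInterval a b) :=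
  (isOpen_lt continuous_const continuous_coe_real_ereal).inter
    (isOpen_lt continuous_coe_real_ereal continuous_const)

theorem openInterval_mono {a b a' b' : EReal} (ha : a' ≤ a) (hb : b ≤ b') :
    openInterval a b ⊆ openInterval a' b' :=
  fun _ ht => ⟨ha.trans_lt ht.1, ht.2.trans_le hb⟩

theorem Icc_subset_openInterval {a b : EReal} {c d : ℝ} (hc : c ∈ openInterval a b)
    (hd : d ∈ openInterval a b) : Icc c d ⊆ openInterval a b := fun _ ht =>
  ⟨hc.1.trans_le (EReal.coe_le_coe_iff.2 ht.1), (EReal.coe_le_coe_iff.2 ht.2).trans_lt hd.2⟩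

theorem neg_half_mem_J : (-1 / 2 : ℝ) ∈ J := by simp only [J, mem_Icc]; norm_num

theorem half_mem_J : (1 / 2 : ℝ) ∈ J := by simp only [J, mem_Icc]; norm_num

theorem zero_mem_J : (0 : ℝ) ∈ J := by simp only [J, mem_Icc]; norm_num

theorem uIcc_eq_J : uIcc (-1 / 2 : ℝ) (1 / 2) = J := uIcc_of_le (by norm_num)

theorem isCompact_J : IsCompact J := isCompact_Icc

/-- Every point of `U` has a neighbourhood that meets `B` at most in that point; by the Lindelöf
property countably many of these neighbourhoods cover `U`. -/
theorem countable_inter_of_eventually_notMem {U B : Set ℝ}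
    (h : ∀ t ∈ U, ∀ᶠ r in 𝓝[≠] t, r ∉ B) : (U ∩ B).Countable := by
  obtain ⟨T, hTU, hT, hcov⟩ := TopologicalSpace.countable_cover_nhdsWithin
    (f := fun t => {r | r ≠ t → r ∉ B}) (s := U)
    (fun t ht => mem_nhdsWithin_of_mem_nhds (eventually_nhdsWithin_iff.1 (h t ht)))
  refine hT.mono fun r hr => ?_
  obtain ⟨t, htT, htr⟩ := mem_iUnion₂.1 (hcov hr.1)
  by_cases hrt : r = t
  · exact hrt ▸ htT
  · exact absurd hr.2 (htr hrt)

/-- The points where the oscillation is not below `1 / (n + 1)` are isolated: on either side of `t`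
all values are eventually close to a one-sided limit, hence close to each other. -/
theorem countable_not_continuousAt_of_oneSided {u : ℝ → ℝ} {U : Set ℝ}
    (hl : ∀ t ∈ U, ∃ c, Tendsto u (𝓝[<] t) (𝓝 c))
    (hr : ∀ t ∈ U, ∃ c, Tendsto u (𝓝[>] t) (𝓝 c)) :
    {t | t ∈ U ∧ ¬ ContinuousAt u t}.Countable := by
  set B : ℕ → Set ℝ := fun n => {t | ¬ ∀ᶠ r in 𝓝 t, dist (u r) (u t) < 1 / ((n : ℝ) + 1)} with hB
  have hsub : {t | t ∈ U ∧ ¬ ContinuousAt u t} ⊆ ⋃ n, U ∩ B n := by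
    intro t ht
    by_contra hcon
    refine ht.2 (Metric.tendsto_nhds.2 fun ε hε => ?_)
    obtain ⟨n, hn⟩ := exists_nat_one_div_lt hε
    have : t ∉ B n := fun h => hcon (mem_iUnion.2 ⟨n, ht.1, h⟩)
    exact (not_not.1 this).mono fun r h => h.trans hn
  refine (countable_iUnion fun n => countable_inter_of_eventually_notMem fun t ht => ?_).mono hsub
  have hpos : (0:ℝ) < 1 / ((n : ℝ) + 1) / 2 := by positivity
  have side : ∀ s : Set ℝ, IsOpen s → ∀ c, Tendsto u (𝓝[s] t) (𝓝 c) → ∀ᶠ r in 𝓝[s] t, r ∉ B n := by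
    intro s hs c hc
    have h1 : ∀ᶠ r in 𝓝[s] t, dist (u r) c < 1 / ((n : ℝ) + 1) / 2 := Metric.tendsto_nhds.1 hc _ hpos
    filter_upwards [eventually_eventually_nhdsWithin.2 h1, h1, self_mem_nhdsWithin] with r h2 h3 h4
    simp only [hB, mem_ofPred_eq, not_not]
    rw [hs.nhdsWithin_eq h4] at h2
    filter_upwards [h2] with q h5
    calc dist (u q) (u r) ≤ dist (u q) c + dist (u r) c := dist_triangle_right _ _ _
      _ < _ := by linarith
  obtain ⟨c, hc⟩ := hl t ht
  obtain ⟨c', hc'⟩ := hr t ht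
  rw [← Iio_union_Ioi, nhdsWithin_union, eventually_sup]
  exact ⟨side _ isOpen_Iio c hc, side _ isOpen_Ioi c' hc'⟩

theorem aestronglyMeasurable_of_countable {E : Type*} [NormedAddCommGroup E]
    [SecondCountableTopology E] {u : ℝ → E} {U : Set ℝ} (hU : IsOpen U)
    (h : {t | t ∈ U ∧ ¬ ContinuousAt u t}.Countable) :
    AEStronglyMeasurable u (volume.restrict U) := by
  set D := {t | t ∈ U ∧ ¬ ContinuousAt u t}
  have hc : ContinuousOn u (U \ D) := fun t ht => by
    have : ContinuousAt u t := by
      by_contra hcon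
      exact ht.2 ⟨ht.1, hcon⟩
    exact this.continuousWithinAt
  have h1 := hc.aestronglyMeasurable (μ := volume) (hU.measurableSet.diff h.measurableSet)
  rwa [Measure.restrict_congr_set
    (sdiff_null_ae_eq_self (h.measure_zero volume))] at h1

/-! ## Dynamic paths with values in a normed space -/

/-- Every value of `x` is a continuous path on `J` that runs from the left limit of `x` to its right
limit. -/
structure Joins {E : Type*} [NormedAddCommGroup E] (a b : EReal) (x : ℝ → ℝ → E) : Prop where
  cont : ∀ t ∈ openInterval a b, ContinuousOn (x t) J
  left : ∀ t ∈ openInterval a b, TendstoUniformlyOn x (fun _ => x t (-1 / 2)) (𝓝[<] t) J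
  right : ∀ t ∈ openInterval a b, TendstoUniformlyOn x (fun _ => x t (1 / 2)) (𝓝[>] t) J

theorem tendstoUniformlyOn_of_components {n : ℕ} {x : ℝ → ℝ → Fin n → ℝ} {c : Fin n → ℝ}
    {l : Filter ℝ} (h : ∀ i, HasDynLimit (fun t s => x t s i) l (c i)) :
    TendstoUniformlyOn x (fun _ => c) l J := by
  refine Metric.tendstoUniformlyOn_iff.2 fun ε hε => ?_
  have : ∀ᶠ t in l, ∀ i, ∀ s ∈ J, dist (c i) (x t s i) < ε :=
    eventually_all.2 fun i => Metric.tendstoUniformlyOn_iff.1 (h i) ε hε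
  filter_upwards [this] with t ht s hs
  exact (dist_pi_lt_iff hε).2 fun i => ht i s hs

theorem hasDynLimit_component {n : ℕ} {x : ℝ → ℝ → Fin n → ℝ} {c : Fin n → ℝ}
    {l : Filter ℝ} (h : TendstoUniformlyOn x (fun _ => c) l J) (i : Fin n) :
    HasDynLimit (fun t s => x t s i) l (c i) := by
  refine Metric.tendstoUniformlyOn_iff.2 fun ε hε => ?_
  filter_upwards [Metric.tendstoUniformlyOn_iff.1 h ε hε] with t ht s hs
  exact (dist_le_pi_dist _ _ i).trans_lt (ht s hs)

theorem JoinsLimits.joins {a b : EReal} {g : DynFun} (h : JoinsLimits a b g) : Joins a b g where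
  cont t ht := uIcc_eq_J ▸ (h.value_ac t ht).continuousOn
  left := h.left_lim
  right := h.right_lim

theorem joins_of_components {n : ℕ} {a b : EReal} {x : ℝ → ℝ → Fin n → ℝ}
    (h : ∀ i, JoinsLimits a b fun t s => x t s i) : Joins a b x where
  cont t ht := continuousOn_pi.2 fun i => (h i).joins.cont t ht
  left t ht := tendstoUniformlyOn_of_components fun i => (h i).left_lim t ht
  right t ht := tendstoUniformlyOn_of_components fun i => (h i).right_lim t ht

namespace Joins

variable {E : Type*} [NormedAddCommGroup E] {a b : EReal} {x : ℝ → ℝ → E}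

theorem mono {a' b' : EReal} (h : Joins a b x) (ha : a ≤ a') (hb : b' ≤ b) : Joins a' b' x where
  cont t ht := h.cont t (openInterval_mono ha hb ht)
  left t ht := h.left t (openInterval_mono ha hb ht)
  right t ht := h.right t (openInterval_mono ha hb ht)

/-- Near `t`, but off `t`, the values lie within distance 1 of an endpoint of the compact path `x
t`; compactness of `[c, d]` turns local bounds into a global one. -/
theorem exists_bound (h : Joins a b x) {c d : ℝ} (hc : c ∈ openInterval a b)
    (hd : d ∈ openInterval a b) : ∃ C, ∀ t ∈ Icc c d, ∀ s ∈ J, ‖x t s‖ ≤ C := by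
  have key : ∀ t ∈ Icc c d, ∃ C, ∀ᶠ r in 𝓝 t, ∀ s ∈ J, ‖x r s‖ ≤ C := by
    intro t ht
    have ht' := Icc_subset_openInterval hc hd ht
    obtain ⟨C, hC⟩ := isCompact_J.exists_bound_of_continuousOn (h.cont t ht')
    have hev : ∀ᶠ r in 𝓝[≠] t, ∀ s ∈ J, ‖x r s‖ ≤ C + 1 := by
      rw [← Iio_union_Ioi, nhdsWithin_union, eventually_sup]
      constructor
      · filter_upwards [Metric.tendstoUniformlyOn_iff.1 (h.left t ht') 1 one_pos] with r hr s hs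
        have h1 := hr s hs
        rw [dist_comm, dist_eq_norm] at h1
        have h2 := norm_le_norm_add_norm_sub' (x r s) (x t (-1 / 2))
        have h3 := hC _ neg_half_mem_J
        linarith
      · filter_upwards [Metric.tendstoUniformlyOn_iff.1 (h.right t ht') 1 one_pos] with r hr s hs
        have h1 := hr s hs
        rw [dist_comm, dist_eq_norm] at h1
        have h2 := norm_le_norm_add_norm_sub' (x r s) (x t (1 / 2))
        have h3 := hC _ half_mem_J
        linarith
    refine ⟨C + 1, ?_⟩
    filter_upwards [eventually_nhdsWithin_iff.1 hev] with r hr s hs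
    by_cases hrt : r = t
    · subst hrt
      linarith [hC s hs]
    · exact hr hrt s hs
  refine isCompact_Icc.induction_on (p := fun S => ∃ C, ∀ t ∈ S, ∀ s ∈ J, ‖x t s‖ ≤ C)
    ⟨0, fun t ht => ht.elim⟩ (fun S S' hSS' ⟨C, hC⟩ => ⟨C, fun t ht => hC t (hSS' ht)⟩)
    (fun S S' ⟨C, hC⟩ ⟨C', hC'⟩ => ⟨max C C', fun t ht s hs => ?_⟩) fun t ht => ?_
  · rcases ht with ht | ht
    · exact (hC t ht s hs).trans (le_max_left _ _)
    · exact (hC' t ht s hs).trans (le_max_right _ _)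
  · obtain ⟨C, hC⟩ := key t ht
    exact ⟨_, mem_nhdsWithin_of_mem_nhds hC, C, fun r hr => hr⟩

/-- Uniform convergence to a constant on each side of `t` makes the oscillation over `J` small near
`t`, so the times with oscillation above `1 / (n + 1)` are isolated. -/
theorem countable_nonconstant (h : Joins a b x) :
    {t | t ∈ openInterval a b ∧ ¬ ∀ s ∈ J, ∀ s' ∈ J, x t s = x t s'}.Countable := by
  set B : ℕ → Set ℝ := fun n => {t | ∃ s ∈ J, ∃ s' ∈ J, 1 / ((n : ℝ) + 1) < dist (x t s) (x t s')}
  have hsub : {t | t ∈ openInterval a b ∧ ¬ ∀ s ∈ J, ∀ s' ∈ J, x t s = x t s'} ⊆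
      ⋃ n, openInterval a b ∩ B n := by
    rintro t ⟨ht, hne⟩
    push Not at hne
    obtain ⟨s, hs, s', hs', hne⟩ := hne
    obtain ⟨n, hn⟩ := exists_nat_one_div_lt (dist_pos.2 hne)
    exact mem_iUnion.2 ⟨n, ht, s, hs, s', hs', hn⟩
  refine (countable_iUnion fun n => countable_inter_of_eventually_notMem fun t ht => ?_).mono hsub
  have hpos : (0:ℝ) < 1 / ((n : ℝ) + 1) / 2 := by positivity
  have side : ∀ l : Filter ℝ, ∀ c : E, TendstoUniformlyOn x (fun _ => c) l J →
      ∀ᶠ r in l, r ∉ B n := by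
    intro l c hc
    filter_upwards [Metric.tendstoUniformlyOn_iff.1 hc _ hpos] with r hr
    rintro ⟨s, hs, s', hs', hlt⟩
    have := dist_triangle_left (x r s) (x r s') c
    linarith [hr s hs, hr s' hs']
  rw [← Iio_union_Ioi, nhdsWithin_union, eventually_sup]
  exact ⟨side _ _ (h.left t ht), side _ _ (h.right t ht)⟩

theorem continuousAt_of_constant (h : Joins a b x) {t s : ℝ} (ht : t ∈ openInterval a b)
    (hs : s ∈ J) (hord : ∀ s ∈ J, ∀ s' ∈ J, x t s = x t s') : ContinuousAt (fun r => x r s) t := by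
  rw [← continuousWithinAt_compl_self, ← Iio_union_Ioi]
  have hl := (h.left t ht).tendsto_at hs
  have hr := (h.right t ht).tendsto_at hs
  rw [hord _ neg_half_mem_J s hs] at hl
  rw [hord _ half_mem_J s hs] at hr
  exact ContinuousWithinAt.union hl hr

end Joins

/-! ## Test functions -/

theorem hasDynLimit_of_eventually_eq {g : DynFun} {l : Filter ℝ} {c : ℝ}
    (h : ∀ᶠ t in l, ∀ s ∈ J, g t s = c) : HasDynLimit g l c := by
  refine Metric.tendstoUniformlyOn_iff.2 fun ε hε => ?_
  filter_upwards [h] with t ht s hs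
  rw [ht s hs, dist_self]
  exact hε

theorem hasDynLimit_left_end {a b : EReal} {g : DynFun} {lo : ℝ} (hlo : lo ∈ openInterval a b)
    (h : ∀ t < lo, ∀ s ∈ J, g t s = 0) :
    HasDynLimit g (comap (fun t : ℝ => (t : EReal)) (𝓝[>] a)) 0 := by
  refine hasDynLimit_of_eventually_eq ?_
  have : ∀ᶠ e in 𝓝[>] a, e < (lo : EReal) := mem_nhdsWithin_of_mem_nhds (Iio_mem_nhds hlo.1)
  filter_upwards [preimage_mem_comap this] with t ht
  exact h t (EReal.coe_lt_coe_iff.1 ht)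

theorem hasDynLimit_right_end {a b : EReal} {g : DynFun} {hi : ℝ} (hhi : hi ∈ openInterval a b)
    (h : ∀ t, hi < t → ∀ s ∈ J, g t s = 0) :
    HasDynLimit g (comap (fun t : ℝ => (t : EReal)) (𝓝[<] b)) 0 := by
  refine hasDynLimit_of_eventually_eq ?_
  have : ∀ᶠ e in 𝓝[<] b, (hi : EReal) < e := mem_nhdsWithin_of_mem_nhds (Ioi_mem_nhds hhi.2)
  filter_upwards [preimage_mem_comap this] with t ht
  exact h t (EReal.coe_lt_coe_iff.1 ht)

theorem isRegulatedOnJ_const (c : ℝ) : IsRegulatedOnJ fun _ => c :=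
  ⟨⟨|c|, fun _ _ => le_rfl⟩, fun _ _ _ => ⟨c, tendsto_const_nhds⟩,
    fun _ _ _ => ⟨c, tendsto_const_nhds⟩⟩

/-- As the profile of a `pointTest` at `τ` this step isolates the part of the jump at `τ` that is
completed at the parameter `σ`. -/
theorem isRegulatedOnJ_step (σ : ℝ) : IsRegulatedOnJ fun s => if s ≤ σ then (1 : ℝ) else 0 where
  bounded := ⟨1, fun s _ => by split_ifs <;> simp⟩
  left_lim s _ _ := by
    by_cases h : s ≤ σ
    · refine ⟨1, tendsto_const_nhds.congr' ?_⟩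
      filter_upwards [self_mem_nhdsWithin] with r hr
      rw [if_pos (le_of_lt (lt_of_lt_of_le hr h))]
    · refine ⟨0, tendsto_const_nhds.congr' ?_⟩
      filter_upwards [mem_nhdsWithin_of_mem_nhds (Ioi_mem_nhds (not_le.1 h))] with r hr
      rw [if_neg (not_le.2 hr)]
  right_lim s _ _ := by
    by_cases h : s < σ
    · refine ⟨1, tendsto_const_nhds.congr' ?_⟩
      filter_upwards [mem_nhdsWithin_of_mem_nhds (Iio_mem_nhds h)] with r hr
      rw [if_pos (le_of_lt hr)]
    · refine ⟨0, tendsto_const_nhds.congr' ?_⟩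
      filter_upwards [self_mem_nhdsWithin] with r hr
      rw [if_neg (not_le.2 (lt_of_le_of_lt (not_lt.1 h) hr))]

/-- The ordinary indicator function of `[c, d]` as a test function. -/
def intervalTest {a b : EReal} {c d : ℝ} (hc : c ∈ openInterval a b) (hd : d ∈ openInterval a b) :
    TestFun a b where
  toFun t _ := (Icc c d).indicator (fun _ => (1 : ℝ)) t
  lo := c
  hi := d
  lo_mem := hc
  hi_mem := hd
  eq_zero t ht _ _ := indicator_of_notMem ht _
  regulated :=
    { bounded := ⟨1, fun t _ _ _ => by by_cases h : t ∈ Icc c d <;> simp [h]⟩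
      value_regulated := fun t _ => isRegulatedOnJ_const _
      left_lim := fun t _ => by
        by_cases h : c < t ∧ t ≤ d
        · refine ⟨1, hasDynLimit_of_eventually_eq ?_⟩
          filter_upwards [mem_nhdsWithin_of_mem_nhds (Ioi_mem_nhds h.1), self_mem_nhdsWithin]
            with r hr hr' s _
          exact indicator_of_mem (show r ∈ Icc c d from ⟨le_of_lt hr, (le_of_lt hr').trans h.2⟩) _
        · refine ⟨0, hasDynLimit_of_eventually_eq ?_⟩
          by_cases h1 : c < t
          · have h2 : d < t := not_le.1 fun h2 => h ⟨h1, h2⟩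
            filter_upwards [mem_nhdsWithin_of_mem_nhds (Ioi_mem_nhds h2)] with r hr s _
            exact indicator_of_notMem (fun h3 => absurd h3.2 (not_le.2 hr)) _
          · filter_upwards [self_mem_nhdsWithin] with r hr s _
            exact indicator_of_notMem
              (fun h3 => absurd h3.1 (not_le.2 (lt_of_lt_of_le hr (not_lt.1 h1)))) _
      right_lim := fun t _ => by
        by_cases h : c ≤ t ∧ t < d
        · refine ⟨1, hasDynLimit_of_eventually_eq ?_⟩
          filter_upwards [mem_nhdsWithin_of_mem_nhds (Iio_mem_nhds h.2), self_mem_nhdsWithin]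
            with r hr hr' s _
          exact indicator_of_mem (show r ∈ Icc c d from ⟨h.1.trans (le_of_lt hr'), le_of_lt hr⟩) _
        · refine ⟨0, hasDynLimit_of_eventually_eq ?_⟩
          by_cases h1 : c ≤ t
          · have h2 : d ≤ t := not_lt.1 fun h2 => h ⟨h1, h2⟩
            filter_upwards [self_mem_nhdsWithin] with r hr s _
            exact indicator_of_notMem (fun h3 => absurd h3.2 (not_le.2 (lt_of_le_of_lt h2 hr))) _
          · filter_upwards [mem_nhdsWithin_of_mem_nhds (Iio_mem_nhds (not_le.1 h1))] with r hr s _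
            exact indicator_of_notMem (fun h3 => absurd h3.1 (not_le.2 hr)) _
      lim_left_end := ⟨0, hasDynLimit_left_end hc fun t ht _ _ =>
        indicator_of_notMem (fun h => absurd h.1 (not_le.2 ht)) _⟩
      lim_right_end := ⟨0, hasDynLimit_right_end hd fun t ht _ _ =>
        indicator_of_notMem (fun h => absurd h.2 (not_le.2 ht)) _⟩ }

open Classical in
/-- The test function that takes the value `β` at the time `τ` and vanishes at all other times. -/
def pointTest {a b : EReal} {τ : ℝ} (hτ : τ ∈ openInterval a b) {β : ℝ → ℝ}
    (hβ : IsRegulatedOnJ β) : TestFun a b where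
  toFun t s := if t = τ then β s else 0
  lo := τ
  hi := τ
  lo_mem := hτ
  hi_mem := hτ
  eq_zero t ht _ _ := if_neg fun h => ht (by rw [h]; exact left_mem_Icc.2 le_rfl)
  regulated :=
    { bounded := by
        obtain ⟨C, hC⟩ := hβ.bounded
        refine ⟨C, fun t _ s hs => ?_⟩
        by_cases h : t = τ
        · simpa only [if_pos h] using hC s hs
        · simpa only [if_neg h, abs_zero] using (abs_nonneg _).trans (hC s hs)
      value_regulated := fun t _ => by
        by_cases h : t = τ
        · simpa only [if_pos h] using hβ
        · simpa only [if_neg h] using isRegulatedOnJ_const 0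
      left_lim := fun t _ => by
        refine ⟨0, hasDynLimit_of_eventually_eq ?_⟩
        rcases lt_or_ge τ t with h | h
        · filter_upwards [mem_nhdsWithin_of_mem_nhds (Ioi_mem_nhds h)] with r hr s _
          exact if_neg (Ne.symm (ne_of_lt hr))
        · filter_upwards [self_mem_nhdsWithin] with r hr s _
          exact if_neg (ne_of_lt (lt_of_lt_of_le hr h))
      right_lim := fun t _ => by
        refine ⟨0, hasDynLimit_of_eventually_eq ?_⟩
        rcases lt_or_ge t τ with h | h
        · filter_upwards [mem_nhdsWithin_of_mem_nhds (Iio_mem_nhds h)] with r hr s _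
          exact if_neg (ne_of_lt hr)
        · filter_upwards [self_mem_nhdsWithin] with r hr s _
          exact if_neg (ne_of_gt (lt_of_le_of_lt h hr))
      lim_left_end := ⟨0, hasDynLimit_left_end hτ fun t ht _ _ => if_neg ht.ne⟩
      lim_right_end := ⟨0, hasDynLimit_right_end hτ fun t ht _ _ => if_neg ht.ne'⟩ }

theorem pointTest_self {a b : EReal} {τ : ℝ} (hτ : τ ∈ openInterval a b) {β : ℝ → ℝ}
    (hβ : IsRegulatedOnJ β) (s : ℝ) : (pointTest hτ hβ).toFun τ s = β s := if_pos rfl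

theorem pointTest_of_ne {a b : EReal} {τ : ℝ} (hτ : τ ∈ openInterval a b) {β : ℝ → ℝ}
    (hβ : IsRegulatedOnJ β) {t : ℝ} (ht : t ≠ τ) (s : ℝ) : (pointTest hτ hβ).toFun t s = 0 :=
  if_neg ht

namespace TestFun

variable {a b : EReal}

theorem exists_bound (φ : TestFun a b) : ∃ C, ∀ t, ∀ s ∈ J, |φ.toFun t s| ≤ C := by
  obtain ⟨C, hC⟩ := φ.regulated.bounded
  refine ⟨C, fun t s hs => ?_⟩
  by_cases ht : t ∈ Icc φ.lo φ.hi
  · exact hC t (Icc_subset_openInterval φ.lo_mem φ.hi_mem ht) s hs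
  · rw [φ.eq_zero t ht s hs, abs_zero]
    exact (abs_nonneg _).trans (hC φ.lo φ.lo_mem s hs)

theorem oneSided_limits (φ : TestFun a b) (t : ℝ) :
    (∃ c, Tendsto (ordPart φ.toFun) (𝓝[<] t) (𝓝 c)) ∧
      ∃ c, Tendsto (ordPart φ.toFun) (𝓝[>] t) (𝓝 c) := by
  by_cases ht : t ∈ Icc φ.lo φ.hi
  · have ht' := Icc_subset_openInterval φ.lo_mem φ.hi_mem ht
    obtain ⟨c, hc⟩ := φ.regulated.left_lim t ht'
    obtain ⟨c', hc'⟩ := φ.regulated.right_lim t ht'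
    exact ⟨⟨c, hc.tendsto_at zero_mem_J⟩, c', hc'.tendsto_at zero_mem_J⟩
  · have : Tendsto (ordPart φ.toFun) (𝓝 t) (𝓝 0) := by
      refine tendsto_const_nhds.congr' ?_
      filter_upwards [isClosed_Icc.isOpen_compl.mem_nhds ht] with r hr
      exact (φ.eq_zero r hr 0 zero_mem_J).symm
    exact ⟨⟨0, this.mono_left nhdsWithin_le_nhds⟩, 0, this.mono_left nhdsWithin_le_nhds⟩

theorem aestronglyMeasurable_ordPart (φ : TestFun a b) :
    AEStronglyMeasurable (ordPart φ.toFun) := by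
  have := aestronglyMeasurable_of_countable (u := ordPart φ.toFun) isOpen_univ
    (countable_not_continuousAt_of_oneSided (fun t _ => (φ.oneSided_limits t).1)
      fun t _ => (φ.oneSided_limits t).2)
  rwa [Measure.restrict_univ] at this

end TestFun

/-! ## The continuous part and the distributional derivative -/

theorem jump_eq_zero_of_isOrdinaryAt {g : DynFun} {τ : ℝ} (h : IsOrdinaryAt g τ) : jump g τ = 0 :=
  sub_eq_zero.2 (h _ half_mem_J _ neg_half_mem_J)

open Classical in
/-- The sum of the jumps in `[c, t)`. -/
def jumpSum (g : DynFun) (c t : ℝ) : ℝ := ∑' τ : ℝ, if c ≤ τ ∧ τ < t then jump g τ else 0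

/-- Ordinary values have zero jump, so the sum may run over all real times, with a zero term outside
the range of interest. -/
theorem continuousPart_eq (g : DynFun) (c d t : ℝ) :
    continuousPart g c d t =
      g (max c (min t d)) (-1 / 2) - jumpSum g c (max c (min t d)) := by
  rw [continuousPart, jumpSum]
  congr 1
  refine (tsum_subtype {τ : ℝ | c ≤ τ ∧ τ < max c (min t d) ∧ ¬ IsOrdinaryAt g τ}
    (jump g)).trans (tsum_congr fun τ => ?_)
  by_cases h : IsOrdinaryAt g τ
  · simp [jump_eq_zero_of_isOrdinaryAt h]
  · by_cases h1 : c ≤ τ ∧ τ < max c (min t d)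
    · rw [if_pos h1, indicator_of_mem
        (show τ ∈ {τ : ℝ | c ≤ τ ∧ τ < max c (min t d) ∧ ¬ IsOrdinaryAt g τ} from ⟨h1.1, h1.2, h⟩)]
    · rw [if_neg h1, indicator_of_notMem fun h2 => h1 ⟨h2.1, h2.2.1⟩]

/-- The added terms vanish: at an ordinary time the path is constant on the interior of `J`, and at
times off the support the test function is zero. -/
theorem derivPairing_eq {a b : EReal} (g : DynFun) (φ : TestFun a b) :
    derivPairing g φ = stieltjesIntegral (ordPart φ.toFun) (continuousPart g φ.lo φ.hi) +
      ∑' τ : ℝ, ∫ s in (-1 / 2 : ℝ)..(1 / 2), φ.toFun τ s * deriv (g τ) s := by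
  rw [derivPairing]
  congr 1
  refine (tsum_subtype {τ : ℝ | τ ∈ openInterval a b ∧ ¬ IsOrdinaryAt g τ}
    (fun τ => ∫ s in (-1 / 2 : ℝ)..(1 / 2), φ.toFun τ s * deriv (g τ) s)).trans
    (tsum_congr fun τ => ?_)
  by_cases hmem : τ ∈ {τ : ℝ | τ ∈ openInterval a b ∧ ¬ IsOrdinaryAt g τ}
  · rw [indicator_of_mem hmem]
  rw [indicator_of_notMem hmem]
  symm
  by_cases hab : τ ∈ Icc φ.lo φ.hi
  · have hord : IsOrdinaryAt g τ := by
      by_contra h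
      exact hmem ⟨Icc_subset_openInterval φ.lo_mem φ.hi_mem hab, h⟩
    -- The endpoints of `J` are discarded because the derivative there depends on the meaningless
    -- values outside `J`.
    rw [intervalIntegral.integral_of_le (by norm_num), integral_Ioc_eq_integral_Ioo]
    refine setIntegral_eq_zero_of_forall_eq_zero fun s hs => ?_
    have : g τ =ᶠ[𝓝 s] fun _ => g τ 0 := by
      filter_upwards [isOpen_Ioo.mem_nhds hs] with r hr
      exact hord _ ⟨hr.1.le, hr.2.le⟩ _ zero_mem_J
    rw [this.deriv_eq, deriv_const, mul_zero]
  · refine intervalIntegral.integral_zero_ae (Eventually.of_forall fun s hs => ?_)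
    rw [φ.eq_zero τ hab s, zero_mul]
    rw [uIoc_of_le (by norm_num)] at hs
    exact ⟨hs.1.le, hs.2⟩

theorem integral_step_mul {σ : ℝ} (hσ : σ ∈ J) (F : ℝ → ℝ) :
    ∫ s in (-1 / 2 : ℝ)..(1 / 2), (if s ≤ σ then (1 : ℝ) else 0) * F s =
      ∫ s in (-1 / 2 : ℝ)..σ, F s := by
  rw [intervalIntegral.integral_of_le (by norm_num), intervalIntegral.integral_of_le hσ.1]
  have : (fun s => (if s ≤ σ then (1 : ℝ) else 0) * F s) = (Iic σ).indicator F := by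
    funext s
    by_cases hs : s ≤ σ
    · rw [if_pos hs, indicator_of_mem (show s ∈ Iic σ from hs), one_mul]
    · rw [if_neg hs, indicator_of_notMem (show s ∉ Iic σ from hs), zero_mul]
  rw [this, setIntegral_indicator measurableSet_Iic, Ioc_inter_Iic, min_eq_right hσ.2]

namespace IsSBVLoc

variable {a b : EReal} {g : DynFun} {c d : ℝ}

theorem summable_eVariationOn (h : IsSBVLoc a b g) (hc : c ∈ openInterval a b)
    (hd : d ∈ openInterval a b) :
    Summable ((Icc c d).indicator fun τ => (eVariationOn (g τ) J).toReal) := by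
  have h1 := ENNReal.summable_toReal (h.sum_var c hc d hd).ne
  have h2 := summable_subtype_iff_indicator (s := {t : ℝ | t ∈ Icc c d ∧ ¬ IsOrdinaryAt g t})
    (f := fun τ => (eVariationOn (g τ) J).toReal) |>.1 h1
  refine h2.congr fun τ => ?_
  by_cases ho : IsOrdinaryAt g τ
  · have : eVariationOn (g τ) J = 0 := eVariationOn.constant_on (by
      rintro _ ⟨s, hs, rfl⟩ _ ⟨s', hs', rfl⟩
      exact ho s hs s' hs')
    by_cases hm : τ ∈ Icc c d <;> simp [indicator, ho, this]
  · by_cases hm : τ ∈ Icc c d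
    · rw [indicator_of_mem hm,
        indicator_of_mem (show τ ∈ {t : ℝ | t ∈ Icc c d ∧ ¬ IsOrdinaryAt g t} from ⟨hm, ho⟩)]
    · rw [indicator_of_notMem hm, indicator_of_notMem fun h => hm h.1]

theorem boundedVariationOn_value (h : IsSBVLoc a b g) {t : ℝ} (ht : t ∈ openInterval a b) :
    BoundedVariationOn (g t) J :=
  uIcc_eq_J ▸ (h.joins.value_ac t ht).boundedVariationOn

theorem summable_jump (h : IsSBVLoc a b g) (hc : c ∈ openInterval a b)
    (hd : d ∈ openInterval a b) : Summable ((Icc c d).indicator fun τ => |jump g τ|) := by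
  refine (h.summable_eVariationOn hc hd).of_nonneg_of_le
    (fun τ => indicator_nonneg (fun _ _ => abs_nonneg _) τ) fun τ => ?_
  by_cases hτ : τ ∈ Icc c d
  · rw [indicator_of_mem hτ, indicator_of_mem hτ]
    exact (h.boundedVariationOn_value (Icc_subset_openInterval hc hd hτ)).dist_le
      half_mem_J neg_half_mem_J
  · rw [indicator_of_notMem hτ, indicator_of_notMem hτ]

theorem summable_jumpSum (h : IsSBVLoc a b g) (hc : c ∈ openInterval a b)
    (hd : d ∈ openInterval a b) {p : ℝ → Prop} [DecidablePred p] (hp : ∀ τ, p τ → τ ∈ Icc c d) :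
    Summable fun τ : ℝ => if p τ then jump g τ else 0 := by
  refine Summable.of_norm_bounded (h.summable_jump hc hd) fun τ => ?_
  by_cases hτ : p τ
  · rw [if_pos hτ, indicator_of_mem (hp τ hτ), Real.norm_eq_abs]
  · rw [if_neg hτ, norm_zero]
    exact indicator_nonneg (fun _ _ => abs_nonneg _) τ

open Classical in
theorem tsum_jump_Icc (h : IsSBVLoc a b g) (hc : c ∈ openInterval a b)
    {t : ℝ} (ht : t ∈ openInterval a b) (hct : c ≤ t) :
    (∑' τ : ℝ, if c ≤ τ ∧ τ ≤ t then jump g τ else 0) = jumpSum g c t + jump g t := by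
  have h1 : jump g t = ∑' τ : ℝ, if τ = t then jump g τ else 0 := by
    rw [tsum_eq_single t fun τ hτ => if_neg hτ, if_pos rfl]
  rw [h1, jumpSum, ← (h.summable_jumpSum hc ht fun τ hτ => ⟨hτ.1, hτ.2.le⟩).tsum_add
    (h.summable_jumpSum (p := fun τ => τ = t) hc ht
      fun τ hτ => by subst hτ; exact right_mem_Icc.2 hct)]
  refine tsum_congr fun τ => ?_
  rcases lt_trichotomy τ t with hτ | hτ | hτ
  · simp [hτ, hτ.le, hτ.ne]
  · simp [hτ, hct]
  · simp [hτ.not_ge, hτ.ne', hτ.not_gt]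

/-- From the left both terms converge to their values, since `jumpSum` omits the jump at `t` itself.
From the right the first term tends to `g t (1 / 2)` and the sum gains the jump at `t`; these two
changes cancel. The sums converge by dominated convergence for series. -/
theorem continuousOn_sub_jumpSum (h : IsSBVLoc a b g) (hc : c ∈ openInterval a b)
    (hd : d ∈ openInterval a b) :
    ContinuousOn (fun t => g t (-1 / 2) - jumpSum g c t) (Icc c d) := by
  classical
  intro t ht
  have ht' := Icc_subset_openInterval hc hd ht
  have bound : ∀ s : Set ℝ, ∀ᶠ r in 𝓝[Icc c d ∩ s] t, ∀ τ : ℝ,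
      ‖(if c ≤ τ ∧ τ < r then jump g τ else 0 : ℝ)‖ ≤
        (Icc c d).indicator (fun τ => |jump g τ|) τ := by
    intro s
    filter_upwards [self_mem_nhdsWithin] with r hr τ
    by_cases hτ : c ≤ τ ∧ τ < r
    · rw [if_pos hτ, indicator_of_mem (show τ ∈ Icc c d from ⟨hτ.1, hτ.2.le.trans hr.1.2⟩),
        Real.norm_eq_abs]
    · rw [if_neg hτ, norm_zero]
      exact indicator_nonneg (fun _ _ => abs_nonneg _) τ
  have hleft : ContinuousWithinAt (fun t => g t (-1 / 2) - jumpSum g c t) (Icc c d ∩ Iio t) t := by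
    refine Tendsto.sub (((h.joins.left_lim t ht').tendsto_at neg_half_mem_J).mono_left
      (nhdsWithin_mono _ inter_subset_right)) ?_
    refine tendsto_tsum_of_dominated_convergence (h.summable_jump hc hd) (fun τ => ?_) (bound _)
    refine tendsto_const_nhds.congr' ?_
    rcases lt_or_ge τ t with hτ | hτ
    · filter_upwards [mem_nhdsWithin_of_mem_nhds (Ioi_mem_nhds hτ)] with r hr
      have hr : τ < r := hr
      simp [hτ, hr]
    · filter_upwards [self_mem_nhdsWithin] with r hr
      have : ¬ τ < r := not_lt.2 (le_of_lt (lt_of_lt_of_le hr.2 hτ))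
      simp [hτ.not_gt, this]
  have hright : ContinuousWithinAt (fun t => g t (-1 / 2) - jumpSum g c t)
      (Icc c d ∩ Ioi t) t := by
    have he : g t (-1 / 2) - jumpSum g c t =
        g t (1 / 2) - ∑' τ : ℝ, if c ≤ τ ∧ τ ≤ t then jump g τ else 0 := by
      rw [h.tsum_jump_Icc hc ht' ht.1, jump]
      ring
    rw [ContinuousWithinAt, he]
    refine Tendsto.sub (((h.joins.right_lim t ht').tendsto_at neg_half_mem_J).mono_left
      (nhdsWithin_mono _ inter_subset_right)) ?_
    refine tendsto_tsum_of_dominated_convergence (h.summable_jump hc hd) (fun τ => ?_) (bound _)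
    refine tendsto_const_nhds.congr' ?_
    rcases le_or_gt τ t with hτ | hτ
    · filter_upwards [self_mem_nhdsWithin] with r hr
      have : τ < r := lt_of_le_of_lt hτ hr.2
      simp [hτ, this]
    · filter_upwards [mem_nhdsWithin_of_mem_nhds (Iio_mem_nhds hτ)] with r hr
      have : ¬ τ < r := not_lt.2 (le_of_lt hr)
      simp [hτ.not_ge, this]
  have hun := hleft.union hright
  rw [← inter_union_distrib_left, Iio_union_Ioi] at hun
  have h2 := hun.insert
  exact h2.mono fun r hr => by
    by_cases hrt : r = t
    · exact Or.inl hrt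
    · exact Or.inr ⟨hr, hrt⟩

theorem continuous_continuousPart (h : IsSBVLoc a b g) (hc : c ∈ openInterval a b)
    (hd : d ∈ openInterval a b) (hcd : c ≤ d) : Continuous (continuousPart g c d) := by
  have : continuousPart g c d = fun t => (fun t => g t (-1 / 2) - jumpSum g c t)
      (max c (min t d)) := funext fun t => continuousPart_eq g c d t
  rw [this]
  exact (h.continuousOn_sub_jumpSum hc hd).comp_continuous (by fun_prop)
    fun t => ⟨le_max_left _ _, max_le hcd (min_le_right _ _)⟩

theorem countable_not_isOrdinaryAt (h : IsSBVLoc a b g) :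
    {t | t ∈ openInterval a b ∧ ¬ IsOrdinaryAt g t}.Countable :=
  h.joins.joins.countable_nonconstant

theorem neBot_ordinary (h : IsSBVLoc a b g) {t : ℝ} (ht : t ∈ openInterval a b) :
    (𝓝[Iio t ∩ {r | r ∈ openInterval a b ∧ IsOrdinaryAt g r}] t).NeBot := by
  have hdense := h.countable_not_isOrdinaryAt.dense_compl ℝ
  have h1 : t ∈ closure (Iio t ∩ openInterval a b) :=
    mem_closure_iff_nhdsWithin_neBot.2 (by
      rw [nhdsWithin_inter_of_mem' (mem_nhdsWithin_of_mem_nhds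
        ((isOpen_openInterval a b).mem_nhds ht))]
      infer_instance)
  have h2 := closure_minimal
    (hdense.open_subset_closure_inter (isOpen_Iio.inter (isOpen_openInterval a b)))
    isClosed_closure h1
  refine mem_closure_iff_nhdsWithin_neBot.1 (closure_mono ?_ h2)
  rintro r ⟨hr, hr'⟩
  refine ⟨hr.1, hr.2, ?_⟩
  by_contra hcon
  exact hr' ⟨hr.2, hcon⟩

/-- The hypothesis of bounded variation sees only ordinary times. These are dense, so the left
limits of `g` are limits along them: the ordinary part is split into two monotone functions, each is
extended monotonically to the line, and their left limits give both `g t (-1 / 2)` and the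
dominating function. -/
theorem exists_monotone_left_limits (h : IsSBVLoc a b g) (hc : c ∈ openInterval a b)
    (hd : d ∈ openInterval a b) : ∃ V : ℝ → ℝ, Monotone V ∧
      ∀ t ∈ Icc c d, ∀ t' ∈ Icc c d, t ≤ t' → |g t' (-1 / 2) - g t (-1 / 2)| ≤ V t' - V t := by
  set S := {r | r ∈ openInterval a b ∧ IsOrdinaryAt g r} with hS
  have hex : ∀ t ∈ openInterval a b, ∃ r ∈ S, r < t := by
    intro t ht
    have := h.neBot_ordinary ht
    obtain ⟨r, hr⟩ := (this.nonempty_of_mem self_mem_nhdsWithin)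
    exact ⟨r, hr.2, hr.1⟩
  -- The ordinary time `c'` lies strictly before `c`, so that the left limit at `c` is also taken
  -- along times covered by the extensions.
  obtain ⟨c', hc'S, hc'⟩ := hex c hc
  obtain ⟨d', hd', hdd'⟩ : ∃ d' ∈ S, d ≤ d' := by
    obtain ⟨e, hde, he⟩ : ∃ e, d < e ∧ e ∈ openInterval a b := by
      have := (mem_nhdsWithin_of_mem_nhds (t := Ioi d) ((isOpen_openInterval a b).mem_nhds hd))
      obtain ⟨e, he⟩ := (inferInstance : (𝓝[>] d).NeBot).nonempty_of_mem
        (inter_mem this self_mem_nhdsWithin)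
      exact ⟨e, he.2, he.1⟩
    have h3 := h.neBot_ordinary he
    obtain ⟨r, hr⟩ := h3.nonempty_of_mem
      (inter_mem self_mem_nhdsWithin (mem_nhdsWithin_of_mem_nhds (Ioi_mem_nhds hde)))
    exact ⟨r, hr.1.2, le_of_lt hr.2⟩
  obtain ⟨P, Q, hP, hQ, hPQ⟩ := h.ord_bv.exists_monotoneOn_sub_monotoneOn
  have ext : ∀ P : ℝ → ℝ, MonotoneOn P S →
      ∃ P', Monotone P' ∧ EqOn P P' (S ∩ Icc c' d') := by
    intro P hP
    refine (hP.mono inter_subset_left).exists_monotone_extension ⟨P c', ?_⟩ ⟨P d', ?_⟩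
    · rintro _ ⟨r, hr, rfl⟩
      exact hP hc'S hr.1 hr.2.1
    · rintro _ ⟨r, hr, rfl⟩
      exact hP hr.1 hd' hr.2.2
  obtain ⟨P', mP, eP⟩ := ext P hP
  obtain ⟨Q', mQ, eQ⟩ := ext Q hQ
  have lim : ∀ t ∈ Icc c d, g t (-1 / 2) = Function.leftLim P' t - Function.leftLim Q' t := by
    intro t ht
    have ht' := Icc_subset_openInterval hc hd ht
    have := h.neBot_ordinary ht'
    have l1 : Tendsto (fun r => g r 0) (𝓝[Iio t ∩ S] t) (𝓝 (g t (-1 / 2))) :=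
      ((h.joins.left_lim t ht').tendsto_at zero_mem_J).mono_left
        (nhdsWithin_mono _ inter_subset_left)
    have l2 : Tendsto (fun r => P' r - Q' r) (𝓝[Iio t ∩ S] t)
        (𝓝 (Function.leftLim P' t - Function.leftLim Q' t)) :=
      ((mP.tendsto_leftLim t).sub (mQ.tendsto_leftLim t)).mono_left
        (nhdsWithin_mono _ inter_subset_left)
    refine tendsto_nhds_unique l1 (l2.congr' ?_)
    filter_upwards [self_mem_nhdsWithin,
      mem_nhdsWithin_of_mem_nhds (Ioi_mem_nhds (hc'.trans_le ht.1))] with r hr hr'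
    have hrm : r ∈ S ∩ Icc c' d' := ⟨hr.2, le_of_lt hr', (le_of_lt hr.1).trans (ht.2.trans hdd')⟩
    rw [← eP hrm, ← eQ hrm]
    exact (congrFun hPQ r).symm
  refine ⟨fun t => Function.leftLim P' t + Function.leftLim Q' t, mP.leftLim.add mQ.leftLim,
    fun t ht t' ht' htt' => ?_⟩
  rw [lim t ht, lim t' ht']
  have h1 := mP.leftLim htt'
  have h2 := mQ.leftLim htt'
  rw [abs_le]
  constructor <;> linarith

/-- This excludes the default value 0 in `stieltjesIntegral`. The increments are dominated by those
of a monotone function for the left limits plus the sum of the absolute jumps. -/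
theorem boundedVariationOn_continuousPart (h : IsSBVLoc a b g) (hc : c ∈ openInterval a b)
    (hd : d ∈ openInterval a b) (hcd : c ≤ d) :
    BoundedVariationOn (continuousPart g c d) univ := by
  classical
  obtain ⟨V, mV, hV⟩ := h.exists_monotone_left_limits hc hd
  set p : ℝ → ℝ := fun t => max c (min t d) with hp
  have mp : Monotone p := fun t t' htt' => max_le_max le_rfl (min_le_min htt' le_rfl)
  have pmem : ∀ t, p t ∈ Icc c d := fun t => ⟨le_max_left _ _, max_le hcd (min_le_right _ _)⟩
  set W : ℝ → ℝ := fun t => ∑' τ : ℝ, if c ≤ τ ∧ τ < p t then |jump g τ| else 0 with hW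
  have hsum : ∀ t, Summable fun τ : ℝ => if c ≤ τ ∧ τ < p t then |jump g τ| else 0 := by
    intro t
    refine (h.summable_jump hc hd).of_nonneg_of_le (fun τ => by split_ifs <;> positivity)
      fun τ => ?_
    by_cases hτ : c ≤ τ ∧ τ < p t
    · rw [if_pos hτ, indicator_of_mem (show τ ∈ Icc c d from ⟨hτ.1, hτ.2.le.trans (pmem t).2⟩)]
    · rw [if_neg hτ]
      exact indicator_nonneg (fun _ _ => abs_nonneg _) τ
  refine boundedVariationOn_of_dist_le (m := fun t => V (p t) + W t)
    (C := |V c| + |V d| + ∑' τ, (Icc c d).indicator (fun τ => |jump g τ|) τ)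
    (fun t _ t' _ htt' => ?_) fun t _ => ?_
  · rw [continuousPart_eq, continuousPart_eq]
    have h1 := hV _ (pmem t) _ (pmem t') (mp htt')
    have h2 : |jumpSum g c (p t') - jumpSum g c (p t)| ≤ W t' - W t := by
      have s1 := h.summable_jumpSum hc hd (p := fun τ => c ≤ τ ∧ τ < p t')
        fun τ hτ => ⟨hτ.1, hτ.2.le.trans (pmem t').2⟩
      have s2 := h.summable_jumpSum hc hd (p := fun τ => c ≤ τ ∧ τ < p t)
        fun τ hτ => ⟨hτ.1, hτ.2.le.trans (pmem t).2⟩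
      rw [jumpSum, jumpSum, ← s1.tsum_sub s2, hW, ← (hsum t').tsum_sub (hsum t),
        ← Real.norm_eq_abs]
      refine tsum_of_norm_bounded ((hsum t').sub (hsum t)).hasSum fun τ => ?_
      have hm := mp htt'
      by_cases h3 : c ≤ τ ∧ τ < p t
      · have h4 : c ≤ τ ∧ τ < p t' := ⟨h3.1, h3.2.trans_le hm⟩
        simp [if_pos h3, if_pos h4]
      · by_cases h4 : c ≤ τ ∧ τ < p t'
        · simp [if_neg h3, if_pos h4]
        · simp [if_neg h3, if_neg h4]
    have h3 := abs_sub (g (p t') (-1 / 2) - g (p t) (-1 / 2))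
      (jumpSum g c (p t') - jumpSum g c (p t))
    have e : g (p t') (-1 / 2) - jumpSum g c (p t') - (g (p t) (-1 / 2) - jumpSum g c (p t)) =
      g (p t') (-1 / 2) - g (p t) (-1 / 2) - (jumpSum g c (p t') - jumpSum g c (p t)) := by ring
    change |g (p t') (-1 / 2) - jumpSum g c (p t') - (g (p t) (-1 / 2) - jumpSum g c (p t))| ≤ _
    rw [e]
    linarith
  · have h1 : |V (p t)| ≤ |V c| + |V d| := by
      have i1 := mV (pmem t).1
      have i2 := mV (pmem t).2
      rw [abs_le]
      constructor
      · linarith [neg_abs_le (V c), abs_nonneg (V d)]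
      · linarith [le_abs_self (V d), abs_nonneg (V c)]
    have h2 : |W t| ≤ ∑' τ, (Icc c d).indicator (fun τ => |jump g τ|) τ := by
      rw [abs_of_nonneg (tsum_nonneg fun τ => by split_ifs <;> positivity)]
      refine (hsum t).tsum_le_tsum (fun τ => ?_) (h.summable_jump hc hd)
      by_cases hτ : c ≤ τ ∧ τ < p t
      · rw [if_pos hτ, indicator_of_mem (show τ ∈ Icc c d from ⟨hτ.1, hτ.2.le.trans (pmem t).2⟩)]
      · rw [if_neg hτ]
        exact indicator_nonneg (fun _ _ => abs_nonneg _) τ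
    exact (abs_add_le _ _).trans (add_le_add h1 h2)

theorem integral_deriv_value (h : IsSBVLoc a b g) {τ σ : ℝ} (hτ : τ ∈ openInterval a b)
    (hσ : σ ∈ J) : ∫ s in (-1 / 2 : ℝ)..σ, deriv (g τ) s = g τ σ - g τ (-1 / 2) :=
  ((h.joins.value_ac τ hτ).mono
    (by rw [uIcc_eq_J, uIcc_of_le hσ.1]; exact Icc_subset_Icc le_rfl hσ.2)).integral_deriv_eq_sub

/-- The continuous part contributes `g(d-) - g(c-)` minus the jumps in `[c, d)`; the sum over the
discontinuities restores these jumps and adds the one at `d`. -/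
theorem derivPairing_intervalTest (h : IsSBVLoc a b g) (hc : c ∈ openInterval a b)
    (hd : d ∈ openInterval a b) (hcd : c ≤ d) :
    derivPairing g (intervalTest hc hd) = g d (1 / 2) - g c (-1 / 2) := by
  classical
  rw [derivPairing_eq]
  have h1 : stieltjesIntegral (ordPart (intervalTest hc hd).toFun)
      (continuousPart g (intervalTest hc hd).lo (intervalTest hc hd).hi) =
      1 * (continuousPart g c d d - continuousPart g c d c) :=
    stieltjesIntegral_indicator_Icc (h.continuous_continuousPart hc hd hcd)
      (h.boundedVariationOn_continuousPart hc hd hcd) hcd 1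
  have h2 : (∑' τ : ℝ, ∫ s in (-1 / 2 : ℝ)..(1 / 2),
      (intervalTest hc hd).toFun τ s * deriv (g τ) s) = jumpSum g c d + jump g d := by
    rw [← h.tsum_jump_Icc hc hd hcd]
    refine tsum_congr fun τ => ?_
    by_cases hτ : τ ∈ Icc c d
    · rw [if_pos (show c ≤ τ ∧ τ ≤ d from hτ), jump,
        ← h.integral_deriv_value (Icc_subset_openInterval hc hd hτ) half_mem_J]
      refine intervalIntegral.integral_congr fun s _ => ?_
      simp only [intervalTest, indicator_of_mem hτ, one_mul]
    · rw [if_neg (show ¬ (c ≤ τ ∧ τ ≤ d) from hτ)]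
      simp only [intervalTest, indicator_of_notMem hτ, zero_mul, intervalIntegral.integral_zero]
  have h3 : jumpSum g c c = 0 := by
    rw [jumpSum]
    refine (tsum_congr fun τ => ?_).trans tsum_zero
    exact if_neg fun hτ => absurd hτ.1 (not_le.2 hτ.2)
  rw [h1, h2, continuousPart_eq, continuousPart_eq, min_self, min_eq_left hcd, max_self,
    max_eq_right hcd, h3, jump]
  ring

/-- The continuous part has no mass at `τ`, so only the value of `g` at `τ` is tested. -/
theorem derivPairing_pointTest (h : IsSBVLoc a b g) {τ : ℝ} (hτ : τ ∈ openInterval a b)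
    {β : ℝ → ℝ} (hβ : IsRegulatedOnJ β) :
    derivPairing g (pointTest hτ hβ) = ∫ s in (-1 / 2 : ℝ)..(1 / 2), β s * deriv (g τ) s := by
  classical
  rw [derivPairing_eq]
  have h1 : ordPart (pointTest hτ hβ).toFun = (Icc τ τ).indicator fun _ => β 0 := by
    funext t
    by_cases ht : t = τ
    · simp [ordPart, pointTest, ht]
    · simp [ordPart, pointTest, ht]
  have h2 : stieltjesIntegral (ordPart (pointTest hτ hβ).toFun)
      (continuousPart g (pointTest hτ hβ).lo (pointTest hτ hβ).hi) = 0 := by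
    rw [h1, show (pointTest hτ hβ).lo = τ from rfl, show (pointTest hτ hβ).hi = τ from rfl,
      stieltjesIntegral_indicator_Icc (h.continuous_continuousPart hτ hτ le_rfl)
      (h.boundedVariationOn_continuousPart hτ hτ le_rfl) le_rfl, sub_self, mul_zero]
  rw [h2, zero_add, tsum_eq_single τ]
  · simp [pointTest]
  · intro t ht
    simp [pointTest, ht]

theorem derivPairing_step (h : IsSBVLoc a b g) {τ σ : ℝ} (hτ : τ ∈ openInterval a b)
    (hσ : σ ∈ J) :
    derivPairing g (pointTest hτ (isRegulatedOnJ_step σ)) = g τ σ - g τ (-1 / 2) := by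
  rw [h.derivPairing_pointTest, ← h.integral_deriv_value hτ hσ]
  exact integral_step_mul hσ _

end IsSBVLoc

/-! ## The lexicographic position of a time `τ` relative to a point `(t, s)` -/

/-- The part of the jump at `τ` that is completed at the point `(t, s)`. -/
def pos (τ t s : ℝ) : ℝ := if τ < t then 1 / 2 else if τ = t then s else -1 / 2

theorem pos_of_lt {τ t : ℝ} (h : τ < t) (s : ℝ) : pos τ t s = 1 / 2 := if_pos h

theorem pos_self (t s : ℝ) : pos t t s = s := by simp [pos]

theorem pos_of_gt {τ t : ℝ} (h : t < τ) (s : ℝ) : pos τ t s = -1 / 2 := by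
  rw [pos, if_neg h.not_gt, if_neg h.ne']

theorem pos_mem_J {τ t s : ℝ} (hs : s ∈ J) : pos τ t s ∈ J := by
  rw [pos]
  split_ifs
  exacts [half_mem_J, hs, neg_half_mem_J]

/-- The lexicographic order on times and parameters. -/
def LexLE (t s t' s' : ℝ) : Prop := t < t' ∨ t = t' ∧ s ≤ s'

theorem LexLE.le {t s t' s' : ℝ} (h : LexLE t s t' s') : t ≤ t' := by
  rcases h with h | h
  exacts [h.le, h.1.le]

theorem pos_le_pos {τ t s t' s' : ℝ} (h : LexLE t s t' s') (hs : s ∈ J) (hs' : s' ∈ J) :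
    pos τ t s ≤ pos τ t' s' := by
  rcases lt_trichotomy τ t with h1 | h1 | h1
  · rw [pos_of_lt h1, pos_of_lt (h1.trans_le h.le)]
  · subst h1
    rw [pos_self]
    rcases h with h | h
    · rw [pos_of_lt h]
      exact hs.2
    · obtain ⟨rfl, h⟩ := h
      rwa [pos_self]
  · rw [pos_of_gt h1]
    exact (pos_mem_J hs').1

theorem pos_eq_pos {c d τ t s t' s' : ℝ} (ht : t ∈ Icc c d) (ht' : t' ∈ Icc c d)
    (hτ : τ ∉ Icc c d) : pos τ t s = pos τ t' s' := by
  rcases lt_or_ge τ c with h | h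
  · rw [pos_of_lt (h.trans_le ht.1), pos_of_lt (h.trans_le ht'.1)]
  · have h2 : d < τ := not_le.1 fun h2 => hτ ⟨h, h2⟩
    rw [pos_of_gt (ht.2.trans_lt h2), pos_of_gt (ht'.2.trans_lt h2)]

theorem uIcc_subset_J {p q : ℝ} (hp : p ∈ J) (hq : q ∈ J) : uIcc p q ⊆ J :=
  uIcc_subset_Icc hp hq

theorem uIoc_subset_J {p q : ℝ} (hp : p ∈ J) (hq : q ∈ J) : uIoc p q ⊆ Ioc (-1 / 2) (1 / 2) :=
  Ioc_subset_Ioc (le_min hp.1 hq.1) (max_le hp.2 hq.2)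

/-! ### Increments generated by densities in time and in the parameter -/

namespace ImpulsiveSystem

variable {n : ℕ} (S : ImpulsiveSystem n)

/-- The rate of the impulse at `τ k`. -/
def rate (k : ℕ) (r : ℝ) : ℝ := ∑ j, |S.c k j * S.α k r j|

/-- The total mass of the impulse at `τ k`. -/
def mass (k : ℕ) : ℝ := ∫ r in (-1 / 2 : ℝ)..(1 / 2), S.rate k r

theorem rate_nonneg (k : ℕ) (r : ℝ) : 0 ≤ S.rate k r := Finset.sum_nonneg fun _ _ => abs_nonneg _

theorem mass_nonneg (k : ℕ) : 0 ≤ S.mass k :=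
  intervalIntegral.integral_nonneg (by norm_num) fun r _ => S.rate_nonneg k r

/-- The increment, between the points `(t, s)` and `(t', s')`, that is generated by the density `D`
in time and the densities `K k` in the parameter at the times `τ k`. -/
def flow {E : Type*} [NormedAddCommGroup E] [NormedSpace ℝ E] (D : ℝ → E) (K : ℕ → ℝ → E)
    (t s t' s' : ℝ) : E :=
  (∫ r in t..t', D r) + ∑' k, ∫ r in pos (S.τ k) t s..pos (S.τ k) t' s', K k r

/-- The densities `D` and `K` generate well-defined increments in `[c, d]`. -/
structure FlowAdm {E : Type*} [NormedAddCommGroup E] (c d : ℝ) (D : ℝ → E) (K : ℕ → ℝ → E) :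
    Prop where
  summable : Summable ((S.τ ⁻¹' Icc c d).indicator S.mass)
  rate_cont : ∀ k, ContinuousOn (S.rate k) J
  int : IntegrableOn D (Icc c d)
  cont : ∀ k, S.τ k ∈ Icc c d → ContinuousOn (K k) J
  bound : ∃ C, 0 ≤ C ∧ ∀ k, S.τ k ∈ Icc c d → ∀ r ∈ J, ‖K k r‖ ≤ C * S.rate k r

namespace FlowAdm

set_option linter.unusedSectionVars false

variable {S} {E : Type*} [NormedAddCommGroup E] [NormedSpace ℝ E] [CompleteSpace E]
  {c d : ℝ} {D D' : ℝ → E}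
  {K K' : ℕ → ℝ → E} {t s t' s' t'' s'' : ℝ}

theorem intervalIntegrable_rate (h : S.FlowAdm c d D K) (k : ℕ) {p q : ℝ} (hp : p ∈ J)
    (hq : q ∈ J) : IntervalIntegrable (S.rate k) volume p q :=
  ((h.rate_cont k).mono (uIcc_subset_J hp hq)).intervalIntegrable

theorem intervalIntegrable_kick (h : S.FlowAdm c d D K) {k : ℕ} (hk : S.τ k ∈ Icc c d) {p q : ℝ}
    (hp : p ∈ J) (hq : q ∈ J) : IntervalIntegrable (K k) volume p q :=
  ((h.cont k hk).mono (uIcc_subset_J hp hq)).intervalIntegrable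

theorem intervalIntegrable (h : S.FlowAdm c d D K) (ht : t ∈ Icc c d) (ht' : t' ∈ Icc c d) :
    IntervalIntegrable D volume t t' :=
  (h.int.mono_set (uIcc_subset_Icc ht ht')).intervalIntegrable

/-- Elapsed time plus the mass of the impulses passed is the common scale in which all increments
are estimated. -/
theorem clock (h : S.FlowAdm c d D K) : S.FlowAdm c d (fun _ => (1 : ℝ)) S.rate where
  summable := h.summable
  rate_cont := h.rate_cont
  int := by simp
  cont k _ := h.rate_cont k
  bound := ⟨1, zero_le_one, fun k _ r _ => by
    rw [one_mul, Real.norm_eq_abs, abs_of_nonneg (S.rate_nonneg k r)]⟩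

theorem norm_integral_kick_le {C : ℝ} (h : S.FlowAdm c d D K) (hC : 0 ≤ C) {k : ℕ}
    (hb : ∀ r ∈ J, ‖K k r‖ ≤ C * S.rate k r) {p q : ℝ} (hp : p ∈ J) (hq : q ∈ J) :
    ‖∫ r in p..q, K k r‖ ≤ C * S.mass k := by
  have hJ : IntegrableOn (fun r => C * S.rate k r) (Ioc (-1 / 2) (1 / 2)) :=
    ((intervalIntegrable_iff_integrableOn_Ioc_of_le (by norm_num)).1
      (h.intervalIntegrable_rate k neg_half_mem_J half_mem_J)).const_mul C
  calc ‖∫ r in p..q, K k r‖ ≤ ∫ r in uIoc p q, ‖K k r‖ :=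
        intervalIntegral.norm_integral_le_integral_norm_uIoc
    _ ≤ ∫ r in uIoc p q, C * S.rate k r := by
        refine integral_mono_of_nonneg (Eventually.of_forall fun _ => norm_nonneg _)
          (hJ.mono_set (uIoc_subset_J hp hq)) ?_
        filter_upwards [ae_restrict_mem measurableSet_uIoc] with r hr
        exact hb r (Ioc_subset_Icc_self (uIoc_subset_J hp hq hr))
    _ ≤ ∫ r in Ioc (-1 / 2) (1 / 2), C * S.rate k r := by
        refine setIntegral_mono_set hJ (Eventually.of_forall fun r =>
          mul_nonneg hC (S.rate_nonneg k r)) (uIoc_subset_J hp hq).eventuallyLE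
    _ = C * S.mass k := by
        rw [mass, intervalIntegral.integral_of_le (by norm_num), integral_const_mul]

theorem summable_kick (h : S.FlowAdm c d D K) (ht : t ∈ Icc c d) (ht' : t' ∈ Icc c d)
    (hs : s ∈ J) (hs' : s' ∈ J) :
    Summable fun k => ∫ r in pos (S.τ k) t s..pos (S.τ k) t' s', K k r := by
  obtain ⟨C, hC, hb⟩ := h.bound
  refine Summable.of_norm_bounded (h.summable.mul_left C) fun k => ?_
  by_cases hk : S.τ k ∈ Icc c d
  · rw [indicator_of_mem (show k ∈ S.τ ⁻¹' Icc c d from hk)]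
    exact h.norm_integral_kick_le hC (hb k hk) (pos_mem_J hs) (pos_mem_J hs')
  · rw [pos_eq_pos ht ht' hk, intervalIntegral.integral_same, norm_zero]
    exact mul_nonneg hC (indicator_nonneg (fun k _ => S.mass_nonneg k) k)

/-- Impulses outside `[c, d]` do not change their position and drop out; the others add by adjacency
of the integration intervals. -/
theorem flow_add (h : S.FlowAdm c d D K) (ht : t ∈ Icc c d) (ht' : t' ∈ Icc c d)
    (ht'' : t'' ∈ Icc c d) (hs : s ∈ J) (hs' : s' ∈ J) (hs'' : s'' ∈ J) :
    S.flow D K t s t' s' + S.flow D K t' s' t'' s'' = S.flow D K t s t'' s'' := by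
  rw [flow, flow, flow, ← intervalIntegral.integral_add_adjacent_intervals
    (h.intervalIntegrable ht ht') (h.intervalIntegrable ht' ht''), add_add_add_comm,
    ← (h.summable_kick ht ht' hs hs').tsum_add (h.summable_kick ht' ht'' hs' hs'')]
  congr 1
  refine tsum_congr fun k => ?_
  by_cases hk : S.τ k ∈ Icc c d
  · exact intervalIntegral.integral_add_adjacent_intervals
      (h.intervalIntegrable_kick hk (pos_mem_J hs) (pos_mem_J hs'))
      (h.intervalIntegrable_kick hk (pos_mem_J hs') (pos_mem_J hs''))
  · rw [pos_eq_pos ht ht' hk, intervalIntegral.integral_same, zero_add]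

theorem flow_sub (h : S.FlowAdm c d D K) (h' : S.FlowAdm c d D' K') (ht : t ∈ Icc c d)
    (ht' : t' ∈ Icc c d) (hs : s ∈ J) (hs' : s' ∈ J) :
    S.flow D K t s t' s' - S.flow D' K' t s t' s' =
      S.flow (fun r => D r - D' r) (fun k r => K k r - K' k r) t s t' s' := by
  rw [flow, flow, flow, intervalIntegral.integral_sub (h.intervalIntegrable ht ht')
    (h'.intervalIntegrable ht ht'), add_sub_add_comm,
    ← (h.summable_kick ht ht' hs hs').tsum_sub (h'.summable_kick ht ht' hs hs')]
  congr 1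
  refine tsum_congr fun k => ?_
  by_cases hk : S.τ k ∈ Icc c d
  · exact (intervalIntegral.integral_sub
      (h.intervalIntegrable_kick hk (pos_mem_J hs) (pos_mem_J hs'))
      (h'.intervalIntegrable_kick hk (pos_mem_J hs) (pos_mem_J hs'))).symm
  · simp only [pos_eq_pos ht ht' hk (s := s) (s' := s'), intervalIntegral.integral_same, sub_zero]

/-- The bounds are required only on the part of time and of each jump that is actually passed,
because in the applications they hold only near the starting point. -/
theorem norm_flow_le {C : ℝ} (h : S.FlowAdm c d (fun _ => (1 : ℝ)) S.rate) (ht : t ∈ Icc c d)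
    (ht' : t' ∈ Icc c d) (hs : s ∈ J) (hs' : s' ∈ J) (hlex : LexLE t s t' s')
    (hD : ∀ r ∈ Ioc t t', ‖D r‖ ≤ C)
    (hK : ∀ k, S.τ k ∈ Icc t t' → ∀ r ∈ Icc (pos (S.τ k) t s) (pos (S.τ k) t' s'),
      ‖K k r‖ ≤ C * S.rate k r) :
    ‖S.flow D K t s t' s'‖ ≤ C * S.flow (fun _ => (1 : ℝ)) S.rate t s t' s' := by
  rw [flow, flow, mul_add, ← tsum_mul_left]
  refine (norm_add_le _ _).trans (add_le_add ?_ ?_)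
  · rw [← intervalIntegral.integral_const_mul]
    refine intervalIntegral.norm_integral_le_of_norm_le hlex.le
      (Eventually.of_forall fun r hr => ?_) intervalIntegrable_const
    rw [mul_one]
    exact hD r hr
  · refine tsum_of_norm_bounded ((h.summable_kick ht ht' hs hs').mul_left C).hasSum fun k => ?_
    by_cases hk : S.τ k ∈ Icc t t'
    · rw [← intervalIntegral.integral_const_mul]
      exact intervalIntegral.norm_integral_le_of_norm_le (pos_le_pos hlex hs hs')
        (Eventually.of_forall fun r hr => hK k hk r ⟨hr.1.le, hr.2⟩)
        ((h.intervalIntegrable_rate k (pos_mem_J hs) (pos_mem_J hs')).const_mul C)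
    · rw [pos_eq_pos (left_mem_Icc.2 hlex.le) (right_mem_Icc.2 hlex.le) hk (s := s) (s' := s')]
      simp

theorem flow_nonneg {D : ℝ → ℝ} {K : ℕ → ℝ → ℝ} (hs : s ∈ J) (hs' : s' ∈ J)
    (hlex : LexLE t s t' s') (hD : ∀ᵐ r, r ∈ Ioc t t' → 0 ≤ D r)
    (hK : ∀ k, S.τ k ∈ Icc t t' → ∀ r ∈ J, 0 ≤ K k r) : 0 ≤ S.flow D K t s t' s' := by
  refine add_nonneg ?_ (tsum_nonneg fun k => ?_)
  · rw [intervalIntegral.integral_of_le hlex.le]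
    exact setIntegral_nonneg_of_ae_restrict ((ae_restrict_iff' measurableSet_Ioc).2 hD)
  · by_cases hk : S.τ k ∈ Icc t t'
    · exact intervalIntegral.integral_nonneg (pos_le_pos hlex hs hs') fun r hr =>
        hK k hk r ⟨(pos_mem_J hs).1.trans hr.1, hr.2.trans (pos_mem_J hs').2⟩
    · rw [pos_eq_pos (left_mem_Icc.2 hlex.le) (right_mem_Icc.2 hlex.le) hk (s := s) (s' := s')]
      simp

theorem map_flow (h : S.FlowAdm c d D K) (ht : t ∈ Icc c d) (ht' : t' ∈ Icc c d)
    (hs : s ∈ J) (hs' : s' ∈ J) (L : E →L[ℝ] ℝ) :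
    L (S.flow D K t s t' s') = S.flow (fun r => L (D r)) (fun k r => L (K k r)) t s t' s' := by
  rw [flow, flow, map_add, ← L.intervalIntegral_comp_comm (h.intervalIntegrable ht ht'),
    L.map_tsum (h.summable_kick ht ht' hs hs')]
  congr 1
  refine tsum_congr fun k => ?_
  by_cases hk : S.τ k ∈ Icc c d
  · exact (L.intervalIntegral_comp_comm
      (h.intervalIntegrable_kick hk (pos_mem_J hs) (pos_mem_J hs'))).symm
  · simp [pos_eq_pos ht ht' hk (s := s) (s' := s')]

theorem flow_self : S.flow D K t s t s = 0 := by
  simp [flow]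

/-- Dominated convergence: each single impulse time eventually leaves `A r`, and the masses in `[c,
d]` are summable. -/
theorem tendsto_mass (h : S.FlowAdm c d D K) {l : Filter ℝ} {A : ℝ → Set ℝ}
    (hA : ∀ᶠ r in l, A r ⊆ Icc c d) (hlim : ∀ τ, ∀ᶠ r in l, τ ∉ A r) :
    Tendsto (fun r => ∑' k, (S.τ ⁻¹' A r).indicator S.mass k) l (𝓝 0) := by
  have : Tendsto (fun r => ∑' k, (S.τ ⁻¹' A r).indicator S.mass k) l (𝓝 (∑' _ : ℕ, (0:ℝ))) := by
    refine tendsto_tsum_of_dominated_convergence h.summable (fun k => ?_) ?_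
    · refine tendsto_const_nhds.congr' ?_
      filter_upwards [hlim (S.τ k)] with r hr
      exact (indicator_of_notMem (show k ∉ S.τ ⁻¹' A r from hr) _).symm
    · filter_upwards [hA] with r hr k
      rw [Real.norm_eq_abs, abs_of_nonneg (indicator_nonneg (fun k _ => S.mass_nonneg k) k)]
      exact indicator_le_indicator_of_subset (preimage_mono hr) (fun k => S.mass_nonneg k) k
  rwa [tsum_zero] at this

/-- Here `A` collects the impulse times whose position changes. No order of the two points is
assumed, hence the absolute value around the integral. -/
theorem exists_norm_flow_le_mass (h : S.FlowAdm c d D K) : ∃ C, 0 ≤ C ∧ ∀ t s t' s', t ∈ Icc c d →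
    t' ∈ Icc c d → s ∈ J → s' ∈ J → ∀ A ⊆ Icc c d,
      (∀ τ ∈ Icc c d, τ ∉ A → pos τ t s = pos τ t' s') →
    ‖S.flow D K t s t' s'‖ ≤ |∫ r in t..t', ‖D r‖| + C * ∑' k, (S.τ ⁻¹' A).indicator S.mass k := by
  obtain ⟨C, hC, hb⟩ := h.bound
  refine ⟨C, hC, fun t s t' s' ht ht' hs hs' A hA hpos => ?_⟩
  rw [← tsum_mul_left]
  refine (norm_add_le _ _).trans (add_le_add intervalIntegral.norm_integral_le_abs_integral_norm ?_)
  have hsum : Summable fun k => C * (S.τ ⁻¹' A).indicator S.mass k := by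
    refine Summable.mul_left C (h.summable.of_nonneg_of_le
      (fun k => indicator_nonneg (fun k _ => S.mass_nonneg k) k) fun k => ?_)
    exact indicator_le_indicator_of_subset (preimage_mono hA) (fun k => S.mass_nonneg k) k
  refine tsum_of_norm_bounded hsum.hasSum fun k => ?_
  by_cases hk : S.τ k ∈ A
  · rw [indicator_of_mem (show k ∈ S.τ ⁻¹' A from hk)]
    exact h.norm_integral_kick_le hC (hb k (hA hk)) (pos_mem_J hs) (pos_mem_J hs')
  · have : pos (S.τ k) t s = pos (S.τ k) t' s' := by
      by_cases hk' : S.τ k ∈ Icc c d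
      · exact hpos _ hk' hk
      · exact pos_eq_pos ht ht' hk'
    rw [this, intervalIntegral.integral_same, norm_zero,
      indicator_of_notMem (show k ∉ S.τ ⁻¹' A from hk), mul_zero]

theorem tendsto_integral_norm (h : S.FlowAdm c d D K) (ht : t ∈ Icc c d) {s : Set ℝ} :
    Tendsto (fun r => |∫ q in r..t, ‖D q‖|) (𝓝[Icc c d ∩ s] t) (𝓝 0) := by
  have hcd : c ≤ d := ht.1.trans ht.2
  have hint : IntegrableOn (fun q => ‖D q‖) (uIcc c d) := by
    rw [uIcc_of_le hcd]
    exact h.int.norm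
  have h1 : ContinuousOn (fun r => ∫ q in t..r, ‖D q‖) (uIcc c d) :=
    intervalIntegral.continuousOn_primitive_interval'
      (by rw [intervalIntegrable_iff, ]; exact hint.mono_set uIoc_subset_uIcc)
      (by rwa [uIcc_of_le hcd])
  rw [uIcc_of_le hcd] at h1
  have h2 : Tendsto (fun r => ∫ q in t..r, ‖D q‖) (𝓝[Icc c d] t) (𝓝 (∫ q in t..t, ‖D q‖)) := h1 t ht
  rw [intervalIntegral.integral_same] at h2
  have h3 := (h2.abs).mono_left (nhdsWithin_mono t (inter_subset_left (t := s)))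
  rw [abs_zero] at h3
  refine h3.congr fun r => ?_
  rw [intervalIntegral.integral_symm, abs_neg]

/-- Between `(r, s)` and `(t, -1/2)` only impulses in `[r, t)` act, since the impulse at `t` has not
begun. Their mass tends to 0 and does not depend on `s`, which gives the uniformity. -/
theorem tendstoUniformlyOn_left (h : S.FlowAdm c d D K) (ht : t ∈ Icc c d) :
    TendstoUniformlyOn (fun r s => S.flow D K r s t (-1 / 2)) (fun _ => 0)
      (𝓝[Icc c d ∩ Iio t] t) J := by
  obtain ⟨C, hC, hb⟩ := h.exists_norm_flow_le_mass
  have h1 : Tendsto (fun r => |∫ q in r..t, ‖D q‖| +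
      C * ∑' k, (S.τ ⁻¹' (Ico r t)).indicator S.mass k) (𝓝[Icc c d ∩ Iio t] t)
      (𝓝 (0 + C * 0)) := by
    refine (h.tendsto_integral_norm ht).add (Tendsto.const_mul C (h.tendsto_mass ?_ fun τ => ?_))
    · filter_upwards [self_mem_nhdsWithin] with r hr
      exact fun τ hτ => ⟨hr.1.1.trans hτ.1, hτ.2.le.trans ht.2⟩
    · rcases lt_or_ge τ t with hτ | hτ
      · filter_upwards [mem_nhdsWithin_of_mem_nhds (Ioi_mem_nhds hτ)] with r hr hr'
        exact absurd hr'.1 (not_le.2 hr)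
      · exact Eventually.of_forall fun r hr => absurd hr.2 (not_lt.2 hτ)
  rw [mul_zero, add_zero] at h1
  refine Metric.tendstoUniformlyOn_iff.2 fun ε hε => ?_
  filter_upwards [self_mem_nhdsWithin, h1.eventually (gt_mem_nhds hε)] with r hr hlt s hs
  rw [dist_zero_left]
  refine (hb r s t (-1 / 2) hr.1 ht hs neg_half_mem_J (Ico r t)
    (fun τ hτ => ⟨hr.1.1.trans hτ.1, hτ.2.le.trans ht.2⟩) fun τ _ hτ => ?_).trans_lt hlt
  rcases lt_or_ge τ r with h3 | h3
  · rw [pos_of_lt h3, pos_of_lt (h3.trans hr.2)]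
  · have h4 : t ≤ τ := not_lt.1 fun h4 => hτ ⟨h3, h4⟩
    rw [pos_of_gt (lt_of_lt_of_le hr.2 h4)]
    rcases h4.eq_or_lt with h5 | h5
    · rw [h5, pos_self]
    · rw [pos_of_gt h5]

theorem tendstoUniformlyOn_right (h : S.FlowAdm c d D K) (ht : t ∈ Icc c d) :
    TendstoUniformlyOn (fun r s => S.flow D K r s t (1 / 2)) (fun _ => 0)
      (𝓝[Icc c d ∩ Ioi t] t) J := by
  obtain ⟨C, hC, hb⟩ := h.exists_norm_flow_le_mass
  have h1 : Tendsto (fun r => |∫ q in r..t, ‖D q‖| +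
      C * ∑' k, (S.τ ⁻¹' (Ioc t r)).indicator S.mass k) (𝓝[Icc c d ∩ Ioi t] t)
      (𝓝 (0 + C * 0)) := by
    refine (h.tendsto_integral_norm ht).add (Tendsto.const_mul C (h.tendsto_mass ?_ fun τ => ?_))
    · filter_upwards [self_mem_nhdsWithin] with r hr
      exact fun τ hτ => ⟨ht.1.trans hτ.1.le, hτ.2.trans hr.1.2⟩
    · rcases lt_or_ge t τ with hτ | hτ
      · filter_upwards [mem_nhdsWithin_of_mem_nhds (Iio_mem_nhds hτ)] with r hr hr'
        exact absurd hr'.2 (not_le.2 hr)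
      · exact Eventually.of_forall fun r hr => absurd hr.1 (not_lt.2 hτ)
  rw [mul_zero, add_zero] at h1
  refine Metric.tendstoUniformlyOn_iff.2 fun ε hε => ?_
  filter_upwards [self_mem_nhdsWithin, h1.eventually (gt_mem_nhds hε)] with r hr hlt s hs
  rw [dist_zero_left]
  refine (hb r s t (1 / 2) hr.1 ht hs half_mem_J (Ioc t r)
    (fun τ hτ => ⟨ht.1.trans hτ.1.le, hτ.2.trans hr.1.2⟩) fun τ _ hτ => ?_).trans_lt hlt
  rcases lt_or_ge r τ with h3 | h3
  · rw [pos_of_gt h3, pos_of_gt (lt_trans hr.2 h3)]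
  · have h4 : τ ≤ t := not_lt.1 fun h4 => hτ ⟨h4, h3⟩
    rw [pos_of_lt (lt_of_le_of_lt h4 hr.2)]
    rcases h4.eq_or_lt with h5 | h5
    · rw [h5, pos_self]
    · rw [pos_of_lt h5]

theorem continuousOn_flow (h : S.FlowAdm c d D K) {t₀ s₀ : ℝ} (ht₀ : t₀ ∈ Icc c d)
    (ht : t ∈ Icc c d) (hs₀ : s₀ ∈ J) : ContinuousOn (fun s => S.flow D K t₀ s₀ t s) J := by
  obtain ⟨C, hC, hb⟩ := h.bound
  refine continuousOn_const.add (continuousOn_tsum (u := fun k =>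
    C * (S.τ ⁻¹' Icc c d).indicator S.mass k) (fun k => ?_) (h.summable.mul_left C)
    fun k s hs => ?_)
  · rcases lt_trichotomy (S.τ k) t with h1 | h1 | h1
    · simp only [pos_of_lt h1]
      exact continuousOn_const
    · have hk : S.τ k ∈ Icc c d := h1 ▸ ht
      have h2 := intervalIntegral.continuousOn_primitive_interval' (a := pos (S.τ k) t₀ s₀)
        (h.intervalIntegrable_kick hk neg_half_mem_J half_mem_J)
        (by rw [uIcc_eq_J]; exact pos_mem_J hs₀)
      rw [uIcc_eq_J] at h2
      simp only [h1, pos_self] at h2 ⊢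
      exact h2
    · simp only [pos_of_gt h1]
      exact continuousOn_const
  · by_cases hk : S.τ k ∈ Icc c d
    · rw [indicator_of_mem (show k ∈ S.τ ⁻¹' Icc c d from hk)]
      exact h.norm_integral_kick_le hC (hb k hk) (pos_mem_J hs₀) (pos_mem_J hs)
    · rw [pos_eq_pos ht₀ ht hk, intervalIntegral.integral_same, norm_zero]
      exact mul_nonneg hC (indicator_nonneg (fun k _ => S.mass_nonneg k) k)

theorem joins_flow (h : S.FlowAdm c d D K) {t₀ s₀ : ℝ} (ht₀ : t₀ ∈ Icc c d) (hs₀ : s₀ ∈ J) :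
    Joins c d (fun t s => S.flow D K t₀ s₀ t s) := by
  have hsub : ∀ t ∈ openInterval c d, t ∈ Ioo c d := fun t ht =>
    ⟨EReal.coe_lt_coe_iff.1 ht.1, EReal.coe_lt_coe_iff.1 ht.2⟩
  have hnhds : ∀ t ∈ openInterval c d, ∀ s : Set ℝ, 𝓝[s] t = 𝓝[Icc c d ∩ s] t := fun t ht s =>
    (nhdsWithin_inter_of_mem (mem_nhdsWithin_of_mem_nhds
      (Icc_mem_nhds (hsub t ht).1 (hsub t ht).2))).symm
  refine ⟨fun t ht => h.continuousOn_flow ht₀ (Ioo_subset_Icc_self (hsub t ht)) hs₀,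
    fun t ht => ?_, fun t ht => ?_⟩
  · have ht' := Ioo_subset_Icc_self (hsub t ht)
    refine Metric.tendstoUniformlyOn_iff.2 fun ε hε => ?_
    rw [hnhds t ht]
    filter_upwards [self_mem_nhdsWithin,
      Metric.tendstoUniformlyOn_iff.1 (h.tendstoUniformlyOn_left ht') ε hε] with r hr hlt s hs
    have := hlt s hs
    rw [dist_zero_left] at this
    rwa [dist_eq_norm, ← h.flow_add ht₀ hr.1 ht' hs₀ hs neg_half_mem_J, add_sub_cancel_left]
  · have ht' := Ioo_subset_Icc_self (hsub t ht)
    refine Metric.tendstoUniformlyOn_iff.2 fun ε hε => ?_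
    rw [hnhds t ht]
    filter_upwards [self_mem_nhdsWithin,
      Metric.tendstoUniformlyOn_iff.1 (h.tendstoUniformlyOn_right ht') ε hε] with r hr hlt s hs
    have := hlt s hs
    rw [dist_zero_left] at this
    rwa [dist_eq_norm, ← h.flow_add ht₀ hr.1 ht' hs₀ hs half_mem_J, add_sub_cancel_left]

end FlowAdm

end ImpulsiveSystem

/-! ## Masses of the impulses -/

theorem hasDerivAt_of_eq_integral {f q : ℝ → ℝ} (hq : ContinuousOn q J)
    (hf : ∀ σ ∈ J, f σ = f (-1 / 2) + ∫ r in (-1 / 2 : ℝ)..σ, q r) {s : ℝ}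
    (hs : s ∈ Ioo (-1 / 2 : ℝ) (1 / 2)) : HasDerivAt f (q s) s := by
  have hsJ : s ∈ J := Ioo_subset_Icc_self hs
  have h1 : HasDerivAt (fun σ => ∫ r in (-1 / 2 : ℝ)..σ, q r) (q s) s :=
    intervalIntegral.integral_hasDerivAt_right
      (hq.mono (uIcc_subset_J neg_half_mem_J hsJ)).intervalIntegrable
      ((hq.mono Ioo_subset_Icc_self).stronglyMeasurableAtFilter isOpen_Ioo s hs)
      (hq.continuousAt (Icc_mem_nhds hs.1 hs.2))
  refine (h1.const_add (f (-1 / 2))).congr_of_eventuallyEq ?_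
  filter_upwards [Icc_mem_nhds hs.1 hs.2] with σ hσ
  exact hf σ hσ

/-- If `V` is the variation function of `f`, comparison of slopes gives `|q| ≤ V'` almost
everywhere, and the derivative of a monotone function integrates to at most its increment. -/
theorem integral_abs_le_eVariationOn {f q : ℝ → ℝ} (hq : ContinuousOn q J)
    (hf : ∀ σ ∈ J, f σ = f (-1 / 2) + ∫ r in (-1 / 2 : ℝ)..σ, q r)
    (hbv : BoundedVariationOn f J) :
    ∫ r in (-1 / 2 : ℝ)..(1 / 2), |q r| ≤ (eVariationOn f J).toReal := by
  set V := variationOnFromTo f J (-1 / 2) with hV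
  have hloc := hbv.locallyBoundedVariationOn
  have mono : MonotoneOn V J := variationOnFromTo.monotoneOn hloc neg_half_mem_J
  have dist : ∀ x ∈ J, ∀ y ∈ J, x ≤ y → |f y - f x| ≤ V y - V x := by
    intro x hx y hy hxy
    have h1 : V y - V x = variationOnFromTo f J x y := by
      rw [hV, ← variationOnFromTo.add hloc neg_half_mem_J hx hy]
      ring
    rw [h1, variationOnFromTo.eq_of_le _ _ hxy]
    exact (hbv.mono inter_subset_left).dist_le (x := y) (y := x) ⟨hy, hxy, le_rfl⟩ ⟨hx, le_rfl, hxy⟩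
  have hV1 : V (1 / 2) - V (-1 / 2) = (eVariationOn f J).toReal := by
    rw [hV, variationOnFromTo.self, sub_zero, variationOnFromTo.eq_of_le _ _ (by norm_num)]
    congr 2
    exact inter_self _
  have mono' : MonotoneOn V (uIcc (-1 / 2) (1 / 2)) := by rwa [uIcc_eq_J]
  have h2 := mono'.intervalIntegral_deriv_mem_uIcc
  rw [uIcc_of_le (sub_nonneg.2 (mono neg_half_mem_J half_mem_J (by norm_num)))] at h2
  rw [← hV1]
  refine le_trans ?_ h2.2
  have hdiff : ∀ᵐ s, s ∈ J → DifferentiableWithinAt ℝ V J s :=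
    mono.ae_differentiableWithinAt_of_mem
  refine intervalIntegral.integral_mono_ae_restrict (by norm_num) ?_ mono'.intervalIntegrable_deriv ?_
  · refine ContinuousOn.intervalIntegrable ?_
    rw [uIcc_eq_J]
    exact hq.abs
  · rw [EventuallyLE, ae_restrict_iff' measurableSet_Icc]
    have hne : ∀ r : ℝ, ∀ᵐ s : ℝ, s ≠ r := fun r => by simp [ae_iff, measure_singleton]
    filter_upwards [hdiff, hne (-1 / 2), hne (1 / 2)] with s hs hs1 hs2 hsJ
    have hsI : s ∈ Ioo (-1 / 2 : ℝ) (1 / 2) :=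
      ⟨lt_of_le_of_ne hsJ.1 (Ne.symm hs1), lt_of_le_of_ne hsJ.2 hs2⟩
    have hnb : J ∈ 𝓝 s := Icc_mem_nhds hsI.1 hsI.2
    have dV := ((hs hsJ).differentiableAt hnb).hasDerivAt
    have df := hasDerivAt_of_eq_integral hq hf hsI
    have tV := (hasDerivAt_iff_tendsto_slope.1 dV).mono_left
      (nhdsWithin_mono s (fun r (hr : r ∈ Ioi s) => ne_of_gt hr))
    have tf := ((hasDerivAt_iff_tendsto_slope.1 df).mono_left
      (nhdsWithin_mono s (fun r (hr : r ∈ Ioi s) => ne_of_gt hr))).abs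
    refine le_of_tendsto_of_tendsto tf tV ?_
    filter_upwards [self_mem_nhdsWithin, mem_nhdsWithin_of_mem_nhds hnb] with r hr hrJ
    have hr' : 0 < r - s := sub_pos.2 hr
    rw [slope_def_field, slope_def_field, abs_div, abs_of_pos hr']
    gcongr
    exact dist s hsJ r hrJ (le_of_lt hr)

namespace ImpulsiveSystem

variable {n : ℕ} {S : ImpulsiveSystem n}

theorem vPairing_of_eq_zero {ψ : DynFun} {τ : ℝ} (hψ : ∀ t ≠ τ, ∀ s ∈ J, ψ t s = 0) (j : Fin n) :
    S.vPairing j ψ = ∑' k, S.c k j * ∫ s in pos (S.τ k) τ (-1 / 2)..pos (S.τ k) τ (1 / 2),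
      S.α k s j * ψ τ s := by
  have h1 : regularPairing S.left S.right (fun t => S.w t j) ψ = 0 := by
    refine integral_eq_zero_of_ae (ae_restrict_of_ae ?_)
    have : ∀ᵐ t : ℝ, t ≠ τ := by simp [ae_iff, measure_singleton]
    filter_upwards [this] with t ht
    simp [ordPart, hψ t ht 0 zero_mem_J]
  rw [vPairing, h1, zero_add]
  refine tsum_congr fun k => ?_
  congr 1
  by_cases hk : S.τ k = τ
  · rw [hk, pos_self, pos_self, deltaPairing]
  · have h2 : pos (S.τ k) τ (-1 / 2) = pos (S.τ k) τ (1 / 2) :=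
      pos_eq_pos (c := τ) (d := τ) (left_mem_Icc.2 le_rfl) (left_mem_Icc.2 le_rfl)
        fun h => hk (le_antisymm h.2 h.1)
    rw [h2, intervalIntegral.integral_same, deltaPairing,
      intervalIntegral.integral_of_le (by norm_num)]
    refine setIntegral_eq_zero_of_forall_eq_zero fun s hs => ?_
    rw [hψ _ hk s (Ioc_subset_Icc_self hs), mul_zero]

namespace StandingAssumptions

variable {Ω : Set ℝ} (hS : S.StandingAssumptions Ω)
include hS

theorem continuousOn_shape (k : ℕ) (j : Fin n) : ContinuousOn (fun s => S.α k s j) J :=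
  (continuous_apply j).comp_continuousOn (hS.α_cont k)

theorem continuousOn_rate (k : ℕ) : ContinuousOn (S.rate k) J :=
  continuousOn_finsetSum _ fun j _ => (continuousOn_const.mul (hS.continuousOn_shape k j)).abs

/-- Testing a primitive `u` of `v` with steps at `τ k` shows that `u (τ k)` has the density `c k * α
k`. So the mass of the impulse is at most the sum of the variations of the components of `u (τ k)`,
and these variations are summable on compact intervals. -/
theorem summable_mass {c d : ℝ} (hc : c ∈ S.I) (hd : d ∈ S.I) :
    Summable ((S.τ ⁻¹' Icc c d).indicator S.mass) := by
  obtain ⟨u, hu⟩ := hS.primitive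
  have key : ∀ j k, ∫ r in (-1 / 2 : ℝ)..(1 / 2), |S.c k j * S.α k r j| ≤
      (eVariationOn (fun s => u (S.τ k) s j) J).toReal := by
    intro j k
    obtain ⟨hsbv, heq⟩ := hu j
    refine integral_abs_le_eVariationOn
      (continuousOn_const.mul (hS.continuousOn_shape k j)) (fun σ hσ => ?_)
      (hsbv.boundedVariationOn_value (hS.τ_mem k))
    have hk : S.τ k ∈ openInterval S.left S.right := hS.τ_mem k
    have h1 := heq (pointTest hk (isRegulatedOnJ_step σ))
    rw [hsbv.derivPairing_step hk hσ,
      vPairing_of_eq_zero (τ := S.τ k) (fun t ht s _ => pointTest_of_ne hk _ ht s) j,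
      tsum_eq_single k] at h1
    · rw [pos_self, pos_self] at h1
      have h2 : ∫ s in (-1 / 2 : ℝ)..(1 / 2), S.α k s j *
          (pointTest hk (isRegulatedOnJ_step σ)).toFun (S.τ k) s =
          ∫ s in (-1 / 2 : ℝ)..σ, S.α k s j := by
        rw [← integral_step_mul hσ]
        refine intervalIntegral.integral_congr fun s _ => ?_
        simp only [pointTest_self]
        ring
      rw [h2] at h1
      rw [intervalIntegral.integral_const_mul, ← h1]
      ring
    · intro k' hk'
      have hne : S.τ k' ≠ S.τ k := fun h => hk' (hS.τ_inj h)
      have h2 : pos (S.τ k') (S.τ k) (-1 / 2) = pos (S.τ k') (S.τ k) (1 / 2) :=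
        pos_eq_pos (c := S.τ k) (d := S.τ k) (left_mem_Icc.2 le_rfl) (left_mem_Icc.2 le_rfl)
          fun h => hne (le_antisymm h.2 h.1)
      rw [h2, intervalIntegral.integral_same, mul_zero]
  have hsum : Summable fun k => ∑ j, (Icc c d).indicator
      (fun τ => (eVariationOn (fun s => u τ s j) J).toReal) (S.τ k) :=
    summable_sum fun j _ => ((hu j).1.summable_eVariationOn hc hd).comp_injective hS.τ_inj
  refine hsum.of_nonneg_of_le (fun k => indicator_nonneg (fun k _ => S.mass_nonneg k) k)
    fun k => ?_
  by_cases hk : S.τ k ∈ Icc c d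
  · rw [indicator_of_mem (show k ∈ S.τ ⁻¹' Icc c d from hk)]
    simp only [indicator_of_mem hk]
    rw [mass]
    simp only [rate]
    rw [intervalIntegral.integral_finsetSum]
    · exact Finset.sum_le_sum fun j _ => key j k
    · intro j _
      refine ContinuousOn.intervalIntegrable ?_
      rw [uIcc_eq_J]
      exact (continuousOn_const.mul (hS.continuousOn_shape k j)).abs
  · rw [indicator_of_notMem (show k ∉ S.τ ⁻¹' Icc c d from hk)]
    simp only [indicator_of_notMem hk, Finset.sum_const_zero, le_refl]

end StandingAssumptions

end ImpulsiveSystem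

/-! ## Densities along a path -/

theorem norm_mulVec_le {n : ℕ} {A : Matrix (Fin n) (Fin n) ℝ} {C : ℝ} (hC : 0 ≤ C)
    (hA : ∀ i j, |A i j| ≤ C) (v : Fin n → ℝ) : ‖A.mulVec v‖ ≤ C * ∑ j, |v j| := by
  refine (pi_norm_le_iff_of_nonneg (mul_nonneg hC (Finset.sum_nonneg fun _ _ => abs_nonneg _))).2
    fun i => ?_
  rw [Matrix.mulVec, dotProduct, Finset.mul_sum]
  refine (norm_sum_le _ _).trans (Finset.sum_le_sum fun j _ => ?_)
  rw [norm_mul, Real.norm_eq_abs, Real.norm_eq_abs]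
  exact mul_le_mul_of_nonneg_right (hA i j) (abs_nonneg _)

namespace ImpulsiveSystem

variable {n : ℕ} (S : ImpulsiveSystem n)

/-- The density in time of the right-hand side along `x`. -/
def drift (x : ℝ → ℝ → Fin n → ℝ) (t : ℝ) : Fin n → ℝ :=
  S.f t (x t 0) + (S.g t (x t 0) 0).mulVec (S.w t)

/-- The density in the parameter of the right-hand side along `x` at the time `τ k`. -/
def kick (x : ℝ → ℝ → Fin n → ℝ) (k : ℕ) (s : ℝ) : Fin n → ℝ :=
  (S.g (S.τ k) (x (S.τ k) s) s).mulVec (S.c k * S.α k s)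

/-- A dynamic path in the domain of the system. -/
structure IsPath (a b : EReal) (x : ℝ → ℝ → Fin n → ℝ) : Prop where
  le_left : S.left ≤ a
  le_right : b ≤ S.right
  joins : Joins a b x
  mem : ∀ t ∈ openInterval a b, ∀ s ∈ J, x t s ∈ S.N

variable {S} {Ω : Set ℝ} {a b : EReal} {x y : ℝ → ℝ → Fin n → ℝ}

theorem IsPath.subset_I (hx : S.IsPath a b x) : openInterval a b ⊆ S.I :=
  openInterval_mono hx.le_left hx.le_right

theorem isPath_const {y : Fin n → ℝ} (hy : y ∈ S.N) : S.IsPath S.left S.right fun _ _ => y where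
  le_left := le_rfl
  le_right := le_rfl
  joins := ⟨fun _ _ => continuousOn_const,
    fun _ _ => Metric.tendstoUniformlyOn_iff.2 fun ε hε => Eventually.of_forall fun _ _ _ => by
      rwa [dist_self],
    fun _ _ => Metric.tendstoUniformlyOn_iff.2 fun ε hε => Eventually.of_forall fun _ _ _ => by
      rwa [dist_self]⟩
  mem _ _ _ _ := hy

theorem norm_kick_le {C : ℝ} (hC : 0 ≤ C) {k : ℕ} {s : ℝ}
    (h : ∀ i j, |S.g (S.τ k) (x (S.τ k) s) s i j| ≤ C) : ‖S.kick x k s‖ ≤ C * S.rate k s :=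
  norm_mulVec_le hC h _

namespace StandingAssumptions

variable (hS : S.StandingAssumptions Ω)
include hS

theorem exists_lipschitz_g : ∃ L : ℝ, 0 ≤ L ∧ ∀ t ∈ S.I, ∀ s ∈ J, ∀ i j, ∀ y ∈ S.N, ∀ z ∈ S.N,
    |S.g t y s i j - S.g t z s i j| ≤ L * ‖y - z‖ := by
  obtain ⟨K, hK⟩ := hS.g_lip
  refine ⟨K, K.2, fun t ht s hs i j y hy z hz => ?_⟩
  have := (hK t ht s hs i j).dist_le_mul y hy z hz
  rwa [Real.dist_eq, dist_eq_norm] at this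

theorem exists_lipschitz_f : ∃ L : ℝ, 0 ≤ L ∧ ∀ t ∈ S.I, ∀ y ∈ S.N, ∀ z ∈ S.N,
    ‖S.f t y - S.f t z‖ ≤ L * ‖y - z‖ := by
  obtain ⟨K, hK⟩ := hS.f_lip
  refine ⟨K, K.2, fun t ht y hy z hz => ?_⟩
  have := (hK t ht).dist_le_mul y hy z hz
  rwa [dist_eq_norm, dist_eq_norm] at this

/-- As `r` approaches `t` from one side, `x r s` is uniformly close to the endpoint `x t σ`, with `σ
= -1/2` or `σ = 1/2`. The Lipschitz bound, uniform in time and parameter, permits replacing `x r s`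
by this fixed point, where the one-sided limit of `g` is known. -/
theorem joins_coefficient (hx : S.IsPath a b x) (i j : Fin n) :
    Joins a b fun t s => S.g t (x t s) s i j := by
  obtain ⟨L, hL, hLip⟩ := hS.exists_lipschitz_g
  have side : ∀ t ∈ openInterval a b, ∀ (l : Filter ℝ) (σ : ℝ), σ ∈ J → l ≤ 𝓝 t →
      TendstoUniformlyOn x (fun _ => x t σ) l J →
      HasDynLimit (fun r s => S.g r (x t σ) s i j) l (S.g t (x t σ) σ i j) →
      TendstoUniformlyOn (fun t s => S.g t (x t s) s i j) (fun _ => S.g t (x t σ) σ i j) l J := by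
    intro t ht l σ hσ hl h1 h2
    refine Metric.tendstoUniformlyOn_iff.2 fun ε hε => ?_
    -- The denominator `L + 1` covers the case `L = 0`.
    have hδ : 0 < ε / 2 / (L + 1) := by positivity
    filter_upwards [Metric.tendstoUniformlyOn_iff.1 h1 _ hδ,
      Metric.tendstoUniformlyOn_iff.1 h2 _ (half_pos hε),
      hl ((isOpen_openInterval a b).mem_nhds ht)] with r hr1 hr2 hr s hs
    have e1 := hr1 s hs
    have e2 := hr2 s hs
    have e3 := hLip r (hx.subset_I hr) s hs i j _ (hx.mem t ht σ hσ) _ (hx.mem r hr s hs)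
    rw [dist_eq_norm] at e1
    rw [Real.dist_eq] at e2 ⊢
    have e4 : L * ‖x t σ - x r s‖ ≤ ε / 2 := by
      calc L * ‖x t σ - x r s‖ ≤ (L + 1) * (ε / 2 / (L + 1)) := by gcongr; linarith
        _ = ε / 2 := by field_simp
    have e5 := abs_sub_le (S.g t (x t σ) σ i j) (S.g r (x t σ) s i j) (S.g r (x r s) s i j)
    linarith
  refine ⟨fun t ht s hs => ?_, fun t ht => ?_, fun t ht => ?_⟩
  · have hcont := (hS.g_sG _ (hx.mem t ht s hs) i j).joins.joins.cont t (hx.subset_I ht)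
    refine Metric.tendsto_nhds.2 fun ε hε => ?_
    have hδ : 0 < ε / 2 / (L + 1) := by positivity
    filter_upwards [Metric.tendsto_nhds.1 (hcont s hs) _ (half_pos hε),
      Metric.tendsto_nhds.1 (hx.joins.cont t ht s hs) _ hδ, self_mem_nhdsWithin] with r h1 h2 hr
    have e3 := hLip t (hx.subset_I ht) r hr i j _ (hx.mem t ht r hr) _ (hx.mem t ht s hs)
    rw [dist_eq_norm] at h2
    rw [Real.dist_eq] at h1 ⊢
    have e4 : L * ‖x t r - x t s‖ ≤ ε / 2 := by
      calc L * ‖x t r - x t s‖ ≤ (L + 1) * (ε / 2 / (L + 1)) := by gcongr; linarith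
        _ = ε / 2 := by field_simp
    have e5 := abs_sub_le (S.g t (x t r) r i j) (S.g t (x t s) r i j) (S.g t (x t s) s i j)
    linarith
  · exact side t ht _ _ neg_half_mem_J nhdsWithin_le_nhds (hx.joins.left t ht)
      ((hS.g_sG _ (hx.mem t ht _ neg_half_mem_J) i j).joins.left_lim t (hx.subset_I ht))
  · exact side t ht _ _ half_mem_J nhdsWithin_le_nhds (hx.joins.right t ht)
      ((hS.g_sG _ (hx.mem t ht _ half_mem_J) i j).joins.right_lim t (hx.subset_I ht))

theorem exists_bound_coefficient (hx : S.IsPath a b x) {c d : ℝ} (hc : c ∈ openInterval a b)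
    (hd : d ∈ openInterval a b) :
    ∃ C, 0 ≤ C ∧ ∀ t ∈ Icc c d, ∀ s ∈ J, ∀ i j, |S.g t (x t s) s i j| ≤ C := by
  choose C hC using fun i j => (hS.joins_coefficient hx i j).exists_bound hc hd
  refine ⟨∑ i, ∑ j, |C i j|, Finset.sum_nonneg fun _ _ => Finset.sum_nonneg fun _ _ => abs_nonneg _,
    fun t ht s hs i j => ?_⟩
  calc |S.g t (x t s) s i j| ≤ |C i j| := (hC i j t ht s hs).trans (le_abs_self _)
    _ ≤ ∑ j, |C i j| := Finset.single_le_sum (f := fun j => |C i j|)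
        (fun _ _ => abs_nonneg _) (Finset.mem_univ j)
    _ ≤ ∑ i, ∑ j, |C i j| := Finset.single_le_sum (f := fun i => ∑ j, |C i j|)
        (fun _ _ => Finset.sum_nonneg fun _ _ => abs_nonneg _) (Finset.mem_univ i)

theorem continuousOn_kick (hx : S.IsPath a b x) {k : ℕ} (hk : S.τ k ∈ openInterval a b) :
    ContinuousOn (S.kick x k) J := by
  refine continuousOn_pi.2 fun i => ?_
  simp only [kick, Matrix.mulVec, dotProduct]
  refine continuousOn_finsetSum _ fun j _ => ((hS.joins_coefficient hx i j).cont _ hk).mul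
    (continuousOn_const.mul (hS.continuousOn_shape k j))

theorem aestronglyMeasurable_coefficient (hx : S.IsPath a b x) (i j : Fin n) :
    AEStronglyMeasurable (fun t => S.g t (x t 0) 0 i j) (volume.restrict (openInterval a b)) := by
  refine aestronglyMeasurable_of_countable (isOpen_openInterval a b)
    ((hS.joins_coefficient hx i j).countable_nonconstant.mono ?_)
  rintro t ⟨ht, hnc⟩
  exact ⟨ht, fun h => hnc ((hS.joins_coefficient hx i j).continuousAt_of_constant ht zero_mem_J h)⟩

/-- The path is approximated by simple functions with values in `N`; for these the composition is a
finite sum of measurable pieces, and the Lipschitz condition passes to the limit. -/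
theorem aestronglyMeasurable_f (hx : S.IsPath a b x) :
    AEStronglyMeasurable (fun t => S.f t (x t 0)) (volume.restrict (openInterval a b)) := by
  rcases (openInterval a b).eq_empty_or_nonempty with he | ⟨t₁, ht₁⟩
  · rw [he, Measure.restrict_empty]
    exact aestronglyMeasurable_zero_measure _
  obtain ⟨L, hL, hLip⟩ := hS.exists_lipschitz_f
  have hxm : AEStronglyMeasurable (fun t => x t 0) (volume.restrict (openInterval a b)) := by
    refine aestronglyMeasurable_of_countable (isOpen_openInterval a b)
      (hx.joins.countable_nonconstant.mono ?_)
    rintro t ⟨ht, hnc⟩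
    exact ⟨ht, fun h => hnc (hx.joins.continuousAt_of_constant ht zero_mem_J h)⟩
  set y := hxm.mk with hy
  have hym : Measurable y := hxm.stronglyMeasurable_mk.measurable
  have hmem₁ := hx.mem t₁ ht₁ 0 zero_mem_J
  set σ : ℕ → SimpleFunc ℝ (Fin n → ℝ) := fun k => SimpleFunc.approxOn y hym S.N _ hmem₁ k
  have hfm : ∀ v ∈ S.N, AEStronglyMeasurable (fun t => S.f t v)
      (volume.restrict (openInterval a b)) := fun v hv =>
    (hS.f_meas v hv).mono_measure (Measure.restrict_mono hx.subset_I le_rfl)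
  refine aestronglyMeasurable_of_tendsto_ae (f := fun (k : ℕ) t => S.f t (σ k t)) atTop
    (fun k => ?_) ?_
  · have he : (fun t => S.f t (σ k t)) =
        fun t => ∑ v ∈ (σ k).range, ((σ k) ⁻¹' {v}).indicator (fun t => S.f t v) t := by
      funext t
      rw [Finset.sum_eq_single (σ k t)]
      · rw [indicator_of_mem (show t ∈ (σ k) ⁻¹' {σ k t} from rfl)]
      · intro v _ hv
        exact indicator_of_notMem (fun h => hv (Eq.symm h)) _
      · intro h
        exact absurd (SimpleFunc.mem_range_self (σ k) t) h
    rw [he]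
    refine Finset.aestronglyMeasurable_fun_sum _ fun v hv => ?_
    obtain ⟨t, rfl⟩ := SimpleFunc.mem_range.1 hv
    exact (hfm _ (SimpleFunc.approxOn_mem hym hmem₁ k t)).indicator
      ((σ k).measurableSet_fiber _)
  · filter_upwards [hxm.ae_eq_mk, ae_restrict_mem (isOpen_openInterval a b).measurableSet]
      with t h1 ht
    have hxt := hx.mem t ht 0 zero_mem_J
    have h2 : Tendsto (fun k => σ k t) atTop (𝓝 (x t 0)) := by
      have h1' : x t 0 = y t := h1
      rw [h1']
      exact SimpleFunc.tendsto_approxOn hym hmem₁ (subset_closure (h1' ▸ hxt))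
    rw [tendsto_iff_norm_sub_tendsto_zero] at h2 ⊢
    have h3 := h2.const_mul L
    rw [mul_zero] at h3
    exact squeeze_zero (fun _ => norm_nonneg _) (fun k => hLip t (hx.subset_I ht) _
      (SimpleFunc.approxOn_mem hym hmem₁ k t) _ hxt) h3

/-- The Carathéodory majorant is applied only on the compact set `Icc c d ×ˢ {x c 0}`; the deviation
of `x` from this frozen point is bounded and costs a constant by the Lipschitz condition. -/
theorem integrableOn_f (hx : S.IsPath a b x) {c d : ℝ} (hc : c ∈ openInterval a b)
    (hd : d ∈ openInterval a b) : IntegrableOn (fun t => S.f t (x t 0)) (Icc c d) := by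
  obtain ⟨L, hL, hLip⟩ := hS.exists_lipschitz_f
  have hsub := Icc_subset_openInterval hc hd
  have hy := hx.mem c hc 0 zero_mem_J
  obtain ⟨R, hR⟩ := hx.joins.exists_bound hc hd
  obtain ⟨r, hr, hb⟩ := hS.f_bound (Icc c d ×ˢ {x c 0}) (isCompact_Icc.prod isCompact_singleton)
    (prod_mono (hsub.trans hx.subset_I) (singleton_subset_iff.2 hy))
  refine Integrable.mono' (g := fun t => r t + L * (R + R))
    ((hr.mono_set (hsub.trans hx.subset_I)).add (integrableOn_const (by simp) enorm_ne_top))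
    ((hS.aestronglyMeasurable_f hx).mono_measure (Measure.restrict_mono hsub le_rfl)) ?_
  filter_upwards [ae_restrict_mem measurableSet_Icc] with t ht
  have h1 := hb (t, x c 0) ⟨ht, rfl⟩
  have h2 := hLip t (hx.subset_I (hsub ht)) _ (hx.mem t (hsub ht) 0 zero_mem_J) _ hy
  have h3 : ‖x t 0 - x c 0‖ ≤ R + R := (norm_sub_le _ _).trans (add_le_add (hR t ht 0 zero_mem_J)
    (hR c (left_mem_Icc.2 (ht.1.trans ht.2)) 0 zero_mem_J))
  have h4 := norm_le_norm_add_norm_sub' (S.f t (x t 0)) (S.f t (x c 0))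
  have h5 := mul_le_mul_of_nonneg_left h3 hL
  simp only at h1
  linarith

theorem integrableOn_coefficient_mul (hx : S.IsPath a b x) {c d : ℝ} (hc : c ∈ openInterval a b)
    (hd : d ∈ openInterval a b) (i j : Fin n) :
    IntegrableOn (fun t => S.g t (x t 0) 0 i j * S.w t j) (Icc c d) := by
  have hsub := Icc_subset_openInterval hc hd
  obtain ⟨C, hC, hb⟩ := hS.exists_bound_coefficient hx hc hd
  have hw : ContinuousOn (fun t => S.w t j) (Icc c d) :=
    (continuous_apply j).comp_continuousOn (hS.w_cont.mono (hsub.trans hx.subset_I))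
  refine (hw.integrableOn_compact isCompact_Icc).bdd_mul (c := C)
    ((hS.aestronglyMeasurable_coefficient hx i j).mono_measure (Measure.restrict_mono hsub le_rfl))
    ?_
  filter_upwards [ae_restrict_mem measurableSet_Icc] with t ht
  exact hb t ht 0 zero_mem_J i j

theorem integrableOn_drift (hx : S.IsPath a b x) {c d : ℝ} (hc : c ∈ openInterval a b)
    (hd : d ∈ openInterval a b) : IntegrableOn (S.drift x) (Icc c d) := by
  refine (hS.integrableOn_f hx hc hd).add (Integrable.of_eval fun i => ?_)
  simp only [Matrix.mulVec, dotProduct]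
  exact integrable_finsetSum _ fun j _ => hS.integrableOn_coefficient_mul hx hc hd i j

theorem flowAdm (hx : S.IsPath a b x) {c d : ℝ} (hc : c ∈ openInterval a b)
    (hd : d ∈ openInterval a b) : S.FlowAdm c d (S.drift x) (S.kick x) where
  summable := hS.summable_mass (hx.subset_I hc) (hx.subset_I hd)
  rate_cont := hS.continuousOn_rate
  int := hS.integrableOn_drift hx hc hd
  cont k hk := hS.continuousOn_kick hx (Icc_subset_openInterval hc hd hk)
  bound := by
    obtain ⟨C, hC, hb⟩ := hS.exists_bound_coefficient hx hc hd
    exact ⟨C, hC, fun k hk r hr => norm_kick_le hC (hb _ hk r hr)⟩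

end StandingAssumptions

end ImpulsiveSystem

/-! ### The right-hand side as a distribution, and solutions in terms of increments -/

theorem IsRegulatedOnJ.aestronglyMeasurable {β : ℝ → ℝ} (h : IsRegulatedOnJ β) :
    AEStronglyMeasurable β (volume.restrict (Ioc (-1 / 2) (1 / 2))) := by
  have hU : IsOpen (Ioo (-1 / 2 : ℝ) (1 / 2)) := isOpen_Ioo
  rw [← Measure.restrict_congr_set Ioo_ae_eq_Ioc]
  refine aestronglyMeasurable_of_countable hU
    (countable_not_continuousAt_of_oneSided (fun t ht => ?_) (fun t ht => ?_))
  · exact h.left_lim t (Ioo_subset_Icc_self ht) (ne_of_gt ht.1)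
  · exact h.right_lim t (Ioo_subset_Icc_self ht) (ne_of_lt ht.2)

namespace ImpulsiveSystem

variable {n : ℕ} {S : ImpulsiveSystem n} {Ω : Set ℝ} {a b : EReal} {x : ℝ → ℝ → Fin n → ℝ}

/-- The finite sum over components is exchanged with the integral and the series. The series
converge absolutely because each term is bounded by a multiple of the mass of its impulse. -/
theorem StandingAssumptions.pairing_eq (hS : S.StandingAssumptions Ω) (hx : S.IsPath a b x)
    (φ : TestFun a b) (i : Fin n) :
    regularPairing a b (fun t => S.f t (x t 0) i) φ.toFun +
        ∑ j, S.vPairing j (fun t s => S.g t (x t s) s i j * φ.toFun t s) =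
      (∫ t in Icc φ.lo φ.hi, S.drift x t i * φ.toFun t 0) +
        ∑' k, ∫ s in (-1 / 2 : ℝ)..(1 / 2), S.kick x k s i * φ.toFun (S.τ k) s := by
  have hsub := Icc_subset_openInterval φ.lo_mem φ.hi_mem
  obtain ⟨B, hB⟩ := φ.exists_bound
  obtain ⟨C, hC, hbound⟩ := hS.exists_bound_coefficient hx φ.lo_mem φ.hi_mem
  have hB0 : 0 ≤ B := (abs_nonneg _).trans (hB 0 0 zero_mem_J)
  have hφm : AEStronglyMeasurable (fun t => φ.toFun t 0) (volume.restrict (Icc φ.lo φ.hi)) :=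
    φ.aestronglyMeasurable_ordPart.restrict
  have hφb : ∀ᵐ t ∂volume.restrict (Icc φ.lo φ.hi), ‖φ.toFun t 0‖ ≤ B :=
    Eventually.of_forall fun t => hB t 0 zero_mem_J
  have hadm := hS.flowAdm hx φ.lo_mem φ.hi_mem
  have hreg : ∀ (U : Set ℝ) (h : ℝ → ℝ), MeasurableSet U → Icc φ.lo φ.hi ⊆ U →
      ∫ t in U, h t * φ.toFun t 0 = ∫ t in Icc φ.lo φ.hi, h t * φ.toFun t 0 := by
    intro U h hU hsub
    refine setIntegral_eq_of_subset_of_forall_sdiff_eq_zero hU hsub fun t ht => ?_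
    rw [φ.eq_zero t ht.2 0 zero_mem_J, mul_zero]
  have hint : ∀ j, Integrable (fun t => S.g t (x t 0) 0 i j * S.w t j * φ.toFun t 0)
      (volume.restrict (Icc φ.lo φ.hi)) := fun j =>
    (hS.integrableOn_coefficient_mul hx φ.lo_mem φ.hi_mem i j).mul_bdd hφm hφb
  have hf : Integrable (fun t => S.f t (x t 0) i * φ.toFun t 0)
      (volume.restrict (Icc φ.lo φ.hi)) :=
    ((hS.integrableOn_f hx φ.lo_mem φ.hi_mem).eval i).mul_bdd hφm hφb
  -- the regular parts
  have h1 : regularPairing a b (fun t => S.f t (x t 0) i) φ.toFun =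
      ∫ t in Icc φ.lo φ.hi, S.f t (x t 0) i * φ.toFun t 0 :=
    hreg _ _ (isOpen_openInterval a b).measurableSet hsub
  have h2 : ∀ j, regularPairing S.left S.right (fun t => S.w t j)
      (fun t s => S.g t (x t s) s i j * φ.toFun t s) =
      ∫ t in Icc φ.lo φ.hi, S.g t (x t 0) 0 i j * S.w t j * φ.toFun t 0 := by
    intro j
    rw [← hreg _ _ (isOpen_openInterval S.left S.right).measurableSet (hsub.trans hx.subset_I)]
    refine integral_congr_ae (Eventually.of_forall fun t => ?_)
    simp only [ordPart]
    ring
  -- the impulses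
  set q : Fin n → ℕ → ℝ := fun j k => S.c k j * deltaPairing (S.τ k) (fun s => S.α k s j)
    (fun t s => S.g t (x t s) s i j * φ.toFun t s) with hq
  have hterm : ∀ j k, IntervalIntegrable (fun s => S.g (S.τ k) (x (S.τ k) s) s i j *
      (S.c k j * S.α k s j) * φ.toFun (S.τ k) s) volume (-1 / 2) (1 / 2) := by
    intro j k
    by_cases hk : S.τ k ∈ Icc φ.lo φ.hi
    · rw [intervalIntegrable_iff_integrableOn_Ioc_of_le (by norm_num)]
      refine Integrable.mul_bdd (c := B) ?_
        (φ.regulated.value_regulated _ (hsub hk)).aestronglyMeasurable ?_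
      · refine (ContinuousOn.integrableOn_compact isCompact_J ?_).mono_set Ioc_subset_Icc_self
        exact ((hS.joins_coefficient hx i j).cont _ (hsub hk)).mul
          (continuousOn_const.mul (hS.continuousOn_shape k j))
      · filter_upwards [ae_restrict_mem measurableSet_Ioc] with s hs
        exact hB _ s (Ioc_subset_Icc_self hs)
    · refine (IntervalIntegrable.zero (μ := volume)).congr ?_
      intro s hs
      rw [uIoc_of_le (by norm_num)] at hs
      simp [φ.eq_zero _ hk s (Ioc_subset_Icc_self hs)]
  have hqe : ∀ j k, q j k = ∫ s in (-1 / 2 : ℝ)..(1 / 2), S.g (S.τ k) (x (S.τ k) s) s i j *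
      (S.c k j * S.α k s j) * φ.toFun (S.τ k) s := by
    intro j k
    rw [hq]
    simp only [deltaPairing]
    rw [← intervalIntegral.integral_const_mul]
    refine intervalIntegral.integral_congr fun s _ => ?_
    ring
  have hqs : ∀ j, Summable (q j) := by
    intro j
    refine Summable.of_norm_bounded (hadm.summable.mul_left (C * B)) fun k => ?_
    rw [hqe]
    by_cases hk : S.τ k ∈ Icc φ.lo φ.hi
    · rw [indicator_of_mem (show k ∈ S.τ ⁻¹' Icc φ.lo φ.hi from hk), mass,
        ← intervalIntegral.integral_const_mul]
      refine intervalIntegral.norm_integral_le_of_norm_le (by norm_num)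
        (Eventually.of_forall fun s hs => ?_)
        ((hadm.intervalIntegrable_rate k neg_half_mem_J half_mem_J).const_mul _)
      have hsJ : s ∈ J := Ioc_subset_Icc_self hs
      have e1 : |S.c k j * S.α k s j| ≤ S.rate k s :=
        Finset.single_le_sum (f := fun j => |S.c k j * S.α k s j|) (fun _ _ => abs_nonneg _)
          (Finset.mem_univ j)
      rw [norm_mul, norm_mul, Real.norm_eq_abs, Real.norm_eq_abs, Real.norm_eq_abs]
      calc _ ≤ C * S.rate k s * B := by
            gcongr
            exacts [mul_nonneg hC (S.rate_nonneg k s), hbound _ hk s hsJ i j, hB _ s hsJ]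
        _ = _ := by ring
    · rw [indicator_of_notMem (show k ∉ S.τ ⁻¹' Icc φ.lo φ.hi from hk), mul_zero]
      refine le_of_eq (norm_eq_zero.2 ?_)
      rw [intervalIntegral.integral_of_le (by norm_num)]
      refine setIntegral_eq_zero_of_forall_eq_zero fun s hs => ?_
      rw [φ.eq_zero _ hk s (Ioc_subset_Icc_self hs), mul_zero]
  have hv : ∀ j, S.vPairing j (fun t s => S.g t (x t s) s i j * φ.toFun t s) =
      (∫ t in Icc φ.lo φ.hi, S.g t (x t 0) 0 i j * S.w t j * φ.toFun t 0) + ∑' k, q j k :=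
    fun j => by rw [vPairing, h2]
  simp_rw [h1, hv, Finset.sum_add_distrib, ← add_assoc]
  rw [← integral_finsetSum _ fun j _ => hint j,
    ← integral_add hf (integrable_finsetSum _ fun j _ => hint j),
    ← Summable.tsum_finsetSum fun j _ => hqs j]
  congr 1
  · refine integral_congr_ae (Eventually.of_forall fun t => ?_)
    simp only [drift, Pi.add_apply, Matrix.mulVec, dotProduct, add_mul, Finset.sum_mul]
  · refine tsum_congr fun k => ?_
    simp_rw [hqe]
    rw [← intervalIntegral.integral_finsetSum fun j _ => hterm j k]
    refine intervalIntegral.integral_congr fun s _ => ?_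
    simp only [kick, Matrix.mulVec, dotProduct, Finset.sum_mul, Pi.mul_apply]

/-- Solutions in terms of their increments. -/
structure IsPathSolution (S : ImpulsiveSystem n) (a b : EReal) (x : ℝ → ℝ → Fin n → ℝ) : Prop
    extends S.IsPath a b x where
  lt : a < b
  increment : ∀ t ∈ openInterval a b, ∀ t' ∈ openInterval a b, ∀ s ∈ J, ∀ s' ∈ J,
    x t' s' - x t s = S.flow (S.drift x) (S.kick x) t s t' s'

theorem IsSolution.isPath (h : S.IsSolution a b x) : S.IsPath a b x where
  le_left := h.le_left
  le_right := h.le_right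
  joins := joins_of_components fun i => (h.sbv i).joins
  mem := h.mem

/-- The indicator of `[c, d]` yields the increment from `(c, -1/2)` to `(d, 1/2)`, and a step at the
single time `t` the one from `(t, -1/2)` to `(t, s)`. Additivity of `flow` produces all others. -/
theorem IsSolution.isPathSolution (hS : S.StandingAssumptions Ω) (h : S.IsSolution a b x) :
    S.IsPathSolution a b x := by
  have hx := h.isPath
  have hlong : ∀ t ∈ openInterval a b, ∀ t' ∈ openInterval a b, t ≤ t' →
      x t' (1 / 2) - x t (-1 / 2) = S.flow (S.drift x) (S.kick x) t (-1 / 2) t' (1 / 2) := by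
    intro c hc d hd hcd
    have hadm := hS.flowAdm hx hc hd
    funext i
    have h1 := h.eq (intervalTest hc hd) i
    rw [(h.sbv i).derivPairing_intervalTest hc hd hcd, hS.pairing_eq hx] at h1
    have h2 := hadm.map_flow (left_mem_Icc.2 hcd) (right_mem_Icc.2 hcd) neg_half_mem_J half_mem_J
      (ContinuousLinearMap.proj (R := ℝ) i)
    simp only [ContinuousLinearMap.proj_apply] at h2
    rw [Pi.sub_apply, h1, h2, flow]
    congr 1
    · rw [intervalIntegral.integral_of_le hcd, ← integral_Icc_eq_integral_Ioc]
      refine setIntegral_congr_fun measurableSet_Icc fun t ht => ?_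
      simp only [intervalTest, indicator_of_mem (show t ∈ Icc c d from ht), mul_one]
    · refine tsum_congr fun k => ?_
      by_cases hk : S.τ k ∈ Icc c d
      · have e1 : pos (S.τ k) c (-1 / 2) = -1 / 2 := by
          rcases hk.1.eq_or_lt with e | e
          · rw [e, pos_self]
          · exact pos_of_gt e _
        have e2 : pos (S.τ k) d (1 / 2) = 1 / 2 := by
          rcases hk.2.eq_or_lt with e | e
          · rw [e, pos_self]
          · exact pos_of_lt e _
        simp only [e1, e2, intervalTest, indicator_of_mem hk, mul_one]
      · rw [pos_eq_pos (left_mem_Icc.2 hcd) (right_mem_Icc.2 hcd) hk (s' := 1 / 2)]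
        simp only [intervalTest, indicator_of_notMem hk, mul_zero, intervalIntegral.integral_same,
          intervalIntegral.integral_zero]
  have hshort : ∀ t ∈ openInterval a b, ∀ s ∈ J,
      x t s - x t (-1 / 2) = S.flow (S.drift x) (S.kick x) t (-1 / 2) t s := by
    intro t ht s hs
    have hadm := hS.flowAdm hx ht ht
    have htt : t ∈ Icc t t := left_mem_Icc.2 le_rfl
    funext i
    have h1 := h.eq (pointTest ht (isRegulatedOnJ_step s)) i
    rw [(h.sbv i).derivPairing_step ht hs, hS.pairing_eq hx] at h1
    have h2 := hadm.map_flow htt htt neg_half_mem_J hs (ContinuousLinearMap.proj (R := ℝ) i)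
    simp only [ContinuousLinearMap.proj_apply] at h2
    rw [Pi.sub_apply, h1, h2, flow]
    congr 1
    · rw [intervalIntegral.integral_same]
      change ∫ r in Icc t t, _ = _
      rw [Icc_self]
      simp
    · refine tsum_congr fun k => ?_
      by_cases hk : S.τ k = t
      · rw [hk, pos_self, pos_self, ← integral_step_mul hs]
        refine intervalIntegral.integral_congr fun r _ => ?_
        simp only [pointTest_self]
        ring
      · rw [pos_eq_pos htt htt (fun hk' => hk (le_antisymm hk'.2 hk'.1)) (s' := s)]
        simp only [pointTest_of_ne ht _ hk, mul_zero, intervalIntegral.integral_same,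
          intervalIntegral.integral_zero]
  have hle : ∀ t ∈ openInterval a b, ∀ t' ∈ openInterval a b, t ≤ t' → ∀ s ∈ J, ∀ s' ∈ J,
      x t' s' - x t s = S.flow (S.drift x) (S.kick x) t s t' s' := by
    intro t ht t' ht' htt s hs s' hs'
    have hadm := hS.flowAdm hx ht ht'
    have m := left_mem_Icc.2 htt
    have m' := right_mem_Icc.2 htt
    have e1 := hshort t ht s hs
    have e2 := hshort t' ht' s' hs'
    have e3 := hlong t ht t' ht' htt
    have e4 := hshort t' ht' (1 / 2) half_mem_J
    have a1 := hadm.flow_add m m m' neg_half_mem_J hs hs'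
    have a2 := hadm.flow_add m m' m' neg_half_mem_J neg_half_mem_J half_mem_J
    have a3 := hadm.flow_add m m' m' neg_half_mem_J neg_half_mem_J hs'
    rw [← e1, ← a3, ← e2] at a1
    rw [← e3, ← e4] at a2
    rw [eq_sub_of_add_eq' a1, eq_sub_of_add_eq a2]
    abel
  refine ⟨hx, h.lt, fun t ht t' ht' s hs s' hs' => ?_⟩
  rcases le_total t t' with htt | htt
  · exact hle t ht t' ht' htt s hs s' hs'
  · have hadm := hS.flowAdm hx ht' ht
    have m := left_mem_Icc.2 htt
    have m' := right_mem_Icc.2 htt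
    have a1 := hadm.flow_add m m' m hs' hs hs'
    rw [FlowAdm.flow_self, ← hle t' ht' t ht htt s' hs' s hs] at a1
    rw [eq_neg_of_add_eq_zero_right a1]
    abel

end ImpulsiveSystem

/-! ### From increments back to the distributional equation -/

theorem absolutelyContinuousOnInterval_of_eq_integral {f q : ℝ → ℝ} (hq : ContinuousOn q J)
    (hf : ∀ σ ∈ J, f σ = f (-1 / 2) + ∫ r in (-1 / 2 : ℝ)..σ, q r) :
    AbsolutelyContinuousOnInterval f (-1 / 2) (1 / 2) := by
  obtain ⟨C, hC⟩ := isCompact_J.exists_bound_of_continuousOn hq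
  have hC0 : 0 ≤ C := (norm_nonneg _).trans (hC 0 zero_mem_J)
  refine LipschitzOnWith.absolutelyContinuousOnInterval (K := ⟨C, hC0⟩) ?_
  rw [uIcc_eq_J]
  refine LipschitzOnWith.of_dist_le_mul fun s hs s' hs' => ?_
  have hi : ∀ σ ∈ J, IntervalIntegrable q volume (-1 / 2) σ := fun σ hσ =>
    (hq.mono (uIcc_subset_J neg_half_mem_J hσ)).intervalIntegrable
  rw [dist_eq_norm, hf s hs, hf s' hs', add_sub_add_left_eq_sub,
    intervalIntegral.integral_interval_sub_left (hi s hs) (hi s' hs'), dist_eq_norm,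
    Real.norm_eq_abs (s - s')]
  exact intervalIntegral.norm_integral_le_of_norm_le_const fun r hr =>
    hC r (Ioc_subset_Icc_self (uIoc_subset_J hs' hs hr))

theorem stieltjesIntegral_zero (h : ℝ → ℝ) : stieltjesIntegral (fun _ => 0) h = 0 := by
  rw [stieltjesIntegral]
  split_ifs <;> simp

namespace ImpulsiveSystem

variable {n : ℕ} {S : ImpulsiveSystem n} {Ω : Set ℝ} {a b : EReal} {x : ℝ → ℝ → Fin n → ℝ}

/-- The drift is merely integrable in general, so its norm is kept as a density and only the
impulses are compared with their rates. -/
theorem FlowAdm.norm_flow_le_flow {E : Type*} [NormedAddCommGroup E] [NormedSpace ℝ E]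
    [CompleteSpace E]
    {c d t s t' s' C : ℝ} {D : ℝ → E} {K : ℕ → ℝ → E} (h : S.FlowAdm c d D K) (ht : t ∈ Icc c d)
    (ht' : t' ∈ Icc c d) (hs : s ∈ J) (hs' : s' ∈ J) (hlex : LexLE t s t' s')
    (hK : ∀ k, S.τ k ∈ Icc c d → ∀ r ∈ J, ‖K k r‖ ≤ C * S.rate k r) :
    ‖S.flow D K t s t' s'‖ ≤ S.flow (fun r => ‖D r‖) (fun k r => C * S.rate k r) t s t' s' := by
  refine (norm_add_le _ _).trans (add_le_add
    (intervalIntegral.norm_integral_le_integral_norm hlex.le) ?_)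
  have hsum := (h.clock.summable_kick ht ht' hs hs').mul_left C
  simp_rw [← intervalIntegral.integral_const_mul] at hsum
  refine tsum_of_norm_bounded hsum.hasSum fun k => ?_
  by_cases hk : S.τ k ∈ Icc c d
  · exact intervalIntegral.norm_integral_le_of_norm_le (pos_le_pos hlex hs hs')
      (Eventually.of_forall fun r hr => hK k hk r
        ⟨(pos_mem_J hs).1.trans hr.1.le, hr.2.trans (pos_mem_J hs').2⟩)
      ((h.intervalIntegrable_rate k (pos_mem_J hs) (pos_mem_J hs')).const_mul C)
  · rw [pos_eq_pos ht ht' hk (s := s) (s' := s')]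
    simp

namespace IsPathSolution

theorem value_of_notMem (hx : S.IsPathSolution a b x) {t : ℝ} (ht : t ∈ openInterval a b)
    (hr : t ∉ range S.τ) {s : ℝ}
    (hs : s ∈ J) : x t s = x t (-1 / 2) := by
  rw [← sub_eq_zero, hx.increment t ht t ht _ neg_half_mem_J _ hs, flow,
    intervalIntegral.integral_same, zero_add]
  refine (tsum_congr fun k => ?_).trans tsum_zero
  rw [pos_eq_pos (c := t) (d := t) (left_mem_Icc.2 le_rfl) (left_mem_Icc.2 le_rfl)
    (fun h => hr ⟨k, le_antisymm h.2 h.1⟩) (s' := s), intervalIntegral.integral_same]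

theorem isOrdinaryAt_of_notMem (hx : S.IsPathSolution a b x) {t : ℝ} (ht : t ∈ openInterval a b)
    (hr : t ∉ range S.τ)
    (i : Fin n) : IsOrdinaryAt (fun t s => x t s i) t := fun s hs s' hs' => by
  simp only [value_of_notMem hx ht hr hs, value_of_notMem hx ht hr hs']

variable (hS : S.StandingAssumptions Ω) (hx : S.IsPathSolution a b x)
include hS hx

theorem increment_apply {t t' s s' : ℝ} (ht : t ∈ openInterval a b) (ht' : t' ∈ openInterval a b)
    (hs : s ∈ J) (hs' : s' ∈ J) (i : Fin n) :
    x t' s' i - x t s i = S.flow (fun r => S.drift x r i) (fun k r => S.kick x k r i) t s t' s' := by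
  have hmin : min t t' ∈ openInterval a b := by
    rcases min_choice t t' with h | h <;> rw [h] <;> assumption
  have hmax : max t t' ∈ openInterval a b := by
    rcases max_choice t t' with h | h <;> rw [h] <;> assumption
  have h1 := (hS.flowAdm hx.toIsPath hmin hmax).map_flow
    ⟨min_le_left _ _, le_max_left _ _⟩ ⟨min_le_right _ _, le_max_right _ _⟩ hs hs'
    (ContinuousLinearMap.proj (R := ℝ) i)
  simp only [ContinuousLinearMap.proj_apply] at h1
  rw [← h1, ← hx.increment t ht t' ht' s hs s' hs', Pi.sub_apply]

theorem value_of_mem {k : ℕ} (hk : S.τ k ∈ openInterval a b) {s : ℝ} (hs : s ∈ J) (i : Fin n) :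
    x (S.τ k) s i = x (S.τ k) (-1 / 2) i + ∫ r in (-1 / 2 : ℝ)..s, S.kick x k r i := by
  have h1 := increment_apply hS hx hk hk neg_half_mem_J hs i
  rw [flow, intervalIntegral.integral_same, zero_add, tsum_eq_single k, pos_self, pos_self] at h1
  · linarith
  · intro k' hk'
    have hne : S.τ k' ≠ S.τ k := fun h => hk' (hS.τ_inj h)
    rw [pos_eq_pos (c := S.τ k) (d := S.τ k) (left_mem_Icc.2 le_rfl) (left_mem_Icc.2 le_rfl)
      (fun h => hne (le_antisymm h.2 h.1)) (s' := s), intervalIntegral.integral_same]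

theorem joinsLimits (i : Fin n) : JoinsLimits a b fun t s => x t s i where
  value_ac t ht := by
    by_cases hr : t ∈ range S.τ
    · obtain ⟨k, rfl⟩ := hr
      exact absolutelyContinuousOnInterval_of_eq_integral
        ((continuous_apply i).comp_continuousOn (hS.continuousOn_kick hx.toIsPath ht))
        fun σ hσ => value_of_mem hS hx ht hσ i
    · refine absolutelyContinuousOnInterval_of_eq_integral (q := fun _ => 0) continuousOn_const
        fun σ hσ => ?_
      rw [value_of_notMem hx ht hr hσ, intervalIntegral.integral_zero, add_zero]
  left_lim t ht := hasDynLimit_component (hx.joins.left t ht) i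
  right_lim t ht := hasDynLimit_component (hx.joins.right t ht) i

/-- The increments at ordinary times are dominated by the flow of `‖drift‖` and of a multiple of the
rates, which is monotone along them. Non-ordinary values occur only at impulse times, with variation
at most a constant times the mass. -/
theorem isSBVLoc (i : Fin n) : IsSBVLoc a b fun t s => x t s i where
  joins := joinsLimits hS hx i
  ord_bv := by
    intro c d hc hd
    rcases lt_or_ge d c with hdc | hcd
    · rw [Icc_eq_empty (not_le.2 hdc), inter_empty]
      exact BoundedVariationOn.of_subsingleton subsingleton_empty
    have hadm := hS.flowAdm hx.toIsPath hc.1 hd.1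
    obtain ⟨C, hC, hb⟩ := hadm.bound
    have hadm' : S.FlowAdm c d (fun r => ‖S.drift x r‖) (fun k r => C * S.rate k r) :=
      ⟨hadm.summable, hadm.rate_cont, hadm.int.norm,
        fun k _ => continuousOn_const.mul (hadm.rate_cont k), C, hC, fun k _ r _ => by
          rw [norm_mul, Real.norm_eq_abs, Real.norm_eq_abs, abs_of_nonneg hC,
            abs_of_nonneg (S.rate_nonneg k r)]⟩
    set m : ℝ → ℝ := fun t => S.flow (fun r => ‖S.drift x r‖) (fun k r => C * S.rate k r) c 0 t 0
      with hm
    have hdist : ∀ t ∈ Icc c d, ∀ t' ∈ Icc c d, t ≤ t' → |x t' 0 i - x t 0 i| ≤ m t' - m t := by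
      intro t ht t' ht' htt
      have hsub := Icc_subset_openInterval hc.1 hd.1
      have h1 : m t' - m t =
          S.flow (fun r => ‖S.drift x r‖) (fun k r => C * S.rate k r) t 0 t' 0 := by
        rw [hm]
        simp only
        rw [← hadm'.flow_add (left_mem_Icc.2 hcd) ht ht' zero_mem_J zero_mem_J zero_mem_J,
          add_sub_cancel_left]
      have h2 := hadm.norm_flow_le_flow ht ht' zero_mem_J zero_mem_J
        (htt.lt_or_eq.imp id fun h => ⟨h, le_rfl⟩) hb
      rw [h1]
      refine le_trans ?_ h2
      rw [← hx.increment t (hsub ht) t' (hsub ht') 0 zero_mem_J 0 zero_mem_J]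
      exact norm_le_pi_norm (x t' 0 - x t 0) i
    refine boundedVariationOn_of_dist_le (m := m) (C := m d)
      (fun t ht t' ht' htt => hdist t ht.2 t' ht'.2 htt) fun t ht => ?_
    have h0 : m c = 0 := FlowAdm.flow_self
    have h1 := (abs_nonneg _).trans (hdist c (left_mem_Icc.2 hcd) t ht.2 ht.2.1)
    have h2 := (abs_nonneg _).trans (hdist t ht.2 d (right_mem_Icc.2 hcd) ht.2.2)
    rw [abs_of_nonneg (by linarith)]
    linarith
  sum_var := by
    intro c hc d hd
    have hsub := Icc_subset_openInterval hc hd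
    have hadm := hS.flowAdm hx.toIsPath hc hd
    obtain ⟨C, hC, hb⟩ := hadm.bound
    have hrange : ∀ t : {t : ℝ // t ∈ Icc c d ∧ ¬ IsOrdinaryAt (fun t s => x t s i) t},
        ∃ k, S.τ k = t := fun t => by
      by_contra h
      exact t.2.2 (isOrdinaryAt_of_notMem hx (hsub t.2.1) h i)
    choose e he using hrange
    have hinj : Function.Injective e := fun t t' h => Subtype.ext (by rw [← he, ← he, h])
    have hsum := hadm.summable.mul_left C
    have hnn : ∀ k, 0 ≤ C * (S.τ ⁻¹' Icc c d).indicator S.mass k := fun k =>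
      mul_nonneg hC (indicator_nonneg (fun k _ => S.mass_nonneg k) k)
    have hvar : ∀ t : {t : ℝ // t ∈ Icc c d ∧ ¬ IsOrdinaryAt (fun t s => x t s i) t},
        eVariationOn (fun s => x t s i) J ≤
          ENNReal.ofReal (C * (S.τ ⁻¹' Icc c d).indicator S.mass (e t)) := by
      intro t
      have hk : S.τ (e t) ∈ Icc c d := by rw [he]; exact t.2.1
      have hri : ∀ p ∈ J, ∀ q ∈ J, IntervalIntegrable (fun r => C * S.rate (e t) r) volume p q :=
        fun p hp q hq => (hadm.intervalIntegrable_rate (e t) hp hq).const_mul C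
      have hki : ∀ p ∈ J, ∀ q ∈ J,
          IntervalIntegrable (fun r => S.kick x (e t) r i) volume p q := fun p hp q hq =>
        (((continuous_apply i).comp_continuousOn (hadm.cont _ hk)).mono
          (uIcc_subset_J hp hq)).intervalIntegrable
      have hle := eVariationOn_le_of_dist_le (h := fun s => x t s i) (s := J)
        (m := fun s => ∫ r in (-1 / 2 : ℝ)..s, C * S.rate (e t) r) fun s hs s' hs' hss => by
        have h1 := fun σ (hσ : σ ∈ J) => value_of_mem hS hx (hsub hk) hσ i
        simp only [he] at h1
        rw [h1 s hs, h1 s' hs', add_sub_add_left_eq_sub,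
          intervalIntegral.integral_interval_sub_left (hki _ neg_half_mem_J _ hs')
            (hki _ neg_half_mem_J _ hs),
          intervalIntegral.integral_interval_sub_left (hri _ neg_half_mem_J _ hs')
            (hri _ neg_half_mem_J _ hs), ← Real.norm_eq_abs]
        refine intervalIntegral.norm_integral_le_of_norm_le hss
          (Eventually.of_forall fun r hr => ?_) (hri _ hs _ hs')
        exact (norm_le_pi_norm (S.kick x (e t) r) i).trans
          (hb _ hk r ⟨hs.1.trans hr.1.le, hr.2.trans hs'.2⟩)
      have hmono : MonotoneOn (fun s => ∫ r in (-1 / 2 : ℝ)..s, C * S.rate (e t) r) J := by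
        intro s hs s' hs' hss
        rw [← sub_nonneg, intervalIntegral.integral_interval_sub_left (hri _ neg_half_mem_J _ hs')
            (hri _ neg_half_mem_J _ hs)]
        exact intervalIntegral.integral_nonneg hss fun r _ => mul_nonneg hC (S.rate_nonneg _ r)
      have h2 := hmono.eVariationOn_eq neg_half_mem_J half_mem_J
      rw [show J ∩ Icc (-1 / 2 : ℝ) (1 / 2) = J from inter_self _, intervalIntegral.integral_same,
        sub_zero, intervalIntegral.integral_const_mul] at h2
      rw [indicator_of_mem (show e t ∈ S.τ ⁻¹' Icc c d from hk)]
      exact hle.trans h2.le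
    calc _ ≤ ∑' t : {t : ℝ // t ∈ Icc c d ∧ ¬ IsOrdinaryAt (fun t s => x t s i) t},
          ENNReal.ofReal (C * (S.τ ⁻¹' Icc c d).indicator S.mass (e t)) :=
          ENNReal.tsum_le_tsum hvar
      _ ≤ ∑' k, ENNReal.ofReal (C * (S.τ ⁻¹' Icc c d).indicator S.mass k) :=
          ENNReal.tsum_comp_le_tsum_of_injective hinj _
      _ = ENNReal.ofReal (∑' k, C * (S.τ ⁻¹' Icc c d).indicator S.mass k) :=
          (ENNReal.ofReal_tsum_of_nonneg hnn hsum).symm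
      _ < ⊤ := ENNReal.ofReal_lt_top

/-- The kicks passed between `(c, -1/2)` and `(t, -1/2)` are exactly the complete ones at impulse
times in `[c, t)`; subtracting them from an increment leaves the integral of the drift. -/
theorem jumpSum_eq {c t : ℝ} (hc : c ∈ openInterval a b) (ht : t ∈ openInterval a b) (hct : c ≤ t)
    (i : Fin n) : jumpSum (fun t s => x t s i) c t =
      ∑' k, ∫ r in pos (S.τ k) c (-1 / 2)..pos (S.τ k) t (-1 / 2), S.kick x k r i := by
  classical
  have hsub := Icc_subset_openInterval hc ht
  rw [jumpSum, ← hS.τ_inj.tsum_eq]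
  · refine tsum_congr fun k => ?_
    by_cases hk : c ≤ S.τ k ∧ S.τ k < t
    · have e1 : pos (S.τ k) c (-1 / 2) = -1 / 2 := by
        rcases hk.1.eq_or_lt with e | e
        · rw [← e, pos_self]
        · exact pos_of_gt e _
      rw [if_pos hk, e1, pos_of_lt hk.2, jump,
        value_of_mem hS hx (hsub ⟨hk.1, hk.2.le⟩) half_mem_J i, add_sub_cancel_left]
    · rw [if_neg hk]
      have : pos (S.τ k) c (-1 / 2) = pos (S.τ k) t (-1 / 2) := by
        rcases lt_or_ge (S.τ k) c with h | h
        · rw [pos_of_lt h, pos_of_lt (h.trans_le hct)]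
        · have h' : t ≤ S.τ k := not_lt.1 fun h' => hk ⟨h, h'⟩
          have e : ∀ r ≤ S.τ k, pos (S.τ k) r (-1 / 2) = -1 / 2 := fun r hr => by
            rcases hr.eq_or_lt with e | e
            · rw [e, pos_self]
            · exact pos_of_gt e _
          rw [e c h, e t h']
      rw [this, intervalIntegral.integral_same]
  · intro τ hτ
    by_contra hr
    refine hτ ?_
    simp only
    split_ifs with h
    · exact jump_eq_zero_of_isOrdinaryAt
        (isOrdinaryAt_of_notMem hx (hsub ⟨h.1, h.2.le⟩) hr i)
    · rfl

/-- The continuous part of each component is a primitive of its drift, so the Stieltjes integral is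
an ordinary one. At the time `τ k` the path is a primitive of the kick, and elsewhere its value is
constant. -/
theorem isSolution : S.IsSolution a b x where
  le_left := hx.le_left
  lt := hx.lt
  le_right := hx.le_right
  sbv := isSBVLoc hS hx
  mem := hx.mem
  eq := by
    intro φ i
    rw [hS.pairing_eq hx.toIsPath, derivPairing_eq]
    have hsub := Icc_subset_openInterval φ.lo_mem φ.hi_mem
    congr 1
    · rcases lt_or_ge φ.hi φ.lo with h | h
      -- A test function does not carry `lo ≤ hi`; if this fails, its support is empty.
      · have h0 : ordPart φ.toFun = fun _ => 0 := funext fun t =>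
          φ.eq_zero t (by rw [Icc_eq_empty (not_le.2 h)]; exact notMem_empty _) 0 zero_mem_J
        rw [h0, stieltjesIntegral_zero, Icc_eq_empty (not_le.2 h), Measure.restrict_empty,
          integral_zero_measure]
      · obtain ⟨B, hB⟩ := φ.exists_bound
        have hadm := hS.flowAdm hx.toIsPath φ.lo_mem φ.hi_mem
        rw [integral_Icc_eq_integral_Ioc, ← intervalIntegral.integral_of_le h]
        refine stieltjesIntegral_eq_integral (C := B) h ?_ (fun t => ?_)
          φ.aestronglyMeasurable_ordPart fun t => hB t 0 zero_mem_J
        · rw [intervalIntegrable_iff_integrableOn_Icc_of_le h]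
          exact Integrable.eval hadm.int i
        · have ht : max φ.lo (min t φ.hi) ∈ Icc φ.lo φ.hi :=
            ⟨le_max_left _ _, max_le h (min_le_right _ _)⟩
          rw [continuousPart_eq, continuousPart_eq, min_eq_left h, max_self,
            jumpSum_eq hS hx φ.lo_mem (hsub ht) ht.1, jumpSum_eq hS hx φ.lo_mem φ.lo_mem le_rfl]
          have h1 := increment_apply hS hx φ.lo_mem (hsub ht) neg_half_mem_J neg_half_mem_J i
          rw [flow] at h1
          simp only [intervalIntegral.integral_same, tsum_zero, sub_zero]
          linarith
    · rw [← hS.τ_inj.tsum_eq]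
      · refine tsum_congr fun k => ?_
        by_cases hk : S.τ k ∈ Icc φ.lo φ.hi
        · rw [intervalIntegral.integral_of_le (by norm_num), intervalIntegral.integral_of_le
            (by norm_num), integral_Ioc_eq_integral_Ioo, integral_Ioc_eq_integral_Ioo]
          refine setIntegral_congr_fun measurableSet_Ioo fun s hs => ?_
          have hd := hasDerivAt_of_eq_integral
            ((continuous_apply i).comp_continuousOn (hS.continuousOn_kick hx.toIsPath (hsub hk)))
            (fun σ hσ => value_of_mem hS hx (hsub hk) hσ i) hs
          have hd' : deriv (fun s => x (S.τ k) s i) s = S.kick x k s i := hd.deriv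
          rw [hd', mul_comm]
        · refine intervalIntegral.integral_congr fun s hs => ?_
          rw [uIcc_eq_J] at hs
          simp [φ.eq_zero _ hk s hs]
      · intro τ hτ
        by_contra hr
        refine hτ ?_
        by_cases hk : τ ∈ Icc φ.lo φ.hi
        · simp only
          rw [intervalIntegral.integral_of_le (by norm_num), integral_Ioc_eq_integral_Ioo]
          refine setIntegral_eq_zero_of_forall_eq_zero fun s hs => ?_
          have : (fun s => x τ s i) =ᶠ[𝓝 s] fun _ => x τ (-1 / 2) i := by
            filter_upwards [Icc_mem_nhds hs.1 hs.2] with σ hσ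
            rw [value_of_notMem hx (hsub hk) hr hσ]
          rw [this.deriv_eq, deriv_const, mul_zero]
        · simp only
          rw [intervalIntegral.integral_of_le (by norm_num)]
          refine setIntegral_eq_zero_of_forall_eq_zero fun s hs => ?_
          rw [φ.eq_zero _ hk s (Ioc_subset_Icc_self hs), zero_mul]

end IsPathSolution

end ImpulsiveSystem

/-! ## Growth of dynamic functions -/

theorem exists_lt_mem_openInterval {a b : EReal} {t : ℝ} (ht : t ∈ openInterval a b) :
    ∃ c ∈ openInterval a b, c < t := by
  obtain ⟨l, u, hlu, hsub⟩ := mem_nhds_iff_exists_Ioo_subset.1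
    ((isOpen_openInterval a b).mem_nhds ht)
  obtain ⟨c, hc⟩ := exists_between hlu.1
  exact ⟨c, hsub ⟨hc.1, hc.2.trans hlu.2⟩, hc.2⟩

theorem exists_gt_mem_openInterval {a b : EReal} {t : ℝ} (ht : t ∈ openInterval a b) :
    ∃ d ∈ openInterval a b, t < d := by
  obtain ⟨l, u, hlu, hsub⟩ := mem_nhds_iff_exists_Ioo_subset.1
    ((isOpen_openInterval a b).mem_nhds ht)
  obtain ⟨d, hd⟩ := exists_between hlu.2
  exact ⟨d, hsub ⟨hlu.1.trans hd.1, hd.2⟩, hd.1⟩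

namespace Joins

variable {E F : Type*} [NormedAddCommGroup E] [NormedAddCommGroup F] {a b : EReal}
  {x : ℝ → ℝ → E} {y : ℝ → ℝ → F}

theorem map (hx : Joins a b x) {Φ : E → F} (hΦ : Continuous Φ) :
    Joins a b fun t s => Φ (x t s) where
  cont t ht := hΦ.comp_continuousOn (hx.cont t ht)
  left t ht := tendsto_prod_principal_iff.1
    ((hΦ.tendsto _).comp (tendsto_prod_principal_iff.2 (hx.left t ht)))
  right t ht := tendsto_prod_principal_iff.1
    ((hΦ.tendsto _).comp (tendsto_prod_principal_iff.2 (hx.right t ht)))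

theorem prodMk (hx : Joins a b x) (hy : Joins a b y) : Joins a b fun t s => (x t s, y t s) where
  cont t ht := (hx.cont t ht).prodMk (hy.cont t ht)
  left t ht := tendsto_prod_principal_iff.1
    ((tendsto_prod_principal_iff.2 (hx.left t ht)).prodMk_nhds
      (tendsto_prod_principal_iff.2 (hy.left t ht)))
  right t ht := tendsto_prod_principal_iff.1
    ((tendsto_prod_principal_iff.2 (hx.right t ht)).prodMk_nhds
      (tendsto_prod_principal_iff.2 (hy.right t ht)))

theorem left_unique {ξ : E} (hx : Joins a b x) {t : ℝ} (ht : t ∈ openInterval a b)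
    (h : TendstoUniformlyOn x (fun _ => ξ) (𝓝[<] t) J) : x t (-1 / 2) = ξ :=
  tendsto_nhds_unique ((hx.left t ht).tendsto_at zero_mem_J) (h.tendsto_at zero_mem_J)

variable {e D θ : ℝ → ℝ → ℝ} {c d A K : ℝ}

/-- Continuous induction along the path: below the level `A` continuity suffices, and at the level
`A` the hypothesis provides the next step. -/
theorem value_le (he : Joins a b e) {t : ℝ} (ht : t ∈ openInterval a b) (h0 : e t (-1 / 2) ≤ A)
    (hjump : ∀ s ∈ J, s < 1 / 2 → e t s = A → ∀ᶠ s' in 𝓝[>] s, e t s' ≤ A) :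
    ∀ s ∈ J, e t s ≤ A := by
  have hcl : IsClosed ({s | e t s ≤ A} ∩ Icc (-1 / 2) (1 / 2)) := by
    rw [inter_comm]
    exact (he.cont t ht).preimage_isClosed_of_isClosed isClosed_Icc isClosed_Iic
  refine hcl.Icc_subset_of_forall_mem_nhdsWithin h0 fun s hs => ?_
  have hsJ : s ∈ J := ⟨hs.2.1, hs.2.2.le⟩
  have hle : e t s ≤ A := hs.1
  rcases hle.eq_or_lt with h | h
  · exact hjump s hsJ hs.2.2 h
  · have h1 := (he.cont t ht s hsJ).eventually (gt_mem_nhds h)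
    have h2 : 𝓝[>] s ≤ 𝓝[J] s := by
      rw [← nhdsWithin_Ioo_eq_nhdsGT hs.2.2]
      exact nhdsWithin_mono s fun r hr => ⟨hs.2.1.trans hr.1.le, hr.2.le⟩
    filter_upwards [h2 h1] with r hr
    exact le_of_lt hr

/-- Continuous induction in the lexicographic order. Left limits carry the bound to `(t, -1/2)`,
`value_le` carries it through the value at `t`, and from `(t, 1/2)` it passes to later times by the
right limit if it is strict and by hypothesis at equality. -/
theorem le_of_step (he : Joins a b e) (hc : c ∈ openInterval a b) (hd : d ∈ openInterval a b)
    (h0 : e c (-1 / 2) ≤ A)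
    (hjump : ∀ t ∈ Icc c d, ∀ s ∈ J, s < 1 / 2 → e t s = A → ∀ᶠ s' in 𝓝[>] s, e t s' ≤ A)
    (hflow : ∀ t ∈ Ico c d, e t (1 / 2) = A → ∀ᶠ t' in 𝓝[>] t, ∀ s ∈ J, e t' s ≤ A) :
    ∀ t ∈ Icc c d, ∀ s ∈ J, e t s ≤ A := by
  intro t₁ ht₁
  have hsub := Icc_subset_openInterval hc hd
  set Q : Set ℝ := {t | ∀ r ∈ Icc c t, ∀ s ∈ J, e r s ≤ A} with hQ
  have hanti : ∀ {r t}, t ∈ Q → r ≤ t → r ∈ Q := fun ht hrt q hq => ht q ⟨hq.1, hq.2.trans hrt⟩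
  have hcQ : c ∈ Q := fun r hr => by
    rw [le_antisymm hr.2 hr.1]
    exact he.value_le hc h0 (hjump c ⟨le_rfl, ht₁.1.trans ht₁.2⟩)
  have hcl : IsClosed (Q ∩ Icc c d) := by
    refine isClosed_of_closure_subset fun t ht => ?_
    have htcd : t ∈ Icc c d := closure_minimal inter_subset_right isClosed_Icc ht
    refine ⟨?_, htcd⟩
    have hlt : ∀ r < t, r ∈ Q := fun r hr => by
      obtain ⟨q, hq, hqQ⟩ := mem_closure_iff.1 ht (Ioi r) isOpen_Ioi hr
      exact hanti hqQ.1 (le_of_lt hq)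
    rcases htcd.1.eq_or_lt with h | h
    · exact h ▸ hcQ
    have hlim : e t (-1 / 2) ≤ A := by
      refine le_of_tendsto ((he.left t (hsub htcd)).tendsto_at zero_mem_J) ?_
      filter_upwards [Ico_mem_nhdsLT h] with r hr
      exact hlt r hr.2 r (right_mem_Icc.2 hr.1) 0 zero_mem_J
    intro r hr
    rcases hr.2.eq_or_lt with h' | h'
    · rw [h']
      exact he.value_le (hsub htcd) hlim (hjump t htcd)
    · exact hlt r h' r (right_mem_Icc.2 hr.1)
  refine hcl.Icc_subset_of_forall_mem_nhdsWithin hcQ (fun t ht => ?_) ht₁ t₁ (right_mem_Icc.2 ht₁.1)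
  have htQ : t ∈ Q := ht.1
  have hle := htQ t (right_mem_Icc.2 ht.2.1) (1 / 2) half_mem_J
  have hev : ∀ᶠ t' in 𝓝[>] t, ∀ s ∈ J, e t' s ≤ A := by
    rcases hle.eq_or_lt with h | h
    · exact hflow t ht.2 h
    · have h1 := (tendsto_prod_principal_iff.2 (he.right t (hsub (Ico_subset_Icc_self ht.2)))).eventually
        (gt_mem_nhds h)
      rw [eventually_prod_principal_iff] at h1
      filter_upwards [h1] with r hr s hs
      exact le_of_lt (hr s hs)
  obtain ⟨u, hu, hIoo⟩ := (mem_nhdsGT_iff_exists_Ioo_subset).1 hev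
  refine mem_of_superset (Ioo_mem_nhdsGT hu) fun t' ht' r hr => ?_
  rcases le_or_gt r t with h | h
  · exact htQ r ⟨hr.1, h⟩
  · exact hIoo ⟨h, hr.2.trans_lt ht'.2⟩

/-- A Gronwall inequality: since `1 + z ≤ exp z`, a step cannot raise `D exp(-Kθ)` above the level
from which it starts. A level `A > 0` forces `D > 0`, so steps are needed only from points with
positive `D`. -/
theorem mul_exp_le_of_step (hD : Joins a b D) (hθ : Joins a b θ) (hc : c ∈ openInterval a b)
    (hd : d ∈ openInterval a b) (hA : 0 < A) (h0 : D c (-1 / 2) * Real.exp (-K * θ c (-1 / 2)) ≤ A)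
    (hjump : ∀ t ∈ Icc c d, ∀ s ∈ J, s < 1 / 2 → 0 < D t s →
      ∀ᶠ s' in 𝓝[>] s, D t s' ≤ D t s * (1 + K * (θ t s' - θ t s)))
    (hflow : ∀ t ∈ Ico c d, 0 < D t (1 / 2) → ∀ᶠ t' in 𝓝[>] t, ∀ s ∈ J,
      D t' s ≤ D t (1 / 2) * (1 + K * (θ t' s - θ t (1 / 2)))) :
    ∀ t ∈ Icc c d, ∀ s ∈ J, D t s * Real.exp (-K * θ t s) ≤ A := by
  have hstep : ∀ t s t' s', D t s * Real.exp (-K * θ t s) = A → 0 < D t s →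
      D t' s' ≤ D t s * (1 + K * (θ t' s' - θ t s)) → D t' s' * Real.exp (-K * θ t' s') ≤ A := by
    intro t s t' s' h1 h2 h3
    have h4 : D t' s' ≤ D t s * Real.exp (K * (θ t' s' - θ t s)) := by
      refine h3.trans (mul_le_mul_of_nonneg_left ?_ h2.le)
      rw [add_comm]
      exact Real.add_one_le_exp _
    calc D t' s' * Real.exp (-K * θ t' s')
        ≤ D t s * Real.exp (K * (θ t' s' - θ t s)) * Real.exp (-K * θ t' s') :=
          mul_le_mul_of_nonneg_right h4 (Real.exp_pos _).le
      _ = D t s * Real.exp (-K * θ t s) := by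
          rw [mul_assoc, ← Real.exp_add]
          congr 2
          ring
      _ = A := h1
  have hpos : ∀ t s, D t s * Real.exp (-K * θ t s) = A → 0 < D t s := fun t s h =>
    pos_of_mul_pos_left (h ▸ hA) (Real.exp_pos _).le
  have he : Joins a b fun t s => D t s * Real.exp (-K * θ t s) :=
    (hD.prodMk hθ).map (Φ := fun p : ℝ × ℝ => p.1 * Real.exp (-K * p.2)) (by fun_prop)
  refine he.le_of_step hc hd h0 (fun t ht s hs hs' h => ?_) fun t ht h => ?_
  · filter_upwards [hjump t ht s hs hs' (hpos t s h)] with r hr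
    exact hstep _ _ _ _ h (hpos t s h) hr
  · filter_upwards [hflow t ht (hpos t _ h)] with r hr s hs
    exact hstep _ _ _ _ h (hpos t _ h) (hr s hs)

end Joins

/-! ## Tangent directions of the constraint set -/

/-- If the joint map to `ι → ℝ` were not surjective, a nonzero functional would vanish on its range,
and its coefficients would be a linear relation between the `φ i`. -/
theorem exists_forall_apply_eq {ι E : Type*} [Finite ι] [NormedAddCommGroup E] [NormedSpace ℝ E]
    {φ : ι → E →L[ℝ] ℝ} (h : LinearIndependent ℝ φ) (r : ι → ℝ) : ∃ e, ∀ i, φ i e = r i := by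
  have := Fintype.ofFinite ι
  classical
  set Φ : E →ₗ[ℝ] ι → ℝ := LinearMap.pi fun i => (φ i : E →ₗ[ℝ] ℝ)
  have hsurj : LinearMap.range Φ = ⊤ := by
    by_contra hne
    obtain ⟨f, hf, hle⟩ := Submodule.exists_le_ker_of_lt_top _ (lt_top_iff_ne_top.2 hne)
    refine hf (LinearMap.pi_ext' fun i => LinearMap.ext_ring ?_)
    have hsum : ∑ i, f (Pi.single i 1) • φ i = 0 := by
      ext v
      have h1 : f (Φ v) = 0 := hle (LinearMap.mem_range_self Φ v)
      rw [LinearMap.pi_apply_eq_sum_univ f] at h1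
      have h2 : ∀ i : ι, (fun j => if i = j then (1 : ℝ) else 0) = Pi.single i 1 := fun i => by
        funext j
        simp [Pi.single_apply, eq_comm]
      simpa [Φ, mul_comm, h2] using h1
    simpa using Fintype.linearIndependent_iff.1 h _ hsum i
  obtain ⟨e, he⟩ := (LinearMap.range_eq_top.1 hsurj) r
  exact ⟨e, fun i => congrFun he i⟩

theorem isClosed_constraintSet {n m : ℕ} {η : Fin m → (Fin n → ℝ) → ℝ}
    (hη : ∀ i, Continuous (η i)) : IsClosed (constraintSet η) := by
  rw [show constraintSet η = ⋂ i, {x | η i x ≤ 0} by ext; simp [constraintSet]]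
  exact isClosed_iInter fun i => isClosed_le (hη i) continuous_const

/-- At a boundary point, linear independence gives `e` on which all active derivatives equal `-1`.
Adding `κ ‖v‖ e` to `v` makes every active linear term at most `-κ ‖v‖`, which absorbs the remainder
of first order; inactive constraints stay negative by continuity. The corrected point lies in the
set, at distance at most `ε ‖v‖`. -/
theorem eventually_infDist_le {n m : ℕ} {η : Fin m → (Fin n → ℝ) → ℝ}
    (hη : ∀ i, ContDiff ℝ 1 (η i)) {y : Fin n → ℝ} (hy : y ∈ constraintSet η)
    (hind : y ∈ frontier (constraintSet η) →
      LinearIndependent ℝ (fun i : {i : Fin m // η i y = 0} => fderiv ℝ (η i) y))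
    {ε : ℝ} (hε : 0 < ε) :
    ∃ δ > 0, ∀ v, ‖v‖ ≤ δ → (y ∈ frontier (constraintSet η) →
      ∀ i, η i y = 0 → fderiv ℝ (η i) y v ≤ 0) →
      Metric.infDist (y + v) (constraintSet η) ≤ ε * ‖v‖ := by
  suffices h : ∀ᶠ v in 𝓝 (0 : Fin n → ℝ), (y ∈ frontier (constraintSet η) →
      ∀ i, η i y = 0 → fderiv ℝ (η i) y v ≤ 0) →
      Metric.infDist (y + v) (constraintSet η) ≤ ε * ‖v‖ by
    obtain ⟨δ, hδ, hball⟩ := Metric.eventually_nhds_iff.1 h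
    refine ⟨δ / 2, half_pos hδ, fun v hv => hball ?_⟩
    rw [dist_zero_right]
    linarith
  by_cases hfr : y ∈ frontier (constraintSet η)
  swap
  · have hint : constraintSet η ∈ 𝓝 (y + 0) := by
      rw [add_zero]
      by_contra h
      exact hfr ⟨subset_closure hy, fun h' => h (mem_interior_iff_mem_nhds.1 h')⟩
    have hcont : Tendsto (fun v : Fin n → ℝ => y + v) (𝓝 0) (𝓝 (y + 0)) :=
      tendsto_const_nhds.add tendsto_id
    filter_upwards [hcont hint] with v hv _
    rw [Metric.infDist_zero_of_mem (show y + v ∈ constraintSet η from hv)]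
    positivity
  obtain ⟨e, he⟩ := exists_forall_apply_eq (hind hfr) fun _ => -1
  -- Small enough that the correction satisfies `κ ‖v‖ ‖e‖ ≤ ε ‖v‖`.
  set κ := ε / (‖e‖ + 1) with hκ
  have hκ0 : 0 < κ := by positivity
  have hz : Tendsto (fun v : Fin n → ℝ => y + (v + (κ * ‖v‖) • e)) (𝓝 0) (𝓝 y) := by
    have : Continuous fun v : Fin n → ℝ => y + (v + (κ * ‖v‖) • e) := by fun_prop
    simpa using this.tendsto 0
  have key : ∀ i, ∀ᶠ v in 𝓝 (0 : Fin n → ℝ), (∀ i, η i y = 0 → fderiv ℝ (η i) y v ≤ 0) →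
      η i (y + (v + (κ * ‖v‖) • e)) ≤ 0 := by
    intro i
    rcases (hy i).lt_or_eq with hlt | heq
    · have := ((hη i).continuous.tendsto y).comp hz
      filter_upwards [this.eventually (gt_mem_nhds hlt)] with v hv _
      exact le_of_lt hv
    -- The corrected increment has norm at most `(1 + κ ‖e‖) ‖v‖`, so this tolerance makes the
    -- remainder at most `κ ‖v‖`.
    · have hρ : 0 < κ / (1 + κ * ‖e‖) := by positivity
      have hd := ((hη i).differentiable one_ne_zero y).hasFDerivAt
      filter_upwards [hz.eventually (hd.isLittleO.def hρ)] with v hv hcone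
      have h1 : fderiv ℝ (η i) y (v + (κ * ‖v‖) • e) ≤ -(κ * ‖v‖) := by
        rw [map_add, map_smul, he ⟨i, heq⟩, smul_eq_mul]
        linarith [hcone i heq]
      rw [heq, add_sub_cancel_left, sub_zero] at hv
      have h2 : ‖v + (κ * ‖v‖) • e‖ ≤ (1 + κ * ‖e‖) * ‖v‖ := by
        refine (norm_add_le _ _).trans ?_
        rw [norm_smul, Real.norm_of_nonneg (by positivity)]
        linarith
      have h3 : κ / (1 + κ * ‖e‖) * ‖v + (κ * ‖v‖) • e‖ ≤ κ * ‖v‖ := by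
        calc _ ≤ κ / (1 + κ * ‖e‖) * ((1 + κ * ‖e‖) * ‖v‖) := by gcongr
          _ = κ * ‖v‖ := by field_simp
      have h4 := (le_abs_self _).trans (hv.trans h3)
      linarith
  filter_upwards [eventually_all.2 key] with v hv hcone
  have hmem : y + (v + (κ * ‖v‖) • e) ∈ constraintSet η := fun i => hv i (hcone hfr)
  refine (Metric.infDist_le_dist_of_mem hmem).trans ?_
  rw [dist_add_left, dist_self_add_right, norm_smul, Real.norm_of_nonneg (by positivity)]
  have : κ * ‖e‖ ≤ ε := by
    rw [hκ, div_mul_eq_mul_div, div_le_iff₀ (by positivity)]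
    nlinarith [norm_nonneg e]
  calc κ * ‖v‖ * ‖e‖ = κ * ‖e‖ * ‖v‖ := by ring
    _ ≤ ε * ‖v‖ := by gcongr

namespace ImpulsiveSystem

variable {n : ℕ} {S : ImpulsiveSystem n} {Ω : Set ℝ} {a b : EReal} {x : ℝ → ℝ → Fin n → ℝ}

/-! ## Viability of solutions -/

namespace StandingAssumptions

variable (hS : S.StandingAssumptions Ω)
include hS

theorem exists_bound_w {c d : ℝ} (hc : c ∈ S.I) (hd : d ∈ S.I) :
    ∃ W, 0 ≤ W ∧ ∀ r ∈ Icc c d, ∑ j, |S.w r j| ≤ W := by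
  have hw : ContinuousOn (fun r => ∑ j, |S.w r j|) (Icc c d) :=
    continuousOn_finsetSum _ fun j _ => ((continuous_apply j).comp_continuousOn
      (hS.w_cont.mono (Icc_subset_openInterval hc hd))).abs
  obtain ⟨W, hW⟩ := isCompact_Icc.exists_bound_of_continuousOn hw
  exact ⟨|W|, abs_nonneg _, fun r hr => (le_abs_self _).trans ((hW r hr).trans (le_abs_self _))⟩

/-- The comparison is pointwise for arbitrary functions, so that a constant path can be inserted for
one of them. -/
theorem exists_lipschitz_rhs {c d : ℝ} (hc : c ∈ S.I) (hd : d ∈ S.I) :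
    ∃ L, 0 ≤ L ∧
      (∀ (x y : ℝ → ℝ → Fin n → ℝ), ∀ r ∈ Icc c d, x r 0 ∈ S.N → y r 0 ∈ S.N →
        ‖S.drift x r - S.drift y r‖ ≤ L * ‖x r 0 - y r 0‖) ∧
      ∀ (x y : ℝ → ℝ → Fin n → ℝ) (k : ℕ), ∀ r ∈ J, x (S.τ k) r ∈ S.N → y (S.τ k) r ∈ S.N →
        ‖S.kick x k r - S.kick y k r‖ ≤ L * ‖x (S.τ k) r - y (S.τ k) r‖ * S.rate k r := by
  obtain ⟨W, hW, hw⟩ := hS.exists_bound_w hc hd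
  obtain ⟨Lf, hLf, hf⟩ := hS.exists_lipschitz_f
  obtain ⟨Lg, hLg, hg⟩ := hS.exists_lipschitz_g
  have hsub : Icc c d ⊆ S.I := Icc_subset_openInterval hc hd
  refine ⟨Lf + Lg * W + Lg, by positivity, fun x y r hr hx hy => ?_, fun x y k r hr hx hy => ?_⟩
  · have h1 := hf r (hsub hr) _ hx _ hy
    have h2 := norm_mulVec_le (A := S.g r (x r 0) 0 - S.g r (y r 0) 0)
      (mul_nonneg hLg (norm_nonneg (x r 0 - y r 0)))
      (fun i j => hg r (hsub hr) 0 zero_mem_J i j _ hx _ hy) (S.w r)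
    rw [drift, drift, add_sub_add_comm, ← Matrix.sub_mulVec]
    have h3 : Lg * ‖x r 0 - y r 0‖ * ∑ j, |S.w r j| ≤ Lg * ‖x r 0 - y r 0‖ * W := by
      gcongr
      exact hw r hr
    have h4 := mul_nonneg hLg (norm_nonneg (x r 0 - y r 0))
    refine (norm_add_le _ _).trans ?_
    nlinarith
  · rw [kick, kick, ← Matrix.sub_mulVec]
    refine (norm_mulVec_le (mul_nonneg hLg (norm_nonneg (x (S.τ k) r - y (S.τ k) r)))
      (fun i j => hg _ (hS.τ_mem k) r hr i j _ hx _ hy) _).trans ?_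
    refine mul_le_mul_of_nonneg_right (mul_le_mul_of_nonneg_right ?_ (norm_nonneg _))
      (S.rate_nonneg k r)
    have := mul_nonneg hLg hW
    linarith

/-- Continuity of `f` in time on `Ω` enters here: a pointwise bound, not just integrability, lets
the drift be compared with the clock, whose density in time is 1. -/
theorem exists_bound_drift_const {c d : ℝ} (hc : c ∈ S.I) (hd : d ∈ S.I) (hΩ : Icc c d ⊆ Ω)
    {y : Fin n → ℝ} (hy : y ∈ S.N) :
    ∃ C, 0 ≤ C ∧ ∀ r ∈ Icc c d, ‖S.drift (fun _ _ => y) r‖ ≤ C := by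
  obtain ⟨W, hW, hw⟩ := hS.exists_bound_w hc hd
  obtain ⟨Cg, hCg, hg⟩ := hS.exists_bound_coefficient (isPath_const hy) hc hd
  obtain ⟨Cf, hf⟩ := isCompact_Icc.exists_bound_of_continuousOn ((hS.f_cont y hy).mono hΩ)
  refine ⟨|Cf| + Cg * W, by positivity, fun r hr => (norm_add_le _ _).trans (add_le_add
    ((hf r hr).trans (le_abs_self _)) ((norm_mulVec_le hCg (hg r hr 0 zero_mem_J) _).trans ?_))⟩
  exact mul_le_mul_of_nonneg_left (hw r hr) hCg

end StandingAssumptions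

/-- The difference between `x t' s'` and `y + v` is `x t s - y` plus the difference of two flows.
The latter is at most `2LD` times the clock increment, because `x` stays within `2D` of `y` on the
step. -/
theorem IsPathSolution.infDist_le (hx : S.IsPathSolution a b x) {c d t s t' s' L D : ℝ}
    (hadm : S.FlowAdm c d (S.drift x) (S.kick x)) {y : Fin n → ℝ}
    (hadmy : S.FlowAdm c d (S.drift fun _ _ => y) (S.kick fun _ _ => y))
    (hc : c ∈ openInterval a b) (hd : d ∈ openInterval a b) (hy : y ∈ S.N)
    (ht : t ∈ Icc c d) (ht' : t' ∈ Icc c d) (hs : s ∈ J) (hs' : s' ∈ J)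
    (hlex : LexLE t s t' s') (hL : 0 ≤ L)
    (hLd : ∀ (x y : ℝ → ℝ → Fin n → ℝ), ∀ r ∈ Icc c d, x r 0 ∈ S.N → y r 0 ∈ S.N →
      ‖S.drift x r - S.drift y r‖ ≤ L * ‖x r 0 - y r 0‖)
    (hLk : ∀ (x y : ℝ → ℝ → Fin n → ℝ) (k : ℕ), ∀ r ∈ J, x (S.τ k) r ∈ S.N → y (S.τ k) r ∈ S.N →
      ‖S.kick x k r - S.kick y k r‖ ≤ L * ‖x (S.τ k) r - y (S.τ k) r‖ * S.rate k r)
    {M : Set (Fin n → ℝ)} (hD : dist (x t s) y ≤ D)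
    (hnear : ∀ r ∈ Ioc t t', ‖x r 0 - y‖ ≤ 2 * D)
    (hnear' : ∀ k, S.τ k ∈ Icc t t' → ∀ r ∈ Icc (pos (S.τ k) t s) (pos (S.τ k) t' s'),
      ‖x (S.τ k) r - y‖ ≤ 2 * D)
    (hv : Metric.infDist (y + S.flow (S.drift fun _ _ => y) (S.kick fun _ _ => y) t s t' s') M ≤
      D * S.flow (fun _ => (1 : ℝ)) S.rate t s t' s') :
    Metric.infDist (x t' s') M ≤
      D * (1 + (2 * L + 1) * S.flow (fun _ => (1 : ℝ)) S.rate t s t' s') := by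
  have hsub := Icc_subset_openInterval hc hd
  set v := S.flow (S.drift fun _ _ => y) (S.kick fun _ _ => y) t s t' s' with hvdef
  have h1 : ‖S.flow (S.drift x) (S.kick x) t s t' s' - v‖ ≤
      L * (2 * D) * S.flow (fun _ => (1 : ℝ)) S.rate t s t' s' := by
    rw [hvdef, hadm.flow_sub hadmy ht ht' hs hs']
    refine FlowAdm.norm_flow_le hadm.clock ht ht' hs hs' hlex (fun r hr => ?_)
      fun k hk r hr => ?_
    · have hr' : r ∈ Icc c d := ⟨ht.1.trans hr.1.le, hr.2.trans ht'.2⟩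
      exact (hLd _ _ r hr' (hx.mem r (hsub hr') 0 zero_mem_J) hy).trans
        (mul_le_mul_of_nonneg_left (hnear r hr) hL)
    · have hk' : S.τ k ∈ Icc c d := ⟨ht.1.trans hk.1, hk.2.trans ht'.2⟩
      have hrJ : r ∈ J := ⟨(pos_mem_J hs).1.trans hr.1, hr.2.trans (pos_mem_J hs').2⟩
      exact (hLk _ _ k r hrJ (hx.mem _ (hsub hk') r hrJ) hy).trans (mul_le_mul_of_nonneg_right
        (mul_le_mul_of_nonneg_left (hnear' k hk r hr) hL) (S.rate_nonneg k r))
  have h2 : dist (x t' s') (y + v) ≤ D + L * (2 * D) *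
      S.flow (fun _ => (1 : ℝ)) S.rate t s t' s' := by
    have h3 : x t' s' - (y + v) = (x t s - y) + (S.flow (S.drift x) (S.kick x) t s t' s' - v) := by
      rw [← hx.increment t (hsub ht) t' (hsub ht') s hs s' hs']
      abel
    rw [dist_eq_norm, h3]
    exact (norm_add_le _ _).trans (add_le_add (by rwa [← dist_eq_norm]) h1)
  calc Metric.infDist (x t' s') M ≤ Metric.infDist (y + v) M + dist (x t' s') (y + v) :=
        Metric.infDist_le_infDist_add_dist
    _ ≤ D * S.flow (fun _ => (1 : ℝ)) S.rate t s t' s' + (D + L * (2 * D) *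
      S.flow (fun _ => (1 : ℝ)) S.rate t s t' s') := add_le_add hv h2
    _ = _ := by ring

/-- In terms of the increments along a frozen point, the velocities of the system at the boundary of
`{η ≤ 0}` are directed inwards. -/
def IsInward {m : ℕ} (S : ImpulsiveSystem n) (Ω : Set ℝ) (η : Fin m → (Fin n → ℝ) → ℝ) : Prop :=
  ∀ y ∈ frontier (constraintSet η), ∀ i, η i y = 0 →
    (∀ᵐ r, r ∈ Ω → fderiv ℝ (η i) y (S.drift (fun _ _ => y) r) ≤ 0) ∧
      ∀ k, ∀ r ∈ J, fderiv ℝ (η i) y (S.kick (fun _ _ => y) k r) ≤ 0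

/-- The entries of `g(·, y)` have ordinary values outside a countable set of times, so the first
inequality holds almost everywhere in `Ω`, which is enough under the integral. -/
theorem StandingAssumptions.isInward {m : ℕ} (hS : S.StandingAssumptions Ω) (hΩ : Ω ⊆ S.I)
    {η : Fin m → (Fin n → ℝ) → ℝ} (hη : ∀ i, Continuous (η i)) (hMN : constraintSet η ⊆ S.N)
    (hflow : ∀ x ∈ frontier (constraintSet η), ∀ i, η i x = 0 → ∀ t ∈ Ω,
      (∀ p q, IsOrdinaryAt (fun r s => S.g r x s p q) t) →
        fderiv ℝ (η i) x (S.f t x + (S.g t x 0).mulVec (S.w t)) ≤ 0)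
    (hjump : ∀ x ∈ frontier (constraintSet η), ∀ i, η i x = 0 → ∀ k : ℕ, ∀ s ∈ J,
      fderiv ℝ (η i) x ((S.g (S.τ k) x s).mulVec (S.c k * S.α k s)) ≤ 0) :
    S.IsInward Ω η := by
  intro y hy i hi
  have hyN : y ∈ S.N := hMN ((isClosed_constraintSet hη).frontier_subset hy)
  refine ⟨?_, fun k r hr => hjump y hy i hi k r hr⟩
  have hall : ∀ᵐ r : ℝ, ∀ p q, r ∈ S.I → IsOrdinaryAt (fun r s => S.g r y s p q) r := by
    refine ae_all_iff.2 fun p => ae_all_iff.2 fun q => ?_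
    have hc := ((hS.joins_coefficient (isPath_const hyN) p q).countable_nonconstant.measure_zero
      volume)
    refine measure_mono_null (fun r hr => ?_) hc
    have hr' : ¬ (r ∈ S.I → IsOrdinaryAt (fun r s => S.g r y s p q) r) := hr
    push Not at hr'
    exact ⟨hr'.1, hr'.2⟩
  filter_upwards [hall] with r hr hrΩ
  exact hflow y hy i hi r hrΩ fun p q => hr p q (hΩ hrΩ)

/-- A continuous linear functional passes under the integrals and the sum, where the inward
condition fixes the sign. -/
theorem IsInward.fderiv_flow_le {m : ℕ} {η : Fin m → (Fin n → ℝ) → ℝ} (hin : S.IsInward Ω η)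
    {c d t s t' s' : ℝ} {y : Fin n → ℝ}
    (hadm : S.FlowAdm c d (S.drift fun _ _ => y) (S.kick fun _ _ => y)) (ht : t ∈ Icc c d)
    (ht' : t' ∈ Icc c d) (hs : s ∈ J) (hs' : s' ∈ J) (hlex : LexLE t s t' s')
    (hΩ : Ioc t t' ⊆ Ω) (hy : y ∈ frontier (constraintSet η)) {i : Fin m} (hi : η i y = 0) :
    fderiv ℝ (η i) y (S.flow (S.drift fun _ _ => y) (S.kick fun _ _ => y) t s t' s') ≤ 0 := by
  have h1 := hadm.map_flow ht ht' hs hs' (-fderiv ℝ (η i) y)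
  have h2 := FlowAdm.flow_nonneg (S := S)
    (D := fun r => (-fderiv ℝ (η i) y) (S.drift (fun _ _ => y) r))
    (K := fun k r => (-fderiv ℝ (η i) y) (S.kick (fun _ _ => y) k r)) hs hs' hlex
    (by
      filter_upwards [(hin y hy i hi).1] with r hr hrt
      simpa using hr (hΩ hrt))
    (fun k _ r hr => by simpa using (hin y hy i hi).2 k r hr)
  rw [← h1] at h2
  simpa using h2

/-- The increments of the distance to `{η ≤ 0}` after the point `(t, s)` at which it is positive. -/
theorem IsPathSolution.infDist_constraintSet_le {m : ℕ} {η : Fin m → (Fin n → ℝ) → ℝ}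
    (hin : S.IsInward Ω η)
    (hx : S.IsPathSolution a b x) {c d t s t' s' L D C δ : ℝ}
    (hadm : S.FlowAdm c d (S.drift x) (S.kick x)) {y : Fin n → ℝ}
    (hadmy : S.FlowAdm c d (S.drift fun _ _ => y) (S.kick fun _ _ => y))
    (hc : c ∈ openInterval a b) (hd : d ∈ openInterval a b) (hy : y ∈ S.N)
    (ht : t ∈ Icc c d) (ht' : t' ∈ Icc c d) (hs : s ∈ J) (hs' : s' ∈ J)
    (hlex : LexLE t s t' s') (hL : 0 ≤ L)
    (hLd : ∀ (x y : ℝ → ℝ → Fin n → ℝ), ∀ r ∈ Icc c d, x r 0 ∈ S.N → y r 0 ∈ S.N →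
      ‖S.drift x r - S.drift y r‖ ≤ L * ‖x r 0 - y r 0‖)
    (hLk : ∀ (x y : ℝ → ℝ → Fin n → ℝ) (k : ℕ), ∀ r ∈ J, x (S.τ k) r ∈ S.N → y (S.τ k) r ∈ S.N →
      ‖S.kick x k r - S.kick y k r‖ ≤ L * ‖x (S.τ k) r - y (S.τ k) r‖ * S.rate k r)
    (hΩ : Ioc t t' ⊆ Ω) (hD0 : 0 < D) (hD : dist (x t s) y ≤ D)
    (hnear : ∀ r ∈ Ioc t t', ∀ σ ∈ J, ‖x r σ - x t s‖ ≤ D)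
    (hnear' : ∀ r ∈ Icc s (pos t t' s'), ‖x t r - x t s‖ ≤ D)
    (hC : 0 ≤ C) (hbd : ∀ r ∈ Ioc t t', ‖S.drift (fun _ _ => y) r‖ ≤ C)
    (hbk : ∀ k, S.τ k ∈ Icc c d → ∀ r ∈ J, ‖S.kick (fun _ _ => y) k r‖ ≤ C * S.rate k r)
    (htan : ∀ v, ‖v‖ ≤ δ → (y ∈ frontier (constraintSet η) →
      ∀ i, η i y = 0 → fderiv ℝ (η i) y v ≤ 0) →
      Metric.infDist (y + v) (constraintSet η) ≤ D / (C + 1) * ‖v‖)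
    (hδ : C * S.flow (fun _ => (1 : ℝ)) S.rate t s t' s' ≤ δ) :
    Metric.infDist (x t' s') (constraintSet η) ≤
      D * (1 + (2 * L + 1) * S.flow (fun _ => (1 : ℝ)) S.rate t s t' s') := by
  have htri : ∀ z, ‖z - x t s‖ ≤ D → ‖z - y‖ ≤ 2 * D := fun z hz => by
    rw [← dist_eq_norm] at hz ⊢
    linarith [dist_triangle z (x t s) y]
  have hvn : ‖S.flow (S.drift fun _ _ => y) (S.kick fun _ _ => y) t s t' s'‖ ≤
      C * S.flow (fun _ => (1 : ℝ)) S.rate t s t' s' :=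
    FlowAdm.norm_flow_le hadm.clock ht ht' hs hs' hlex hbd fun k hk r hr =>
      hbk k ⟨ht.1.trans hk.1, hk.2.trans ht'.2⟩ r
        ⟨(pos_mem_J hs).1.trans hr.1, hr.2.trans (pos_mem_J hs').2⟩
  have hΔ : 0 ≤ S.flow (fun _ => (1 : ℝ)) S.rate t s t' s' :=
    FlowAdm.flow_nonneg hs hs' hlex (Eventually.of_forall fun _ _ => zero_le_one)
      fun k _ r _ => S.rate_nonneg k r
  refine hx.infDist_le hadm hadmy hc hd hy ht ht' hs hs' hlex hL hLd hLk hD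
    (fun r hr => htri _ (hnear r hr 0 zero_mem_J)) (fun k hk r hr => htri _ ?_) ?_
  · rcases hk.1.eq_or_lt with h | h
    · rw [← h] at hr ⊢
      rw [pos_self] at hr
      exact hnear' r hr
    · exact hnear _ ⟨h, hk.2⟩ r ⟨(pos_mem_J hs).1.trans hr.1, hr.2.trans (pos_mem_J hs').2⟩
  -- Since `‖v‖` is at most `C` times the clock increment, the tolerance `D / (C + 1)` leaves an
  -- error of at most `D` times that increment.
  · refine (htan _ (hvn.trans hδ) fun hfr i hi =>
      hin.fderiv_flow_le hadmy ht ht' hs hs' hlex hΩ hfr hi).trans ?_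
    calc D / (C + 1) * ‖S.flow (S.drift fun _ _ => y) (S.kick fun _ _ => y) t s t' s'‖
        ≤ D / (C + 1) * ((C + 1) * S.flow (fun _ => (1 : ℝ)) S.rate t s t' s') := by
          gcongr
          linarith
      _ = _ := by field_simp

theorem eventually_jump_near {E : Type*} [NormedAddCommGroup E] {x : ℝ → E} (hx : ContinuousOn x J)
    {s : ℝ} (hs : s ∈ J) (hs' : s < 1 / 2) {ε : ℝ} (hε : 0 < ε) :
    ∀ᶠ s' in 𝓝[>] s, s' ∈ J ∧ ∀ r ∈ Icc s s', ‖x r - x s‖ ≤ ε := by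
  have h2 : 𝓝[>] s ≤ 𝓝[J] s := by
    rw [← nhdsWithin_Ioo_eq_nhdsGT hs']
    exact nhdsWithin_mono s fun r hr => ⟨hs.1.trans hr.1.le, hr.2.le⟩
  have h1 : ∀ᶠ r in 𝓝[>] s, ‖x r - x s‖ ≤ ε := by
    filter_upwards [h2 (Metric.tendsto_nhds.1 (hx s hs) ε hε)] with r hr
    have hr' : dist (x r) (x s) < ε := hr
    rw [dist_eq_norm] at hr'
    exact hr'.le
  obtain ⟨u, hu, hIoo⟩ := mem_nhdsGT_iff_exists_Ioo_subset.1 h1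
  filter_upwards [h2 self_mem_nhdsWithin, Ioo_mem_nhdsGT hu] with s' hs'J hs'u
  refine ⟨hs'J, fun r hr => ?_⟩
  rcases hr.1.eq_or_lt with h | h
  · rw [← h, sub_self, norm_zero]
    exact hε.le
  · exact hIoo ⟨h, hr.2.trans_lt hs'u.2⟩

theorem eventually_flow_near {E : Type*} [NormedAddCommGroup E] {x : ℝ → ℝ → E}
    (hx : Joins a b x) {t : ℝ} (ht : t ∈ openInterval a b) {ε : ℝ} (hε : 0 < ε) :
    ∀ᶠ t' in 𝓝[>] t, ∀ r ∈ Ioc t t', ∀ s ∈ J, ‖x r s - x t (1 / 2)‖ ≤ ε := by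
  have h1 : ∀ᶠ r in 𝓝[>] t, ∀ s ∈ J, ‖x r s - x t (1 / 2)‖ ≤ ε := by
    filter_upwards [Metric.tendstoUniformlyOn_iff.1 (hx.right t ht) ε hε] with r hr s hs
    rw [← dist_eq_norm, dist_comm]
    exact (hr s hs).le
  obtain ⟨u, hu, hIoo⟩ := mem_nhdsGT_iff_exists_Ioo_subset.1 h1
  filter_upwards [Ioo_mem_nhdsGT hu] with t' ht' r hr
  exact hIoo ⟨hr.1, hr.2.trans_lt ht'.2⟩

theorem IsPathSolution.mem_constraintSet {m : ℕ} {η : Fin m → (Fin n → ℝ) → ℝ} {t₀ : ℝ} {T : EReal}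
    (hS : S.StandingAssumptions (openInterval t₀ T)) (hin : S.IsInward (openInterval t₀ T) η)
    (hη : ∀ i, ContDiff ℝ 1 (η i)) (hMN : constraintSet η ⊆ S.N)
    (hind : ∀ x ∈ frontier (constraintSet η),
      LinearIndependent ℝ (fun i : {i : Fin m // η i x = 0} => fderiv ℝ (η i) x))
    (hx : S.IsPathSolution a b x) (ht₀ : t₀ ∈ openInterval a b)
    (h₀ : x t₀ (-1 / 2) ∈ constraintSet η) {d : ℝ} (hd : d ∈ openInterval a b)
    (hdT : (d : EReal) < T) : ∀ t ∈ Icc t₀ d, ∀ s ∈ J, x t s ∈ constraintSet η := by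
  set M := constraintSet η with hM
  have hMc : IsClosed M := isClosed_constraintSet fun i => (hη i).continuous
  have hMne : M.Nonempty := ⟨_, h₀⟩
  rcases lt_or_ge d t₀ with hdt | hdt
  · intro t ht
    exact absurd (ht.1.trans ht.2) (not_le.2 hdt)
  -- Margins on both sides make `t₀` and `d` interior points, at which `θ` joins its one-sided
  -- limits.
  obtain ⟨c, hc, hct⟩ := exists_lt_mem_openInterval ht₀
  obtain ⟨e, he, hde⟩ := exists_gt_mem_openInterval hd
  obtain ⟨L, hL, hLd, hLk⟩ := hS.exists_lipschitz_rhs (hx.subset_I hc) (hx.subset_I he)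
  have hadm := hS.flowAdm hx.toIsPath hc he
  have hadmy : ∀ y ∈ M, S.FlowAdm c e (S.drift fun _ _ => y) (S.kick fun _ _ => y) := fun y hy =>
    hS.flowAdm (isPath_const (hMN hy)) (hx.subset_I hc) (hx.subset_I he)
  set θ : ℝ → ℝ → ℝ := fun t s => S.flow (fun _ => (1 : ℝ)) S.rate t₀ (-1 / 2) t s with hθ
  have ht₀ce : t₀ ∈ Icc c e := ⟨hct.le, hdt.trans hde.le⟩
  have hIcc : Icc t₀ d ⊆ Icc c e := Icc_subset_Icc hct.le hde.le
  have hJθ : Joins c e θ := hadm.clock.joins_flow ht₀ce neg_half_mem_J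
  have hce : ∀ t ∈ Icc t₀ d, t ∈ openInterval (c : EReal) e := fun t ht =>
    ⟨EReal.coe_lt_coe_iff.2 (hct.trans_le ht.1), EReal.coe_lt_coe_iff.2 (ht.2.trans_lt hde)⟩
  have hJx : Joins c e x := hx.joins.mono hc.1.le he.2.le
  have hJD : Joins c e fun t s => Metric.infDist (x t s) M :=
    hJx.map (Metric.continuous_infDist_pt M)
  have hθsub : ∀ t ∈ Icc c e, ∀ t' ∈ Icc c e, ∀ s ∈ J, ∀ s' ∈ J,
      θ t' s' - θ t s = S.flow (fun _ => (1 : ℝ)) S.rate t s t' s' :=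
      fun t ht t' ht' s hs s' hs' => by
    rw [hθ]
    simp only
    rw [← hadm.clock.flow_add ht₀ce ht ht' neg_half_mem_J hs hs', add_sub_cancel_left]
  have hjump : ∀ t ∈ Icc t₀ d, ∀ s ∈ J, s < 1 / 2 → 0 < Metric.infDist (x t s) M →
      ∀ᶠ s' in 𝓝[>] s, Metric.infDist (x t s') M ≤
        Metric.infDist (x t s) M * (1 + (2 * L + 1) * (θ t s' - θ t s)) := by
    intro t ht s hs hs2 hpos
    obtain ⟨y, hyM, hy⟩ := hMc.exists_infDist_eq_dist hMne (x t s)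
    obtain ⟨C, hC, hbk⟩ := (hadmy y hyM).bound
    obtain ⟨δ, hδ, htan⟩ := eventually_infDist_le hη hyM (hind y)
      (div_pos hpos (by linarith : 0 < C + 1))
    -- A clock increment of at most `δ / (C + 1)` keeps the frozen increment inside the ball of
    -- radius `δ` where the tangency estimate holds.
    filter_upwards [eventually_jump_near (hJx.cont t (hce t ht)) hs hs2 hpos,
      eventually_jump_near (hJθ.cont t (hce t ht)) hs hs2 (div_pos hδ (by linarith : 0 < C + 1)),
      self_mem_nhdsWithin] with s' h1 h2 h3
    have hss : s ≤ s' := le_of_lt h3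
    have hflow := hθsub t (hIcc ht) t (hIcc ht) s hs s' h1.1
    rw [hflow]
    refine hx.infDist_constraintSet_le hin hadm (hadmy y hyM) hc he (hMN hyM) (hIcc ht) (hIcc ht)
      hs h1.1 (Or.inr ⟨rfl, hss⟩) hL hLd hLk (by simp) hpos hy.ge (by simp) ?_ hC (by simp) hbk htan ?_
    · rw [pos_self]
      exact h1.2
    · rw [← hflow]
      have h4 := (le_abs_self _).trans (h2.2 s' ⟨hss, le_rfl⟩)
      rw [le_div_iff₀ (by linarith)] at h4
      have h5 : 0 ≤ θ t s' - θ t s := hflow ▸ FlowAdm.flow_nonneg hs h1.1 (Or.inr ⟨rfl, hss⟩)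
        (Eventually.of_forall fun _ _ => zero_le_one) fun k _ r _ => S.rate_nonneg k r
      linarith
  -- The time `t₀` is excluded because the frozen drift is bounded only on compact subintervals of
  -- `Ω`.
  have hflow : ∀ t ∈ Ioo t₀ d, 0 < Metric.infDist (x t (1 / 2)) M →
      ∀ᶠ t' in 𝓝[>] t, ∀ s ∈ J, Metric.infDist (x t' s) M ≤
        Metric.infDist (x t (1 / 2)) M * (1 + (2 * L + 1) * (θ t' s - θ t (1 / 2))) := by
    intro t ht hpos
    have htc := Ioo_subset_Icc_self ht
    obtain ⟨y, hyM, hy⟩ := hMc.exists_infDist_eq_dist hMne (x t (1 / 2))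
    have hΩ : Icc t d ⊆ openInterval t₀ T := fun r hr =>
      ⟨EReal.coe_lt_coe_iff.2 (ht.1.trans_le hr.1), (EReal.coe_le_coe_iff.2 hr.2).trans_lt hdT⟩
    obtain ⟨C₁, hC₁, hbk⟩ := (hadmy y hyM).bound
    obtain ⟨C₂, hC₂, hbd⟩ := hS.exists_bound_drift_const
      (hx.subset_I (Icc_subset_openInterval hc he (hIcc htc))) (hx.subset_I hd) hΩ (hMN hyM)
    have hC : 0 ≤ max C₁ C₂ := hC₁.trans (le_max_left _ _)
    obtain ⟨δ, hδ, htan⟩ := eventually_infDist_le hη hyM (hind y)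
      (div_pos hpos (by linarith : 0 < max C₁ C₂ + 1))
    filter_upwards [eventually_flow_near hJx (hce t htc) hpos,
      eventually_flow_near hJθ (hce t htc) (div_pos hδ (by linarith : 0 < max C₁ C₂ + 1)),
      Ioo_mem_nhdsGT ht.2] with t' h1 h2 h3 s hs
    have ht' : t' ∈ Icc t₀ d := ⟨htc.1.trans h3.1.le, h3.2.le⟩
    have hflow := hθsub t (hIcc htc) t' (hIcc ht') (1 / 2) half_mem_J s hs
    rw [hflow]
    refine hx.infDist_constraintSet_le hin hadm (hadmy y hyM) hc he (hMN hyM) (hIcc htc) (hIcc ht')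
      half_mem_J hs (Or.inl h3.1) hL hLd hLk
      (fun r hr => hΩ ⟨hr.1.le, hr.2.trans h3.2.le⟩) hpos hy.ge h1 (fun r hr => ?_) hC
      (fun r hr => (hbd r ⟨hr.1.le, hr.2.trans h3.2.le⟩).trans (le_max_right _ _))
      (fun k hk r hr => (hbk k hk r hr).trans
        (mul_le_mul_of_nonneg_right (le_max_left _ _) (S.rate_nonneg k r))) htan ?_
    · rw [pos_of_lt h3.1] at hr
      rw [le_antisymm hr.2 hr.1, sub_self, norm_zero]
      exact hpos.le
    · rw [← hflow]
      have h4 := (le_abs_self _).trans (h2 t' ⟨h3.1, le_rfl⟩ s hs)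
      rw [le_div_iff₀ (by linarith)] at h4
      have h5 : 0 ≤ θ t' s - θ t (1 / 2) := hflow ▸ FlowAdm.flow_nonneg half_mem_J hs (Or.inl h3.1)
        (Eventually.of_forall fun _ _ => zero_le_one) fun k _ r _ => S.rate_nonneg k r
      linarith
  have hzero : ∀ t s, (∀ A > 0, Metric.infDist (x t s) M * Real.exp (-(2 * L + 1) * θ t s) ≤ A) →
      Metric.infDist (x t s) M = 0 := fun t s h => by
    have h1 : Metric.infDist (x t s) M * Real.exp (-(2 * L + 1) * θ t s) ≤ 0 :=
      le_of_forall_pos_le_add fun A hA => by rw [zero_add]; exact h A hA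
    exact le_antisymm (nonpos_of_mul_nonpos_left h1 (Real.exp_pos _)) Metric.infDist_nonneg
  have hstart : Metric.infDist (x t₀ (-1 / 2)) M * Real.exp (-(2 * L + 1) * θ t₀ (-1 / 2)) = 0 := by
    rw [Metric.infDist_zero_of_mem h₀, zero_mul]
  -- Within the single time `t₀` only the impulse acts. Once the distance is zero at `(t₀, 1/2)`, no
  -- estimate of the drift is needed there: the bound at `t₀` is strict and persists by the right
  -- limit.
  have hinit : ∀ s ∈ J, Metric.infDist (x t₀ s) M = 0 := fun s hs => hzero t₀ s fun A hA =>
    hJD.mul_exp_le_of_step hJθ (hce t₀ ⟨le_rfl, hdt⟩) (hce t₀ ⟨le_rfl, hdt⟩) hA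
      (hstart.trans_le hA.le) (fun t ht => hjump t ⟨ht.1, ht.2.trans hdt⟩)
      (fun t ht => absurd (ht.1.trans_lt ht.2) (lt_irrefl _)) t₀ ⟨le_rfl, le_rfl⟩ s hs
  intro t ht s hs
  refine (hMc.mem_iff_infDist_zero hMne).2 (hzero t s fun A hA => ?_)
  refine hJD.mul_exp_le_of_step hJθ (hce t₀ ⟨le_rfl, hdt⟩) (hce d ⟨hdt, le_rfl⟩) hA
    (hstart.trans_le hA.le) hjump (fun t ht hpos => ?_) t ht s hs
  rcases ht.1.eq_or_lt with h | h
  · rw [← h, hinit _ half_mem_J] at hpos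
    exact absurd hpos (lt_irrefl _)
  · exact hflow t ⟨h, ht.2⟩ hpos

end ImpulsiveSystem

namespace ImpulsiveSystem

variable {n : ℕ} {S : ImpulsiveSystem n} {Ω : Set ℝ} {a b : EReal} {x y : ℝ → ℝ → Fin n → ℝ}

/-! ## Continuation of solutions -/

theorem flow_congr {c d t t' s s' : ℝ} (ht : t ∈ Icc c d) (ht' : t' ∈ Icc c d)
    (h : ∀ r ∈ Icc c d, x r = y r) :
    S.flow (S.drift x) (S.kick x) t s t' s' = S.flow (S.drift y) (S.kick y) t s t' s' := by
  rw [flow, flow]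
  congr 1
  · refine intervalIntegral.integral_congr fun r hr => ?_
    simp only [drift, h r (uIcc_subset_Icc ht ht' hr)]
  · refine tsum_congr fun k => ?_
    by_cases hk : S.τ k ∈ Icc c d
    · simp only [kick, h _ hk]
    · simp only [pos_eq_pos ht ht' hk (s := s) (s' := s'), intervalIntegral.integral_same]

/-- Linear growth: drift and kick are at most `C (1 + ‖x - y‖)` relative to the clock, with `y` the
value at `(t₁, -1/2)`. The Gronwall scheme bounds `1 + ‖x - y‖` by an exponential of the clock,
which is finite up to `β`. -/
theorem IsPathSolution.exists_bound (hS : S.StandingAssumptions Ω) {β t₁ : ℝ}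
    (hx : S.IsPathSolution a β x) (hβ : β ∈ S.I) (ht₁ : t₁ ∈ openInterval a β)
    (hΩ : Icc t₁ β ⊆ Ω) : ∃ R, 0 ≤ R ∧
      (∀ t ∈ Ico t₁ β, ∀ s ∈ J, ‖S.drift x t‖ ≤ R) ∧
      ∀ k, S.τ k ∈ Ico t₁ β → ∀ s ∈ J, ‖S.kick x k s‖ ≤ R * S.rate k s := by
  obtain ⟨c, hc, hct⟩ := exists_lt_mem_openInterval ht₁
  have ht₁β : t₁ < β := EReal.coe_lt_coe_iff.1 ht₁.2
  have hcI := hx.subset_I hc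
  set y := x t₁ (-1 / 2) with hydef
  have hyN : y ∈ S.N := hx.mem t₁ ht₁ _ neg_half_mem_J
  obtain ⟨L, hL, hLd, hLk⟩ := hS.exists_lipschitz_rhs hcI hβ
  have hadm := hS.flowAdm (isPath_const hyN) hcI hβ
  obtain ⟨C₁, hC₁, hbk⟩ := hadm.bound
  obtain ⟨C₂, hC₂, hbd⟩ := hS.exists_bound_drift_const (hx.subset_I ht₁) hβ hΩ hyN
  set C := C₁ + C₂ + L with hC
  have hsub : Icc t₁ β ⊆ Icc c β := Icc_subset_Icc hct.le le_rfl
  have hmem : ∀ t ∈ Ico t₁ β, t ∈ openInterval a β := fun t ht =>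
    ⟨ht₁.1.trans_le (EReal.coe_le_coe_iff.2 ht.1), EReal.coe_lt_coe_iff.2 ht.2⟩
  -- The summand 1 absorbs the velocity at the frozen point `y` and keeps `D ≥ 1`, so a deviation of
  -- at most 1 during a step at most doubles `D`.
  set D : ℝ → ℝ → ℝ := fun t s => 1 + ‖x t s - y‖ with hD
  have hD1 : ∀ t s, 1 ≤ D t s := fun t s => le_add_of_nonneg_right (norm_nonneg _)
  have hdrift : ∀ t ∈ Ico t₁ β, ‖S.drift x t‖ ≤ C * D t 0 := by
    intro t ht
    have h1 := hLd x (fun _ _ => y) t (hsub ⟨ht.1, ht.2.le⟩) (hx.mem t (hmem t ht) 0 zero_mem_J) hyN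
    have h2 := hbd t ⟨ht.1, ht.2.le⟩
    have h3 := norm_le_norm_add_norm_sub' (S.drift x t) (S.drift (fun _ _ => y) t)
    have h4 := mul_nonneg (add_nonneg hC₁ hC₂) (norm_nonneg (x t 0 - y))
    simp only [hC, hD]
    nlinarith
  have hkick : ∀ k, S.τ k ∈ Ico t₁ β → ∀ s ∈ J, ‖S.kick x k s‖ ≤ C * D (S.τ k) s * S.rate k s := by
    intro k hk s hs
    have h1 := hLk x (fun _ _ => y) k s hs (hx.mem _ (hmem _ hk) s hs) hyN
    have h2 := hbk k (hsub ⟨hk.1, hk.2.le⟩) s hs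
    have h3 := norm_le_norm_add_norm_sub' (S.kick x k s) (S.kick (fun _ _ => y) k s)
    have h4 := mul_nonneg (add_nonneg hC₁ hC₂) (norm_nonneg (x (S.τ k) s - y))
    calc _ ≤ C₁ * S.rate k s + L * ‖x (S.τ k) s - y‖ * S.rate k s := h3.trans (add_le_add h2 h1)
      _ = (C₁ + L * ‖x (S.τ k) s - y‖) * S.rate k s := by ring
      _ ≤ _ := by
        refine mul_le_mul_of_nonneg_right ?_ (S.rate_nonneg k s)
        simp only [hC, hD]
        nlinarith
  set θ : ℝ → ℝ → ℝ := fun t s => S.flow (fun _ => (1 : ℝ)) S.rate t₁ (-1 / 2) t s with hθ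
  have ht₁c : t₁ ∈ Icc c β := ⟨hct.le, ht₁β.le⟩
  have hJθ : Joins c β θ := hadm.clock.joins_flow ht₁c neg_half_mem_J
  have hcβ : ∀ t ∈ Ico t₁ β, t ∈ openInterval (c : EReal) β := fun t ht =>
    ⟨EReal.coe_lt_coe_iff.2 (hct.trans_le ht.1), EReal.coe_lt_coe_iff.2 ht.2⟩
  have hJx : Joins c β x := hx.joins.mono hc.1.le le_rfl
  have hJD : Joins c β D := hJx.map (Φ := fun z => 1 + ‖z - y‖) (by fun_prop)
  have hθsub : ∀ t ∈ Icc c β, ∀ t' ∈ Icc c β, ∀ s ∈ J, ∀ s' ∈ J,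
      θ t' s' - θ t s = S.flow (fun _ => (1 : ℝ)) S.rate t s t' s' :=
      fun t ht t' ht' s hs s' hs' => by
    rw [hθ]
    simp only
    rw [← hadm.clock.flow_add ht₁c ht ht' neg_half_mem_J hs hs', add_sub_cancel_left]
  have hstep : ∀ t ∈ Ico t₁ β, ∀ t' ∈ Ico t₁ β, ∀ s ∈ J, ∀ s' ∈ J, LexLE t s t' s' →
      (∀ r ∈ Ioc t t', ∀ σ ∈ J, ‖x r σ - x t s‖ ≤ 1) →
      (∀ r ∈ Icc s (pos t t' s'), ‖x t r - x t s‖ ≤ 1) →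
      D t' s' ≤ D t s * (1 + 2 * C * (θ t' s' - θ t s)) := by
    intro t ht t' ht' s hs s' hs' hlex hn hn'
    have htri : ∀ r σ, ‖x r σ - x t s‖ ≤ 1 → D r σ ≤ 2 * D t s := fun r σ h => by
      have h1 := norm_sub_le_norm_sub_add_norm_sub (x r σ) (x t s) y
      have h2 := hD1 t s
      simp only [hD] at h2 ⊢
      linarith
    have hC0 : 0 ≤ C := by positivity
    have h1 : ‖S.flow (S.drift x) (S.kick x) t s t' s'‖ ≤ C * (2 * D t s) * (θ t' s' - θ t s) := by
      have hmt := hsub ⟨ht.1, ht.2.le⟩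
      have hmt' := hsub ⟨ht'.1, ht'.2.le⟩
      rw [hθsub t hmt t' hmt' s hs s' hs']
      refine FlowAdm.norm_flow_le hadm.clock hmt hmt' hs hs' hlex (fun r hr => ?_)
        fun k hk r hr => ?_
      · exact (hdrift r ⟨ht.1.trans hr.1.le, hr.2.trans_lt ht'.2⟩).trans
          (mul_le_mul_of_nonneg_left (htri r 0 (hn r hr 0 zero_mem_J)) hC0)
      · have hrJ : r ∈ J := ⟨(pos_mem_J hs).1.trans hr.1, hr.2.trans (pos_mem_J hs').2⟩
        refine (hkick k ⟨ht.1.trans hk.1, hk.2.trans_lt ht'.2⟩ r hrJ).trans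
          (mul_le_mul_of_nonneg_right (mul_le_mul_of_nonneg_left (htri _ _ ?_) hC0)
            (S.rate_nonneg k r))
        rcases hk.1.eq_or_lt with h | h
        · rw [← h] at hr ⊢
          rw [pos_self] at hr
          exact hn' r hr
        · exact hn _ ⟨h, hk.2⟩ r hrJ
    rw [← hx.increment t (hmem t ht) t' (hmem t' ht') s hs s' hs'] at h1
    have h2 := norm_sub_le_norm_sub_add_norm_sub (x t' s') (x t s) y
    have h3 : D t' s' ≤ D t s + C * (2 * D t s) * (θ t' s' - θ t s) := by
      simp only [hD] at h1 ⊢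
      linarith
    exact h3.trans_eq (by ring)
  have hgrowth : ∀ t ∈ Ico t₁ β, ∀ s ∈ J, D t s * Real.exp (-(2 * C) * θ t s) ≤ 1 := by
    intro t ht s hs
    refine hJD.mul_exp_le_of_step hJθ (hcβ t₁ ⟨le_rfl, ht₁β⟩) (hcβ t ht) one_pos ?_
      (fun r hr σ hσ hσ' _ => ?_) (fun r hr _ => ?_) t ⟨ht.1, le_rfl⟩ s hs
    · have : θ t₁ (-1 / 2) = 0 := FlowAdm.flow_self
      simp [this, hD, hydef]
    · have hr' : r ∈ Ico t₁ β := ⟨hr.1, hr.2.trans_lt ht.2⟩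
      filter_upwards [eventually_jump_near (hJx.cont r (hcβ r hr')) hσ hσ' one_pos,
        self_mem_nhdsWithin] with σ' h1 h2
      refine hstep r hr' r hr' σ hσ σ' h1.1 (Or.inr ⟨rfl, le_of_lt h2⟩) (by simp) ?_
      rw [pos_self]
      exact h1.2
    · have hr' : r ∈ Ico t₁ β := ⟨hr.1, hr.2.trans ht.2⟩
      filter_upwards [eventually_flow_near hJx (hcβ r hr') one_pos, Ioo_mem_nhdsGT hr'.2]
        with r' h1 h2 σ hσ
      refine hstep r hr' r' ⟨hr.1.trans h2.1.le, h2.2⟩ (1 / 2) half_mem_J σ hσ (Or.inl h2.1) h1 ?_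
      intro q hq
      rw [pos_of_lt h2.1] at hq
      rw [le_antisymm hq.2 hq.1, sub_self, norm_zero]
      exact zero_le_one
  have hC0 : 0 ≤ C := by positivity
  have hbound : ∀ t ∈ Ico t₁ β, ∀ s ∈ J, D t s ≤ Real.exp (2 * C * θ β (1 / 2)) := by
    intro t ht s hs
    have h1 := hgrowth t ht s hs
    have h2 : θ t s ≤ θ β (1 / 2) := by
      rw [← sub_nonneg, hθsub t (hsub ⟨ht.1, ht.2.le⟩) β (hsub ⟨ht₁β.le, le_rfl⟩) s hs _ half_mem_J]
      exact FlowAdm.flow_nonneg hs half_mem_J (Or.inl ht.2)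
        (Eventually.of_forall fun _ _ => zero_le_one) fun k _ r _ => S.rate_nonneg k r
    rw [neg_mul, Real.exp_neg, mul_inv_le_iff₀ (Real.exp_pos _), one_mul] at h1
    exact h1.trans (Real.exp_le_exp.2 (mul_le_mul_of_nonneg_left h2 (by positivity)))
  refine ⟨C * Real.exp (2 * C * θ β (1 / 2)), by positivity, fun t ht s hs =>
    (hdrift t ht).trans (mul_le_mul_of_nonneg_left (hbound t ht 0 zero_mem_J) hC0),
    fun k hk s hs => (hkick k hk s hs).trans (mul_le_mul_of_nonneg_right
      (mul_le_mul_of_nonneg_left (hbound _ hk s hs) hC0) (S.rate_nonneg k s))⟩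

theorem IsPath.aestronglyMeasurable_drift (hS : S.StandingAssumptions Ω) (hx : S.IsPath a b x) :
    AEStronglyMeasurable (S.drift x) (volume.restrict (openInterval a b)) := by
  have : LocallyIntegrableOn (S.drift x) (openInterval a b) volume := fun t ht => by
    obtain ⟨c, hc, hct⟩ := exists_lt_mem_openInterval ht
    obtain ⟨d, hd, htd⟩ := exists_gt_mem_openInterval ht
    exact ⟨Icc c d, mem_nhdsWithin_of_mem_nhds (Icc_mem_nhds hct htd),
      hS.integrableOn_drift hx hc hd⟩
  exact this.aestronglyMeasurable

/-- The bounds on drift and kicks make the flow admissible up to and including `β`, so its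
increments from `t` to `(β, -1/2)` tend to 0 uniformly in `s`. -/
theorem IsPathSolution.exists_limit (hS : S.StandingAssumptions Ω) {β t₁ : ℝ}
    (hx : S.IsPathSolution a β x) (hβ : β ∈ S.I) (ht₁ : t₁ ∈ openInterval a β)
    (hΩ : Icc t₁ β ⊆ Ω) : ∃ ξ, TendstoUniformlyOn x (fun _ => ξ) (𝓝[<] β) J := by
  have ht₁β : t₁ < β := EReal.coe_lt_coe_iff.1 ht₁.2
  obtain ⟨R, hR, hRd, hRk⟩ := hx.exists_bound hS hβ ht₁ hΩ
  have hyN : x t₁ (-1 / 2) ∈ S.N := hx.mem t₁ ht₁ _ neg_half_mem_J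
  set y : ℝ → ℝ → Fin n → ℝ := fun _ _ => x t₁ (-1 / 2) with hydef
  have hadmy := hS.flowAdm (isPath_const hyN) (hx.subset_I ht₁) hβ
  obtain ⟨C, hC, hCk⟩ := hadmy.bound
  -- The value at `β` is filled in by a constant point of `N`, only to give the kick at `β` a
  -- meaning; the impulse at `β` does not act before `(β, -1/2)`.
  set z : ℝ → ℝ → Fin n → ℝ := fun t => if t < β then x t else y t with hz
  have hzx : ∀ t < β, z t = x t := fun t ht => if_pos ht
  have hzy : z β = y β := if_neg (lt_irrefl β)
  have hmem : ∀ t ∈ Ico t₁ β, t ∈ openInterval a β := fun t ht =>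
    ⟨ht₁.1.trans_le (EReal.coe_le_coe_iff.2 ht.1), EReal.coe_lt_coe_iff.2 ht.2⟩
  have hkx : ∀ k, S.τ k < β → S.kick z k = S.kick x k := fun k hk => by
    funext s
    simp only [kick, hzx _ hk]
  have hky : ∀ k, S.τ k = β → S.kick z k = S.kick y k := fun k hk => by
    funext s
    simp only [kick, hk, hzy]
  have hadm : S.FlowAdm t₁ β (S.drift z) (S.kick z) :=
    { summable := hadmy.summable
      rate_cont := hadmy.rate_cont
      int := by
        rw [integrableOn_Icc_iff_integrableOn_Ioo]
        have h1 : IntegrableOn (S.drift x) (Ioo t₁ β) := by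
          refine Integrable.mono' (g := fun _ => R) (integrableOn_const (by simp) enorm_ne_top)
            ((hx.toIsPath.aestronglyMeasurable_drift hS).mono_measure
              (Measure.restrict_mono (fun t ht => hmem t ⟨ht.1.le, ht.2⟩) le_rfl)) ?_
          filter_upwards [ae_restrict_mem measurableSet_Ioo] with t ht
          exact hRd t ⟨ht.1.le, ht.2⟩ 0 zero_mem_J
        refine h1.congr_fun (fun t ht => ?_) measurableSet_Ioo
        simp only [drift, hzx t ht.2]
      cont := fun k hk => by
        rcases hk.2.eq_or_lt with h | h
        · rw [hky k h]
          exact hadmy.cont k hk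
        · rw [hkx k h]
          exact hS.continuousOn_kick hx.toIsPath (hmem _ ⟨hk.1, h⟩)
      bound := by
        refine ⟨R + C, by positivity, fun k hk r hr => ?_⟩
        rcases hk.2.eq_or_lt with h | h
        · rw [hky k h]
          exact (hCk k hk r hr).trans
            (mul_le_mul_of_nonneg_right (le_add_of_nonneg_left hR) (S.rate_nonneg k r))
        · rw [hkx k h]
          exact (hRk k ⟨hk.1, h⟩ r hr).trans
            (mul_le_mul_of_nonneg_right (le_add_of_nonneg_right hC) (S.rate_nonneg k r)) }
  have hβm : β ∈ Icc t₁ β := ⟨ht₁β.le, le_rfl⟩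
  have ht₁m : t₁ ∈ Icc t₁ β := ⟨le_rfl, ht₁β.le⟩
  refine ⟨x t₁ (-1 / 2) + S.flow (S.drift z) (S.kick z) t₁ (-1 / 2) β (-1 / 2),
    Metric.tendstoUniformlyOn_iff.2 fun ε hε => ?_⟩
  have hnhds : 𝓝[<] β = 𝓝[Icc t₁ β ∩ Iio β] β := by
    refine le_antisymm ?_ (nhdsWithin_mono _ inter_subset_right)
    rw [← nhdsWithin_Ioo_eq_nhdsLT ht₁β]
    exact nhdsWithin_mono _ fun r hr => ⟨Ioo_subset_Icc_self hr, hr.2⟩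
  rw [hnhds]
  filter_upwards [self_mem_nhdsWithin,
    Metric.tendstoUniformlyOn_iff.1 (hadm.tendstoUniformlyOn_left hβm) ε hε] with t ht h s hs
  have h1 := h s hs
  have ht' : t ∈ Ico t₁ β := ⟨ht.1.1, ht.2⟩
  have h2 := hx.increment t₁ ht₁ t (hmem t ht') _ neg_half_mem_J s hs
  rw [← flow_congr (x := z) ⟨le_rfl, ht'.1⟩ ⟨ht'.1, le_rfl⟩ fun r hr =>
    hzx r (hr.2.trans_lt ht'.2)] at h2
  rw [dist_zero_left] at h1
  rw [← hadm.flow_add ht₁m ht.1 hβm neg_half_mem_J hs neg_half_mem_J, ← h2, dist_eq_norm,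
    ← add_assoc, add_sub_cancel, add_sub_cancel_left]
  exact h1

/-- By additivity it suffices to know the increments from `(β, -1/2)`. To the right they come from
`y`; to the left they are limits, as `r` increases to `β`, of increments of `x`. -/
theorem IsPathSolution.glue (hS : S.StandingAssumptions Ω) {β : ℝ} {a' : EReal}
    (hx : S.IsPathSolution a β x) (hy : S.IsPathSolution a' b y) (hβ : β ∈ openInterval a' b)
    (hlim : TendstoUniformlyOn x (fun _ => y β (-1 / 2)) (𝓝[<] β) J) :
    S.IsPathSolution a b fun t => if t < β then x t else y t := by
  set z : ℝ → ℝ → Fin n → ℝ := fun t => if t < β then x t else y t with hz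
  have hzx : ∀ t < β, z t = x t := fun t ht => if_pos ht
  have hzy : ∀ t, β ≤ t → z t = y t := fun t ht => if_neg (not_lt.2 ht)
  have hmx : ∀ t ∈ openInterval a b, t < β → t ∈ openInterval a β := fun t ht h =>
    ⟨ht.1, EReal.coe_lt_coe_iff.2 h⟩
  have hmy : ∀ t ∈ openInterval a b, β ≤ t → t ∈ openInterval a' b := fun t ht h =>
    ⟨hβ.1.trans_le (EReal.coe_le_coe_iff.2 h), ht.2⟩
  have hβm : β ∈ openInterval a b := ⟨hx.lt, hβ.2⟩
  have hpath : S.IsPath a b z :=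
    { le_left := hx.le_left
      le_right := hy.le_right
      joins :=
        { cont := fun t ht => by
            rcases lt_or_ge t β with h | h
            · rw [hzx t h]
              exact hx.joins.cont t (hmx t ht h)
            · rw [hzy t h]
              exact hy.joins.cont t (hmy t ht h)
          left := fun t ht => by
            rcases lt_trichotomy t β with h | h | h
            · rw [hzx t h]
              refine (hx.joins.left t (hmx t ht h)).congr ?_
              filter_upwards [mem_nhdsWithin_of_mem_nhds (Iio_mem_nhds h)] with r hr s _
              rw [hzx r hr]
            · subst h
              rw [hzy t le_rfl]
              refine hlim.congr ?_
              filter_upwards [self_mem_nhdsWithin] with r hr s _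
              rw [hzx r hr]
            · rw [hzy t h.le]
              refine (hy.joins.left t (hmy t ht h.le)).congr ?_
              filter_upwards [mem_nhdsWithin_of_mem_nhds (Ioi_mem_nhds h)] with r hr s _
              rw [hzy r (le_of_lt hr)]
          right := fun t ht => by
            rcases lt_or_ge t β with h | h
            · rw [hzx t h]
              refine (hx.joins.right t (hmx t ht h)).congr ?_
              filter_upwards [mem_nhdsWithin_of_mem_nhds (Iio_mem_nhds h)] with r hr s _
              rw [hzx r hr]
            · rw [hzy t h]
              refine (hy.joins.right t (hmy t ht h)).congr ?_
              filter_upwards [self_mem_nhdsWithin] with r hr s _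
              rw [hzy r (h.trans (le_of_lt hr))] }
      mem := fun t ht s hs => by
        rcases lt_or_ge t β with h | h
        · rw [hzx t h]
          exact hx.mem t (hmx t ht h) s hs
        · rw [hzy t h]
          exact hy.mem t (hmy t ht h) s hs }
  -- the increments from the point `(β, -1/2)`
  have key : ∀ t ∈ openInterval a b, ∀ s ∈ J,
      S.flow (S.drift z) (S.kick z) β (-1 / 2) t s = z t s - z β (-1 / 2) := by
    intro t ht s hs
    rcases lt_or_ge t β with h | h
    · obtain ⟨d, hd, hβd⟩ := exists_gt_mem_openInterval hβm
      obtain ⟨c, hc, hct⟩ := exists_lt_mem_openInterval ht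
      have hadm := hS.flowAdm hpath hc hd
      have hβcd : β ∈ Icc c d := ⟨hct.le.trans h.le, hβd.le⟩
      have htcd : t ∈ Icc c d := ⟨hct.le, h.le.trans hβd.le⟩
      -- The flow from `(β, -1/2)` back to `(r, 0)` vanishes in the limit. By additivity it is also
      -- the flow to `(t, s)` plus the increment of `x` from there to `(r, 0)`, which identifies the
      -- former.
      have h1 : Tendsto (fun r => S.flow (S.drift z) (S.kick z) β (-1 / 2) r 0) (𝓝[<] β) (𝓝 0) := by
        have h2 := ((hadm.joins_flow hβcd neg_half_mem_J).left β
          ⟨EReal.coe_lt_coe_iff.2 (hct.trans h), EReal.coe_lt_coe_iff.2 hβd⟩).tendsto_at zero_mem_J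
        rwa [FlowAdm.flow_self] at h2
      have h3 : Tendsto (fun r => S.flow (S.drift z) (S.kick z) β (-1 / 2) t s + (z r 0 - z t s))
          (𝓝[<] β) (𝓝 (S.flow (S.drift z) (S.kick z) β (-1 / 2) t s + (z β (-1 / 2) - z t s))) :=
        tendsto_const_nhds.add
          (((hpath.joins.left β hβm).tendsto_at zero_mem_J).sub tendsto_const_nhds)
      have h4 := tendsto_nhds_unique (h3.congr' ?_) h1
      · rw [eq_neg_of_add_eq_zero_left h4, neg_sub]
      · filter_upwards [Ioo_mem_nhdsLT h] with r hr
        have hrm : r ∈ openInterval a β := ⟨ht.1.trans (EReal.coe_lt_coe_iff.2 hr.1),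
          EReal.coe_lt_coe_iff.2 hr.2⟩
        have h5 := hx.increment t (hmx t ht h) r hrm s hs 0 zero_mem_J
        rw [← flow_congr (x := z) (c := t) (d := r) ⟨le_rfl, hr.1.le⟩ ⟨hr.1.le, le_rfl⟩ fun q hq =>
          hzx q (hq.2.trans_lt hr.2)] at h5
        rw [hzx r hr.2, hzx t h, h5]
        exact hadm.flow_add hβcd htcd ⟨htcd.1.trans hr.1.le, hr.2.le.trans hβcd.2⟩ neg_half_mem_J hs
          zero_mem_J
    · rw [flow_congr (y := y) (c := β) (d := t) ⟨le_rfl, h⟩ ⟨h, le_rfl⟩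
        fun r hr => hzy r hr.1, hzy t h,
        hzy β le_rfl, hy.increment β hβ t (hmy t ht h) _ neg_half_mem_J s hs]
  refine ⟨hpath, hx.lt.trans hβ.2, fun t ht t' ht' s hs s' hs' => ?_⟩
  have hmin : min β (min t t') ∈ openInterval a b := by
    rcases min_choice β (min t t') with h | h <;> rw [h]
    · exact hβm
    · rcases min_choice t t' with h | h <;> rw [h] <;> assumption
  have hmax : max β (max t t') ∈ openInterval a b := by
    rcases max_choice β (max t t') with h | h <;> rw [h]
    · exact hβm
    · rcases max_choice t t' with h | h <;> rw [h] <;> assumption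
  have h1 := (hS.flowAdm hpath hmin hmax).flow_add
    ⟨min_le_left β (min t t'), le_max_left β (max t t')⟩
    ⟨(min_le_right β (min t t')).trans (min_le_left t t'),
      (le_max_left t t').trans (le_max_right β (max t t'))⟩
    ⟨(min_le_right β (min t t')).trans (min_le_right t t'),
      (le_max_right t t').trans (le_max_right β (max t t'))⟩ neg_half_mem_J hs hs'
  rw [key t ht s hs, key t' ht' s' hs'] at h1
  rw [eq_sub_of_add_eq' h1]
  abel

end ImpulsiveSystem

end

end DynamicODE

/-! ### Viability of the constraint set -/

theorem corollary1 {n m : ℕ} (S : DynamicODE.ImpulsiveSystem n)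
    (t₀ : ℝ) (T : EReal) (ht₀ : t₀ ∈ S.I) (hT : (t₀ : EReal) < T) (hTr : T ≤ S.right)
    (hS : S.StandingAssumptions (DynamicODE.openInterval t₀ T))
    (hex : S.HasNoncontinuableSolutions)
    (η : Fin m → (Fin n → ℝ) → ℝ) (hη : ∀ i, ContDiff ℝ 1 (η i))
    (hMN : DynamicODE.constraintSet η ⊆ S.N)
    (hind : ∀ x ∈ frontier (DynamicODE.constraintSet η),
      LinearIndependent ℝ (fun i : {i : Fin m // η i x = 0} => fderiv ℝ (η i) x))
    -- the first inequality, at the times where the ordinary part of `g(·, x)` is defined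
    (hflow : ∀ x ∈ frontier (DynamicODE.constraintSet η), ∀ i, η i x = 0 →
      ∀ t ∈ DynamicODE.openInterval t₀ T,
        (∀ p q, DynamicODE.IsOrdinaryAt (fun r s => S.g r x s p q) t) →
          fderiv ℝ (η i) x (S.f t x + (S.g t x 0).mulVec (S.w t)) ≤ 0)
    (hjump : ∀ x ∈ frontier (DynamicODE.constraintSet η), ∀ i, η i x = 0 →
      ∀ k : ℕ, ∀ s ∈ DynamicODE.J,
        fderiv ℝ (η i) x ((S.g (S.τ k) x s).mulVec (S.c k * S.α k s)) ≤ 0) :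
    S.HasViability t₀ T (DynamicODE.constraintSet η) := by
  open DynamicODE in
  have hΩI : openInterval t₀ T ⊆ S.I := openInterval_mono ht₀.1.le hTr
  have hcont : ∀ i, Continuous (η i) := fun i => (hη i).continuous
  have hin := hS.isInward hΩI hcont hMN hflow hjump
  intro a b x x₀ hfrom hx₀
  have hx := hfrom.isSolution.isPathSolution hS
  have h₀ : x t₀ (-1 / 2) ∈ constraintSet η := by
    rwa [hx.joins.left_unique hfrom.time_mem (tendstoUniformlyOn_of_components hfrom.init)]
  have hviab : ∀ t ∈ openInterval a b, t₀ ≤ t → (t : EReal) < T → ∀ s ∈ J,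
      x t s ∈ constraintSet η := fun t ht htt htT =>
    hx.mem_constraintSet hS hin hη hMN hind hfrom.time_mem h₀ ht htT t ⟨htt, le_rfl⟩
  refine ⟨fun t ht htab => ?_, fun hnc t ht => ?_⟩
  · rcases ht with rfl | ht
    · exact hviab t htab le_rfl hT
    · exact hviab t htab (EReal.coe_lt_coe_iff.1 ht.1).le ht.2
  refine ⟨hfrom.time_mem.1.trans ht.1, ?_⟩
  by_contra hbt
  rw [not_lt] at hbt
  -- If some `t ∈ Ω` is missed, then `b` is a finite time `β` with `t₀ < β < T`.
  lift b to ℝ using ⟨(hbt.trans_lt (EReal.coe_lt_top t)).ne,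
    ((EReal.bot_lt_coe t₀).trans hfrom.time_mem.2).ne'⟩ with β
  have hβT : (β : EReal) < T := hbt.trans_lt ht.2
  have ht₀β : t₀ < β := EReal.coe_lt_coe_iff.1 hfrom.time_mem.2
  have hβI : β ∈ S.I := hΩI ⟨hfrom.time_mem.2, hβT⟩
  -- The bound on the solution starts at `t₁ > t₀`, because it needs `[t₁, β] ⊆ Ω`.
  obtain ⟨t₁, ht₁⟩ := exists_between ht₀β
  obtain ⟨ξ, hξ⟩ := hx.exists_limit hS hβI
    ⟨hfrom.time_mem.1.trans (EReal.coe_lt_coe_iff.2 ht₁.1), EReal.coe_lt_coe_iff.2 ht₁.2⟩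
    (fun r hr => ⟨EReal.coe_lt_coe_iff.2 (ht₁.1.trans_le hr.1),
      (EReal.coe_le_coe_iff.2 hr.2).trans_lt hβT⟩)
  -- The limit stays in the closed set `M ⊆ N`, so it cannot reach the boundary of `N` and is an
  -- admissible initial value at `β`.
  have hξM : ξ ∈ constraintSet η := by
    refine (isClosed_constraintSet hcont).mem_of_tendsto (hξ.tendsto_at zero_mem_J) ?_
    filter_upwards [Ioo_mem_nhdsLT ht₀β] with r hr
    exact hviab r ⟨hfrom.time_mem.1.trans (EReal.coe_lt_coe_iff.2 hr.1),
      EReal.coe_lt_coe_iff.2 hr.2⟩ hr.1.le ((EReal.coe_lt_coe_iff.2 hr.2).trans hβT) 0 zero_mem_J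
  obtain ⟨a', b', y, hy, -⟩ := hex β hβI ξ (hMN hξM)
  have hy' := hy.isSolution.isPathSolution hS
  have hyβ := hy'.joins.left_unique hy.time_mem (tendstoUniformlyOn_of_components hy.init)
  have hz := hx.glue hS hy' hy.time_mem (by rwa [hyβ])
  have := hnc.2 a b' _ (hz.isSolution hS) le_rfl hy.time_mem.2.le fun r hr s _ => by
    rw [if_pos (EReal.coe_lt_coe_iff.1 hr.2)]
  exact hy.time_mem.2.ne' this.2
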